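/- Functions on $(0,\infty)$ are extended to $\mathbb R$ by $0$. Let $B(0,\infty)$ be the bounded Borel functions on $(0,\infty)$, $B(0,\infty)^+$ the nonnegative ones, $\|\cdot\|$ the supremum norm, and $C^1(0,\infty)^+$ the nonnegative bounded continuously differentiable functions on $(0,\infty)$ with bounded derivative. Let $\mathfrak N(0,\infty)$ be the set of integer-valued finite Borel measures on $(0,\infty)$ with the weak topology, $\mathbf 0$ the null measure, $\mathfrak N(0,\infty)^\circ=\mathfrak N(0,\infty)\setminus\{\mathbf 0\}$, and $\langle\nu,f\rangle=\int_{(0,\infty)}f\,d\nu$. Let $\alpha\in C^1(0,\infty)^+$; for each $x>0$ let $\{p(x,i)\}_{i\ge0}$ be a probability distribution on $\mathbb N$ with $p(\cdot,i)\in C^1(0,\infty)^+$ for all $i$; put $g(x,z)=\sum_i p(x,i)z^i$, $g'(x,1-)=\sum_i i\,p(x,i)$, $g''(x,1-)=\sum_i i(i-1)p(x,i)$, and assume $\|g'(\cdot,1-)\|<\infty$. Let $G$ be a Borel probability measure on $(0,\infty)$, $G(t)=G((0,t])$, and let $L$ be a finite measure on $\mathfrak N(0,\infty)^\circ$, with $\psi(f)=\int(1-e^{-\langle\nu,f\rangle})L(d\nu)$.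 For $f\in B(0,\infty)^+$ let $u_tf(x)$ be the unique locally bounded nonnegative solution of $$u_tf(x)=f(x-t)+\int_0^t\alpha(x-s)\bigl[1-g(x-s,\langle G,e^{-u_{t-s}f}\rangle)\bigr]ds,\qquad t\ge0,\ x>0.$$ A Markov process $(Y_t)_{t\ge0}$ in $\mathfrak N(0,\infty)$ is an $(\alpha,g,G,\psi)$-process if its transition semigroup $(P_t)$ satisfies $$\int e^{-\langle\nu,f\rangle}P_t(\sigma,d\nu)=\exp\Bigl\{-\langle\sigma,u_tf\rangle-\int_0^t\psi(u_sf)\,ds\Bigr\},\qquad f\in B(0,\infty)^+,\ t\ge 0,\ \sigma\in\mathfrak N(0,\infty).$$ For $f\in B(0,\infty)$ let $\pi_tf(x)$ be the unique locally bounded solution of $$\pi_tf(x)=f(x-t)+\int_0^t\alpha(x-s)g'(x-s,1-)\langle G,\pi_{t-s}f\rangle ds,\qquad t\ge0,\ x>0,$$ and put $\Pi_\infty f(x)=\int_0^\infty\pi_sf(x)\,ds$. **Theorem.** Assume (a) $\int_0^\infty ds\int_{(s,\infty)}\alpha(x-s)g'(x-s,1-)G(dx)<1$; (b) $\alpha_1\in(0,\infty)$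 is such that $t\mapsto e^{\alpha_1t}[1-G(t)]$ is directly Riemann integrable over $[0,\infty)$ and $\int_0^\infty e^{\alpha_1s}ds\int_{(s,\infty)}\alpha(x-s)g'(x-s,1-)G(dx)=1$; (c) $\int_0^\infty e^{2\alpha_1x}G(dx)<\infty$ and $\|g''(\cdot,1-)\|<\infty$; (d) $\int L(d\nu)\bigl(\int_0^\infty e^{\alpha_1x}\nu(dx)\bigr)^2<\infty$. Here a nonnegative function $h$ on $[0,\infty)$ is directly Riemann integrable if, with $M_n(a)$ and $m_n(a)$ the supremum and infimum of $h$ over $[(n-1)a,na]$, one has $\sum_{n\ge1}aM_n(a)<\infty$ for all $a>0$ and $\lim_{a\to0}\sum_{n\ge1}aM_n(a)=\lim_{a\to0}\sum_{n\ge1}am_n(a)$. Let $\sigma\in\mathfrak N(0,\infty)$, let $(Y_t)_{t\ge0}$ be a realization with right-continuous paths (for instance a càdlàg one) of the $(\alpha,g,G,\psi)$-process with $Y_0=\sigma$ almost surely, defined under a probability measure $\mathbf P_\sigma$, and let $Z_t=\int_0^tY_s\,ds$ be its occupation time process, so that $\langle Z_t,f\rangle=\int_0^t\langle Y_s,f\rangle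 ds$. Then for every $f\in B(0,\infty)$, $\mathbf P_\sigma$-almost surely, $$\frac1t\langle Z_t,f\rangle\longrightarrow\int_{\mathfrak N(0,\infty)^\circ}\langle\nu,\Pi_\infty f\rangle\,L(d\nu)\qquad(t\to\infty),$$ where the solution $\pi_tf$ exists and all the integrals involved converge absolutely: the one defining $\Pi_\infty f(x)$ for every $x>0$, $\langle\nu,\Pi_\infty f\rangle$ for $L$-almost every $\nu$, the integral with respect to $L$, and, $\mathbf P_\sigma$-almost surely, $\langle Z_t,f\rangle$ for all $t\ge0$. -/

import Mathlib

open MeasureTheory ProbabilityTheory Filter Topology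
open scoped ENNReal NNReal

namespace AgeBranching

noncomputable section

/-- The half line `(0, ∞)` of remaining lifetimes. -/
abbrev Pos : Type := Set.Ioi (0 : ℝ)

/-- The space `𝔑(0, ∞)` of integer-valued finite Borel measures on `(0, ∞)`. It carries the
topology of weak convergence and the σ-algebra generated by the maps `ν ↦ ν B`. -/
abbrev PopMeasure : Type :=
  {ν : FiniteMeasure Pos // ∀ B : Set Pos, MeasurableSet B → ∃ n : ℕ, (ν : Measure Pos) B = n}

/-- `ν` as a measure on `(0, ∞)`. -/
def PopMeasure.toM (ν : PopMeasure) : Measure Pos := (ν.1 : Measure Pos)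

/-- The pairing `⟨μ, f⟩ = ∫_{(0, ∞)} f dμ`. Functions on `(0, ∞)` are represented throughout by
functions on `ℝ` (vanishing on `(-∞, 0]`, see `BddBorel`). -/
def pairing (μ : Measure Pos) (f : ℝ → ℝ) : ℝ := ∫ x : Pos, f x ∂μ

/-- `B(0, ∞)`: bounded Borel functions on `(0, ∞)`, extended by `0` to `ℝ`. -/
structure BddBorel (f : ℝ → ℝ) : Prop where
  measurable : Measurable f
  bounded : ∃ C : ℝ, ∀ x, |f x| ≤ C
  zero_off : ∀ x ≤ 0, f x = 0

/-- `C¹(0, ∞)⁺`: nonnegative bounded continuously differentiable functions on `(0, ∞)` with bounded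
derivative, extended by `0` to `ℝ`. -/
structure C1Nonneg (h : ℝ → ℝ) : Prop where
  nonneg : ∀ x, 0 ≤ h x
  bounded : ∃ C : ℝ, ∀ x, h x ≤ C
  differentiable : ∀ x, 0 < x → DifferentiableAt ℝ h x
  deriv_continuous : ContinuousOn (deriv h) (Set.Ioi 0)
  deriv_bounded : ∃ C : ℝ, ∀ x, 0 < x → |deriv h x| ≤ C
  zero_off : ∀ x ≤ 0, h x = 0

/-- The offspring generating function `g(x, z) = ∑ᵢ p(x, i) zⁱ`. -/
def genFun (p : ℝ → ℕ → ℝ) (x z : ℝ) : ℝ := ∑' i : ℕ, p x i * z ^ i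

/-- `g'(x, 1-) = ∑ᵢ i p(x, i)`, the mean number of offspring at a birth event. -/
def genFunDeriv (p : ℝ → ℕ → ℝ) (x : ℝ) : ℝ := ∑' i : ℕ, (i : ℝ) * p x i

/-- `‖g''(·, 1-)‖ < ∞`, where `g''(x, 1-) = ∑ᵢ i (i - 1) p(x, i)`. -/
def BddSecondMoment (p : ℝ → ℕ → ℝ) : Prop :=
  ∃ C : ℝ, ∀ x, 0 < x → Summable (fun i : ℕ => (i : ℝ) * ((i : ℝ) - 1) * p x i) ∧
    ∑' i : ℕ, (i : ℝ) * ((i : ℝ) - 1) * p x i ≤ C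

/-- Standing assumptions on the birth rate `α` and on the offspring laws `p(x, ·)`, `x > 0`. -/
structure BranchingData (α : ℝ → ℝ) (p : ℝ → ℕ → ℝ) : Prop where
  rate_C1 : C1Nonneg α
  law_C1 : ∀ i : ℕ, C1Nonneg (fun x => p x i)
  law_sum : ∀ x, 0 < x → HasSum (p x) 1
  mean_bounded : ∃ C : ℝ, ∀ x, 0 < x → Summable (fun i : ℕ => (i : ℝ) * p x i) ∧
    genFunDeriv p x ≤ C

/-- `u` is bounded on `[0, T] × (0, ∞)` for every `T`. -/
def LocBdd (u : ℝ → ℝ → ℝ) : Prop :=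
  ∀ T : ℝ, ∃ C : ℝ, ∀ t x : ℝ, 0 ≤ t → t ≤ T → 0 < x → |u t x| ≤ C

/-- `u` is a locally bounded positive Borel solution `(t, x) ↦ u_t f(x)`, on `t ≥ 0`, `x > 0`, of
`u_t f(x) = f(x-t) + ∫₀ᵗ α(x-s) [1 - g(x-s, ⟨G, exp(-u_{t-s} f)⟩)] ds`. -/
structure SolvesCumulant (α : ℝ → ℝ) (p : ℝ → ℕ → ℝ) (G : Measure Pos) (f : ℝ → ℝ)
    (u : ℝ → ℝ → ℝ) : Prop where
  measurable : Measurable (Function.uncurry u)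
  nonneg : ∀ t x : ℝ, 0 ≤ t → 0 < x → 0 ≤ u t x
  locBdd : LocBdd u
  eqn : ∀ t x : ℝ, 0 ≤ t → 0 < x →
    u t x = f (x - t) + ∫ s in (0 : ℝ)..t,
      α (x - s) * (1 - genFun p (x - s) (pairing G fun y => Real.exp (-u (t - s) y)))

/-- `u_t f(x)`, the solution of the cumulant equation (it exists for `f ∈ B(0, ∞)⁺` and is unique
on `t ≥ 0`, `x > 0`, the only arguments at which it is used). -/
def cumulant (α : ℝ → ℝ) (p : ℝ → ℕ → ℝ) (G : Measure Pos) (f : ℝ → ℝ) : ℝ → ℝ → ℝ :=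
  Classical.epsilon (SolvesCumulant α p G f)

/-- `m` is a locally bounded Borel solution `(t, x) ↦ π_t f(x)`, on `t ≥ 0`, `x > 0`, of
`π_t f(x) = f(x-t) + ∫₀ᵗ α(x-s) g'(x-s, 1-) ⟨G, π_{t-s} f⟩ ds`. -/
structure SolvesMean (α : ℝ → ℝ) (p : ℝ → ℕ → ℝ) (G : Measure Pos) (f : ℝ → ℝ)
    (m : ℝ → ℝ → ℝ) : Prop where
  measurable : Measurable (Function.uncurry m)
  locBdd : LocBdd m
  eqn : ∀ t x : ℝ, 0 ≤ t → 0 < x →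
    m t x = f (x - t) + ∫ s in (0 : ℝ)..t,
      α (x - s) * genFunDeriv p (x - s) * pairing G (m (t - s))

/-- `π_t f(x)`, the solution of the mean equation (it exists for `f ∈ B(0, ∞)` and is unique on
`t ≥ 0`, `x > 0`, the only arguments at which it is used). -/
def meanSemigroup (α : ℝ → ℝ) (p : ℝ → ℕ → ℝ) (G : Measure Pos) (f : ℝ → ℝ) : ℝ → ℝ → ℝ :=
  Classical.epsilon (SolvesMean α p G f)

/-- `Π_∞ f(x) = ∫₀^∞ π_s f(x) ds`. -/
def totalMean (α : ℝ → ℝ) (p : ℝ → ℕ → ℝ) (G : Measure Pos) (f : ℝ → ℝ) (x : ℝ) : ℝ :=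
  ∫ s in Set.Ioi (0 : ℝ), meanSemigroup α p G f s x

/-- The immigration functional `ψ(f) = ∫ (1 - exp(-⟨ν, f⟩)) L(dν)`. -/
def immigration (L : Measure PopMeasure) (f : ℝ → ℝ) : ℝ :=
  ∫ ν, (1 - Real.exp (-pairing ν.toM f)) ∂L

/-- `(P_t)` is the transition semigroup of the `(α, g, G, ψ)`-process: for `f ∈ B(0, ∞)⁺`,
`∫ exp(-⟨ν, f⟩) P_t(σ, dν) = exp(-⟨σ, u_t f⟩ - ∫₀ᵗ ψ(u_s f) ds)`. -/
def IsTransition (α : ℝ → ℝ) (p : ℝ → ℕ → ℝ) (G : Measure Pos) (L : Measure PopMeasure)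
    (P : ℝ≥0 → Kernel PopMeasure PopMeasure) : Prop :=
  (∀ t, IsMarkovKernel (P t)) ∧
  ∀ f : ℝ → ℝ, BddBorel f → (∀ x, 0 ≤ f x) → ∀ (t : ℝ≥0) (σ : PopMeasure),
    ∫ ν, Real.exp (-pairing ν.toM f) ∂(P t σ) =
      Real.exp (-pairing σ.toM (cumulant α p G f t) -
        ∫ s in (0 : ℝ)..t, immigration L (cumulant α p G f s))

/-- `Y` is a right-continuous realization, started from `σ`, of the `(α, g, G, ψ)`-process with
respect to the filtration `ℱ`: a Markov process with state space `𝔑(0, ∞)` and transition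
semigroup as in `IsTransition`. -/
structure IsProcess {Ω : Type*} {mΩ : MeasurableSpace Ω} (Pr : Measure Ω) (ℱ : Filtration ℝ≥0 mΩ)
    (α : ℝ → ℝ) (p : ℝ → ℕ → ℝ) (G : Measure Pos) (L : Measure PopMeasure) (σ : PopMeasure)
    (Y : ℝ≥0 → Ω → PopMeasure) : Prop where
  adapted : ∀ t, Measurable[ℱ t] (Y t)
  start : ∀ᵐ ω ∂Pr, Y 0 ω = σ
  right_continuous : ∀ ω t, ContinuousWithinAt (fun s => Y s ω) (Set.Ici t) t
  markov : ∃ P : ℝ≥0 → Kernel PopMeasure PopMeasure, IsTransition α p G L P ∧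
    ∀ (s t : ℝ≥0) (F : PopMeasure → ℝ), Measurable F → (∃ C : ℝ, ∀ ν, |F ν| ≤ C) →
      Pr[fun ω => F (Y (s + t) ω) | ℱ s] =ᵐ[Pr] fun ω => ∫ ν, F ν ∂(P t (Y s ω))

/-- `⟨Z_t, f⟩ = ∫₀ᵗ ⟨Y_s, f⟩ ds`, where `Z_t = ∫₀ᵗ Y_s ds` is the occupation time process. -/
def occupation {Ω : Type*} (Y : ℝ≥0 → Ω → PopMeasure) (f : ℝ → ℝ) (t : ℝ) (ω : Ω) : ℝ :=
  ∫ s in (0 : ℝ)..t, pairing (Y s.toNNReal ω).toM f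

/-- Direct Riemann integrability over `[0, ∞)` of a nonnegative function: with `Mₙ(a)`, `mₙ(a)`
the supremum and infimum of `h` over `[(n-1)a, na]`, the sums `∑ₙ a Mₙ(a)` (`n ≥ 1`) are finite for
all `a > 0`, and `∑ₙ a Mₙ(a)` and `∑ₙ a mₙ(a)` have the same limit as `a ↓ 0`. -/
def DirectlyRiemannIntegrable (h : ℝ → ℝ) : Prop :=
  let upper : ℝ → ℝ≥0∞ := fun a => ∑' n : ℕ, ENNReal.ofReal a *
    ⨆ t ∈ Set.Icc ((n : ℝ) * a) (((n : ℝ) + 1) * a), ENNReal.ofReal (h t)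
  let lower : ℝ → ℝ≥0∞ := fun a => ∑' n : ℕ, ENNReal.ofReal a *
    ⨅ t ∈ Set.Icc ((n : ℝ) * a) (((n : ℝ) + 1) * a), ENNReal.ofReal (h t)
  (∀ a : ℝ, 0 < a → upper a < ⊤) ∧
    ∃ l : ℝ≥0∞, Tendsto upper (𝓝[>] 0) (𝓝 l) ∧ Tendsto lower (𝓝[>] 0) (𝓝 l)

/-- `∫₀^∞ e^{c s} ds ∫_{(s, ∞)} α(x-s) g'(x-s, 1-) G(dx)`. -/
def reproduction (α : ℝ → ℝ) (p : ℝ → ℕ → ℝ) (G : Measure Pos) (c : ℝ) : ℝ≥0∞ :=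
  ∫⁻ s in Set.Ioi (0 : ℝ), ENNReal.ofReal (Real.exp (c * s)) *
    ∫⁻ x in {x : Pos | s < (x : ℝ)}, ENNReal.ofReal (α (x - s) * genFunDeriv p (x - s)) ∂G

/-- Subcriticality together with the Malthusian-type exponent `α₁ > 0`. -/
structure SubcriticalMalthus (α : ℝ → ℝ) (p : ℝ → ℕ → ℝ) (G : Measure Pos) (α₁ : ℝ) : Prop where
  subcritical : reproduction α p G 0 < 1
  pos : 0 < α₁
  tail_dri : DirectlyRiemannIntegrable fun t =>
    Real.exp (α₁ * t) * (1 - G.real {x : Pos | (x : ℝ) ≤ t})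
  malthus : reproduction α p G α₁ = 1

end

end AgeBranching

open AgeBranching

/-!
Write `β(x) = α(x) g'(x, 1-)` and fix `c > 0`. When the reproduction kernel, tilted by `e^{cs}`,
still has mass less than `1`, the renewal equation gives `|π_t f(x)| ≤ C ‖f‖ e^{c(x-t)}`, so that
`Π_∞ f` is well defined and `⟨ν, Π_∞ f⟩` is dominated by `⟨ν, e^{c ·}⟩`. For `c = α₁ / 2` the
tilted mass is at most the average of those for `0` and `α₁`, which are less than `1` and equal
to `1`.

The first two moments of `⟨Y_t, f⟩` come from the behaviour of the Laplace functional along `θ f`,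
`θ ↓ 0`: there `u_t(θ f) ≤ θ π_t f`, with an error of order `θ² e^{c(x-t)}` which is again
controlled by the renewal equation. Hence the second moments are bounded uniformly in time, the
mean given `Y_s` approaches its limit at rate `e^{-ct}`, and by the Markov property the
correlations of `⟨Y_s, f⟩` and `⟨Y_{s+t}, f⟩`, centred at the limit, are `O(e^{-ct})`. So the time
average has variance `O(1/t)`. For `f ≥ 0` it converges almost surely along `t = n²` and, since
`⟨Z_t, f⟩` is monotone, along all `t`; a signed `f` is split into its positive and negative parts.
-/

namespace AgeBranching

lemma intervalIntegrable_of_abs_le {g : ℝ → ℝ} {C a b : ℝ} (hg : Measurable g) (hab : a ≤ b)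
    (h : ∀ s, a < s → s ≤ b → |g s| ≤ C) : IntervalIntegrable g volume a b := by
  rw [intervalIntegrable_iff_integrableOn_Ioc_of_le hab]
  exact Measure.integrableOn_of_bounded (by simp) hg.aestronglyMeasurable
    ((ae_restrict_mem measurableSet_Ioc).mono fun s hs => h s hs.1 hs.2)

lemma measurable_intervalIntegral {S : Type*} [MeasurableSpace S] {F : S → ℝ → ℝ} {T : S → ℝ}
    (hT : Measurable T) (hF : Measurable (Function.uncurry F)) :
    Measurable fun q => ∫ s in (0 : ℝ)..T q, F q s := by
  have rescale (q : S) :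
      ∫ s in (0 : ℝ)..T q, F q s = T q * ∫ r in Set.Ioc (0 : ℝ) 1, F q (T q * r) := by
    rw [← intervalIntegral.integral_of_le zero_le_one,
      intervalIntegral.mul_integral_comp_mul_left, mul_zero, mul_one]
  simp only [rescale]
  have hG : Measurable (Function.uncurry fun q r => F q (T q * r)) :=
    hF.comp (measurable_fst.prodMk ((hT.comp measurable_fst).mul measurable_snd))
  exact hT.mul hG.stronglyMeasurable.integral_prod_right.measurable

lemma le_div_one_sub_of_selfImproving {ι : Type*} {v : ι → ℝ} {κ b : ℝ}
    (hv : BddAbove (Set.range v)) (hκ0 : 0 ≤ κ) (hκ1 : κ < 1) (hb : 0 ≤ b)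
    (himp : ∀ M, 0 ≤ M → (∀ i, v i ≤ M) → ∀ i, v i ≤ κ * M + b) (i : ι) :
    v i ≤ b / (1 - κ) := by
  have : Nonempty ι := ⟨i⟩
  have hκ : 0 < 1 - κ := sub_pos.2 hκ1
  set M := max (⨆ i, v i) 0
  have hM : ∀ i, v i ≤ M := fun i => (le_ciSup hv i).trans (le_max_left _ _)
  have hM0 : 0 ≤ M := le_max_right _ _
  have hself : M ≤ κ * M + b := max_le (ciSup_le (himp M hM0 hM)) (by positivity)
  exact (hM i).trans ((le_div_iff₀ hκ).2 (by linarith))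

section Volterra

variable {Φ : (ℝ → ℝ) → ℝ → ℝ} {B D E : ℝ} {y z : ℝ → ℝ}

/-- Measurable functions with the growth `|y t| ≤ D e^{ct}`, `t ≥ 0`, the class on which Picard
iteration for Volterra equations is carried out. -/
structure ExpGrowth (c D : ℝ) (y : ℝ → ℝ) : Prop where
  measurable : Measurable y
  abs_le : ∀ t, 0 ≤ t → |y t| ≤ D * Real.exp (c * t)

lemma mul_integral_mul_exp (c D t : ℝ) :
    c * ∫ s in (0 : ℝ)..t, D * Real.exp (c * s) = D * Real.exp (c * t) - D := by
  have hderiv (s : ℝ) :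
      HasDerivAt (fun s => D * Real.exp (c * s)) (c * (D * Real.exp (c * s))) s :=
    (((hasDerivAt_id' s).const_mul c).exp.const_mul D).congr_deriv (by ring)
  rw [← intervalIntegral.integral_const_mul,
    intervalIntegral.integral_eq_sub_of_hasDerivAt (fun s _ => hderiv s)
      (by apply Continuous.intervalIntegrable; fun_prop)]
  simp

/-- A functional of Volterra type: `Φ y t` sees `y` only on `[0, t]`, with a Lipschitz bound `B`.
The bound is required only on the growth class `ExpGrowth (2 * B) D`, which `Φ` maps into
itself. -/
structure IsVolterra (B D : ℝ) (Φ : (ℝ → ℝ) → ℝ → ℝ) : Prop where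
  nonneg : 0 ≤ B
  measurable : ∀ y, Measurable y → Measurable (Φ y)
  abs_zero_le : ∀ t, 0 ≤ t → |Φ 0 t| ≤ D
  lipschitz : ∀ y z, ExpGrowth (2 * B) D y → ExpGrowth (2 * B) D z → ∀ t, 0 ≤ t →
    |Φ y t - Φ z t| ≤ B * ∫ s in (0 : ℝ)..t, |y s - z s|

namespace IsVolterra

variable (hΦ : IsVolterra B D Φ)
include hΦ

lemma const_nonneg : 0 ≤ D := (abs_nonneg _).trans (hΦ.abs_zero_le 0 le_rfl)

lemma expGrowth_zero : ExpGrowth (2 * B) D 0 :=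
  ⟨measurable_const, fun t _ => by simpa using mul_nonneg hΦ.const_nonneg (Real.exp_pos _).le⟩

-- In the norm `sup e^{-2Bt}|y t|` a Volterra functional contracts by the factor `1/2`.
lemma abs_sub_le (hy : ExpGrowth (2 * B) D y) (hz : ExpGrowth (2 * B) D z)
    (hyz : ∀ s, 0 ≤ s → |y s - z s| ≤ E * Real.exp (2 * B * s)) {t : ℝ} (ht : 0 ≤ t) :
    |Φ y t - Φ z t| ≤ E / 2 * (Real.exp (2 * B * t) - 1) := by
  have hint : ∫ s in (0 : ℝ)..t, |y s - z s| ≤ ∫ s in (0 : ℝ)..t, E * Real.exp (2 * B * s) := by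
    have hdom : Continuous fun s => E * Real.exp (2 * B * s) := by fun_prop
    exact (le_abs_self _).trans (intervalIntegral.norm_integral_le_of_norm_le ht
      (f := fun s => |y s - z s|) (.of_forall fun s hs => by simpa using hyz s hs.1.le)
      (hdom.intervalIntegrable _ _))
  linarith [hΦ.lipschitz y z hy hz t ht, mul_le_mul_of_nonneg_left hint hΦ.nonneg,
    mul_integral_mul_exp (2 * B) E t]

lemma expGrowth (hy : ExpGrowth (2 * B) D y) : ExpGrowth (2 * B) D (Φ y) := by
  refine ⟨hΦ.measurable y hy.measurable, fun t ht => ?_⟩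
  have hsub := hΦ.abs_sub_le hy hΦ.expGrowth_zero (E := D) (by simpa using hy.abs_le) ht
  have hexp : 1 ≤ Real.exp (2 * B * t) :=
    Real.one_le_exp (mul_nonneg (mul_nonneg zero_le_two hΦ.nonneg) ht)
  calc |Φ y t| = |Φ 0 t + (Φ y t - Φ 0 t)| := by ring_nf
    _ ≤ D + D / 2 * (Real.exp (2 * B * t) - 1) :=
      (abs_add_le _ _).trans (add_le_add (hΦ.abs_zero_le t ht) hsub)
    _ ≤ D * Real.exp (2 * B * t) := by nlinarith [hΦ.const_nonneg]

lemma expGrowth_iterate (n : ℕ) : ExpGrowth (2 * B) D (Φ^[n] 0) := by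
  induction n with
  | zero => exact hΦ.expGrowth_zero
  | succ n ih => rw [Function.iterate_succ_apply']; exact hΦ.expGrowth ih

lemma dist_iterate_le (n : ℕ) {t : ℝ} (ht : 0 ≤ t) :
    dist (Φ^[n] 0 t) (Φ^[n + 1] 0 t) ≤ 2 * (D * Real.exp (2 * B * t)) / 2 / 2 ^ n := by
  induction n generalizing t with
  | zero => simpa [dist_eq_norm] using (hΦ.expGrowth_iterate 1).abs_le t ht
  | succ n ih =>
    have hprev (s : ℝ) (hs : 0 ≤ s) :
        |Φ^[n] 0 s - Φ^[n + 1] 0 s| ≤ D / 2 ^ n * Real.exp (2 * B * s) :=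
      (ih hs).trans_eq (by ring)
    have hD := hΦ.const_nonneg
    rw [Function.iterate_succ_apply' Φ n, Function.iterate_succ_apply' Φ (n + 1), dist_eq_norm]
    calc |Φ (Φ^[n] 0) t - Φ (Φ^[n + 1] 0) t|
        ≤ D / 2 ^ n / 2 * (Real.exp (2 * B * t) - 1) :=
          hΦ.abs_sub_le (hΦ.expGrowth_iterate n) (hΦ.expGrowth_iterate _) hprev ht
      _ ≤ D / 2 ^ n / 2 * Real.exp (2 * B * t) := by gcongr; linarith
      _ = _ := by rw [pow_succ]; field_simp

lemma exists_limit_iterate : ∃ y, Measurable y ∧ ∀ t, 0 ≤ t →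
    Tendsto (fun n => Φ^[n] 0 t) atTop (𝓝 (y t)) := by
  have hlim (t : ℝ) : ∃ l, Tendsto (fun n => (Set.Ici 0).indicator (Φ^[n] 0) t) atTop (𝓝 l) := by
    by_cases ht : 0 ≤ t
    · simpa only [Set.indicator_of_mem (Set.mem_Ici.2 ht)] using cauchySeq_tendsto_of_complete
        (cauchySeq_of_le_geometric_two fun n => hΦ.dist_iterate_le n ht)
    · simp only [Set.indicator_of_notMem (mt Set.mem_Ici.1 ht)]
      exact ⟨0, tendsto_const_nhds⟩
  choose y hy using hlim
  refine ⟨y, measurable_of_tendsto_metrizable (fun n => ?_) (tendsto_pi_nhds.2 hy), fun t ht => ?_⟩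
  · exact (hΦ.expGrowth_iterate n).measurable.indicator measurableSet_Ici
  · simpa only [Set.indicator_of_mem (Set.mem_Ici.2 ht)] using hy t

theorem exists_fixedPoint :
    ∃ y, ExpGrowth (2 * B) D y ∧ ∀ t, 0 ≤ t → y t = Φ y t := by
  obtain ⟨y, hymeas, hy⟩ := hΦ.exists_limit_iterate
  have hgrowth : ExpGrowth (2 * B) D y :=
    ⟨hymeas, fun t ht => le_of_tendsto (hy t ht).abs
      (.of_forall fun n => (hΦ.expGrowth_iterate n).abs_le t ht)⟩
  have hrate (n : ℕ) (s : ℝ) (hs : 0 ≤ s) :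
      |y s - Φ^[n] 0 s| ≤ 2 * D / 2 ^ n * Real.exp (2 * B * s) := by
    rw [abs_sub_comm]
    exact (dist_le_of_le_geometric_two_of_tendsto (fun n => hΦ.dist_iterate_le n hs)
      (hy s hs) n).trans_eq (by ring)
  refine ⟨y, hgrowth, fun t ht =>
    tendsto_nhds_unique ((tendsto_add_atTop_iff_nat 1).2 (hy t ht)) ?_⟩
  have hΦy (n : ℕ) : |Φ^[n + 1] 0 t - Φ y t| ≤
      2 * D / 2 * (Real.exp (2 * B * t) - 1) * (1 / 2) ^ n := by
    rw [Function.iterate_succ_apply', abs_sub_comm]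
    refine (hΦ.abs_sub_le hgrowth (hΦ.expGrowth_iterate n) (hrate n) ht).trans_eq ?_
    rw [one_div_pow]
    ring
  refine tendsto_iff_dist_tendsto_zero.2 (squeeze_zero (fun n => dist_nonneg) hΦy ?_)
  simpa using (tendsto_pow_atTop_nhds_zero_of_lt_one (r := (1 / 2 : ℝ)) (by norm_num)
    (by norm_num)).const_mul (2 * D / 2 * (Real.exp (2 * B * t) - 1))

end IsVolterra

end Volterra

section LaplaceMoments

lemma sub_sq_div_two_le_one_sub_exp_neg {y : ℝ} (hy : 0 ≤ y) :
    y - y ^ 2 / 2 ≤ 1 - Real.exp (-y) := by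
  have hquad : 0 < 1 + y + y ^ 2 / 2 := by positivity
  have hexp : Real.exp (-y) * (1 + y + y ^ 2 / 2) ≤ 1 := by
    rw [Real.exp_neg, inv_mul_le_one₀ (Real.exp_pos y)]
    exact Real.quadratic_le_exp_of_nonneg hy
  have hle : Real.exp (-y) ≤ 1 - y + y ^ 2 / 2 :=
    le_of_mul_le_mul_right (hexp.trans (by nlinarith [sq_nonneg (y ^ 2)])) hquad
  linarith

lemma one_sub_exp_neg_le (y : ℝ) : 1 - Real.exp (-y) ≤ y := by
  linarith [Real.add_one_le_exp (-y)]

lemma one_sub_exp_neg_nonneg {y : ℝ} (hy : 0 ≤ y) : 0 ≤ 1 - Real.exp (-y) :=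
  sub_nonneg.2 (Real.exp_le_one_iff.2 (neg_nonpos.2 hy))

lemma tendsto_one_sub_exp_neg_div (x : ℝ) :
    Tendsto (fun θ => (1 - Real.exp (-(θ * x))) / θ) (𝓝[>] 0) (𝓝 x) := by
  have hderiv : HasDerivAt (fun θ : ℝ => 1 - Real.exp (-(θ * x))) x 0 := by
    simpa using (((hasDerivAt_id' (0 : ℝ)).mul_const x).neg.exp.const_sub 1)
  refine (hderiv.tendsto_slope_zero_right).congr fun θ => ?_
  simp [div_eq_inv_mul]

lemma tendsto_two_mul_sub_one_sub_exp_neg_div (x : ℝ) :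
    Tendsto (fun θ => 2 * (x - (1 - Real.exp (-(θ * x))) / θ) / θ) (𝓝[>] 0) (𝓝 (x ^ 2)) := by
  have hscale : Tendsto (fun θ : ℝ => -(θ * x)) (𝓝[>] 0) (𝓝 0) :=
    ((by fun_prop : Continuous fun θ : ℝ => -(θ * x)).tendsto' 0 0 (by simp)).mono_left
      nhdsWithin_le_nhds
  have htaylor := (Real.exp_sub_sum_range_succ_isLittleO_pow 2).comp_tendsto hscale
  have hpow : (fun θ : ℝ => (-(θ * x)) ^ 2) =O[𝓝[>] 0] fun θ => θ ^ 2 :=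
    (Asymptotics.isBigO_const_mul_self (x ^ 2) (fun θ : ℝ => θ ^ 2) _).congr_left fun θ => by ring
  have hrem := ((htaylor.trans_isBigO hpow).tendsto_div_nhds_zero.const_mul 2).add_const (x ^ 2)
  rw [mul_zero, zero_add] at hrem
  refine hrem.congr' ?_
  filter_upwards [self_mem_nhdsWithin] with θ (hθ : 0 < θ)
  simp only [Function.comp, Finset.sum_range_succ, Finset.range_zero, Finset.sum_empty,
    Nat.factorial]
  field_simp
  push_cast
  ring

variable {S : Type*} [MeasurableSpace S] {Q : Measure S} {X : S → ℝ} {U : ℝ → ℝ} {m V : ℝ}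

lemma integrable_and_integral_le_of_tendsto {ι : Type*} {l : Filter ι} [NeBot l]
    [l.IsCountablyGenerated] {φ : ι → S → ℝ} (hX : Measurable X) (hφ : ∀ i, Measurable (φ i))
    (hlim : ∀ q, Tendsto (fun i => φ i q) l (𝓝 (X q)))
    (hle : ∀ᶠ i in l, (∀ q, 0 ≤ φ i q) ∧ Integrable (φ i) Q ∧ ∫ q, φ i q ∂Q ≤ m) :
    Integrable X Q ∧ ∫ q, X q ∂Q ≤ m := by
  have hX0 (q : S) : 0 ≤ X q := ge_of_tendsto (hlim q) (hle.mono fun i hi => hi.1 q)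
  have hm0 : 0 ≤ m := by
    obtain ⟨i, hi0, -, him⟩ := hle.exists
    exact (integral_nonneg hi0).trans him
  have hfatou : ∫⁻ q, ENNReal.ofReal (X q) ∂Q ≤ ENNReal.ofReal m :=
    calc ∫⁻ q, ENNReal.ofReal (X q) ∂Q
        = ∫⁻ q, liminf (fun i => ENNReal.ofReal (φ i q)) l ∂Q :=
          lintegral_congr fun q => (ENNReal.tendsto_ofReal (hlim q)).liminf_eq.symm
      _ ≤ liminf (fun i => ∫⁻ q, ENNReal.ofReal (φ i q) ∂Q) l :=
          lintegral_liminf_le fun i => (hφ i).ennreal_ofReal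
      _ ≤ ENNReal.ofReal m := by
          refine (liminf_le_liminf (hle.mono fun i hi => ?_)).trans_eq (liminf_const _)
          rw [← ofReal_integral_eq_lintegral_ofReal hi.2.1 (.of_forall hi.1)]
          exact ENNReal.ofReal_le_ofReal hi.2.2
  have hXi : Integrable X Q := ⟨hX.aestronglyMeasurable, by
    rw [hasFiniteIntegral_iff_ofReal (.of_forall hX0)]
    exact hfatou.trans_lt ENNReal.ofReal_lt_top⟩
  rw [← ofReal_integral_eq_lintegral_ofReal hXi (.of_forall hX0)] at hfatou
  exact ⟨hXi, (ENNReal.ofReal_le_ofReal_iff hm0).1 hfatou⟩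

lemma integrable_exp_neg [IsFiniteMeasure Q] (hX : Measurable X) (hX0 : ∀ q, 0 ≤ X q) :
    Integrable (fun q => Real.exp (-X q)) Q :=
  .of_bound (by fun_prop) 1 (.of_forall fun q => by
    simpa [abs_of_pos (Real.exp_pos _)] using hX0 q)

variable [IsProbabilityMeasure Q]

lemma integral_one_sub_exp_neg_div (hX : Measurable X) (hX0 : ∀ q, 0 ≤ X q) {θ : ℝ} (hθ : 0 < θ)
    (hU : ∫ q, Real.exp (-(θ * X q)) ∂Q = Real.exp (-U θ)) :
    Integrable (fun q => (1 - Real.exp (-(θ * X q))) / θ) Q ∧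
      ∫ q, (1 - Real.exp (-(θ * X q))) / θ ∂Q = (1 - Real.exp (-U θ)) / θ := by
  have hexp : Integrable (fun q => Real.exp (-(θ * X q))) Q :=
    integrable_exp_neg (hX.const_mul θ) fun q => mul_nonneg hθ.le (hX0 q)
  refine ⟨((integrable_const 1).sub hexp).div_const θ, ?_⟩
  rw [integral_div, integral_sub (integrable_const 1) hexp, hU, integral_const, probReal_univ,
    one_smul]

lemma log_laplace_nonneg (hX0 : ∀ q, 0 ≤ X q) {θ : ℝ} (hθ : 0 < θ)
    (hU : ∫ q, Real.exp (-(θ * X q)) ∂Q = Real.exp (-U θ)) : 0 ≤ U θ := by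
  have hle : ∫ q, Real.exp (-(θ * X q)) ∂Q ≤ ∫ _, (1 : ℝ) ∂Q :=
    integral_mono_of_nonneg (.of_forall fun q => (Real.exp_pos _).le) (integrable_const _)
      (.of_forall fun q => Real.exp_le_one_iff.2 (neg_nonpos.2 (mul_nonneg hθ.le (hX0 q))))
  rw [hU, integral_const, probReal_univ, one_smul, Real.exp_le_one_iff] at hle
  exact neg_nonpos.1 hle

lemma one_sub_exp_neg_div_mem_Icc {θ u : ℝ} (hθ : 0 < θ) (hu : 0 ≤ u) (hle : u ≤ θ * m)
    (hge : θ * m - θ ^ 2 * V ≤ u) :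
    (1 - Real.exp (-u)) / θ ∈ Set.Icc (m - θ * (V + m ^ 2 / 2)) m := by
  constructor
  · rw [le_div_iff₀ hθ]
    have hsq : u ^ 2 ≤ (θ * m) ^ 2 := pow_le_pow_left₀ hu hle 2
    nlinarith [sub_sq_div_two_le_one_sub_exp_neg hu]
  · rw [div_le_iff₀ hθ]
    linarith [one_sub_exp_neg_le u]

/-- If the Laplace exponent `U` of `X` satisfies `U θ = θ m + O(θ²)`, then `X` has mean `m` and a
second moment controlled by the constant in the error term. -/
theorem moments_of_laplace (hX : Measurable X) (hX0 : ∀ q, 0 ≤ X q)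
    (hU : ∀ θ, 0 < θ → ∫ q, Real.exp (-(θ * X q)) ∂Q = Real.exp (-U θ))
    (hle : ∀ θ, 0 < θ → U θ ≤ θ * m) (hge : ∀ θ, 0 < θ → θ * m - θ ^ 2 * V ≤ U θ) :
    Integrable X Q ∧ ∫ q, X q ∂Q = m ∧ Integrable (fun q => X q ^ 2) Q ∧
      ∫ q, X q ^ 2 ∂Q ≤ 2 * V + m ^ 2 := by
  set φ : ℝ → S → ℝ := fun θ q => (1 - Real.exp (-(θ * X q))) / θ with hφ
  have hφi (θ : ℝ) (hθ : 0 < θ) := integral_one_sub_exp_neg_div hX hX0 hθ (hU θ hθ)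
  have hφb (θ : ℝ) (hθ : 0 < θ) : ∫ q, φ θ q ∂Q ∈ Set.Icc (m - θ * (V + m ^ 2 / 2)) m := by
    rw [hφ, (hφi θ hθ).2]
    exact one_sub_exp_neg_div_mem_Icc hθ (log_laplace_nonneg hX0 hθ (hU θ hθ)) (hle θ hθ) (hge θ hθ)
  have hφ0 (θ : ℝ) (hθ : 0 < θ) (q : S) : 0 ≤ φ θ q :=
    div_nonneg (one_sub_exp_neg_nonneg (mul_nonneg hθ.le (hX0 q))) hθ.le
  have hφX (θ : ℝ) (hθ : 0 < θ) (q : S) : φ θ q ≤ X q := by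
    rw [hφ, div_le_iff₀' hθ]
    exact one_sub_exp_neg_le _
  obtain ⟨hXi, hXm⟩ := integrable_and_integral_le_of_tendsto (l := 𝓝[>] (0 : ℝ)) (Q := Q) (m := m)
    (φ := φ) hX (fun θ => by fun_prop) (fun q => tendsto_one_sub_exp_neg_div (X q))
    (eventually_mem_nhdsWithin.mono fun θ hθ => ⟨hφ0 θ hθ, (hφi θ hθ).1, (hφb θ hθ).2⟩)
  have hmean : ∫ q, X q ∂Q = m := by
    refine hXm.antisymm (le_of_tendsto (x := 𝓝[>] (0 : ℝ))
      (f := fun θ : ℝ => m - θ * (V + m ^ 2 / 2)) ?_ ?_)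
    · exact ((by fun_prop : Continuous fun θ : ℝ => m - θ * (V + m ^ 2 / 2)).tendsto' 0 m
        (by simp)).mono_left nhdsWithin_le_nhds
    · exact eventually_mem_nhdsWithin.mono fun θ hθ =>
        (hφb θ hθ).1.trans (integral_mono (hφi θ hθ).1 hXi (hφX θ hθ))
  have hsq := integrable_and_integral_le_of_tendsto (l := 𝓝[>] (0 : ℝ)) (Q := Q)
    (m := 2 * V + m ^ 2) (X := fun q => X q ^ 2) (φ := fun θ q => 2 * (X q - φ θ q) / θ)
    (by fun_prop) (fun θ => by fun_prop)
    (fun q => tendsto_two_mul_sub_one_sub_exp_neg_div (X q))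
    (eventually_mem_nhdsWithin.mono fun θ (hθ : 0 < θ) =>
      ⟨fun q => div_nonneg (by linarith [hφX θ hθ q]) hθ.le,
        ((hXi.sub (hφi θ hθ).1).const_mul 2).div_const θ, ?_⟩)
  · exact ⟨hXi, hmean, hsq⟩
  · rw [integral_div, integral_const_mul, integral_sub hXi (hφi θ hθ).1, hmean, div_le_iff₀ hθ]
    linarith [(hφb θ hθ).1]

end LaplaceMoments

section TimeAverage

lemma tendsto_inv_mul_of_squares {Z : ℝ → ℝ} {a : ℝ} (hmono : MonotoneOn Z (Set.Ici 0))
    (h0 : 0 ≤ Z 0)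
    (hlim : Tendsto (fun n : ℕ => ((n : ℝ) ^ 2)⁻¹ * Z ((n : ℝ) ^ 2)) atTop (𝓝 a)) :
    Tendsto (fun t => t⁻¹ * Z t) atTop (𝓝 a) := by
  have hZ0 (t : ℝ) (ht : 0 ≤ t) : 0 ≤ Z t := h0.trans (hmono Set.self_mem_Ici ht ht)
  have hfloor : Tendsto (fun t : ℝ => ⌊√t⌋₊) atTop atTop :=
    tendsto_nat_floor_atTop.comp Real.tendsto_sqrt_atTop
  have hratio : Tendsto (fun n : ℕ => ((n : ℝ) / (n + 1)) ^ 2) atTop (𝓝 1) := by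
    simpa using (tendsto_natCast_div_add_atTop (1 : ℝ)).pow 2
  have hlow : Tendsto (fun n : ℕ => ((n : ℝ) / (n + 1)) ^ 2 * (((n : ℝ) ^ 2)⁻¹ * Z ((n : ℝ) ^ 2)))
      atTop (𝓝 a) := by simpa using hratio.mul hlim
  have hup : Tendsto (fun n : ℕ => (((n : ℝ) / (n + 1)) ^ 2)⁻¹ *
      ((((n + 1 : ℕ) : ℝ) ^ 2)⁻¹ * Z (((n + 1 : ℕ) : ℝ) ^ 2))) atTop (𝓝 a) := by
    simpa using (hratio.inv₀ one_ne_zero).mul (hlim.comp (tendsto_add_atTop_nat 1))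
  have hbracket (t : ℝ) (ht : 1 ≤ t) :
      (0 : ℝ) < ⌊√t⌋₊ ∧ (⌊√t⌋₊ : ℝ) ^ 2 ≤ t ∧ t ≤ ((⌊√t⌋₊ : ℝ) + 1) ^ 2 := by
    have hsq : √t ^ 2 = t := Real.sq_sqrt (by linarith)
    refine ⟨Nat.cast_pos.2 (Nat.floor_pos.2 (Real.one_le_sqrt.2 ht)), ?_, ?_⟩
    · exact (pow_le_pow_left₀ (Nat.cast_nonneg _)
        (Nat.floor_le (Real.sqrt_nonneg t)) 2).trans_eq hsq
    · exact hsq.symm.trans_le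
        (pow_le_pow_left₀ (Real.sqrt_nonneg t) (Nat.lt_floor_add_one _).le 2)
  refine tendsto_of_tendsto_of_tendsto_of_le_of_le' (hlow.comp hfloor) (hup.comp hfloor) ?_ ?_
  all_goals
    filter_upwards [eventually_ge_atTop (1 : ℝ)] with t ht
    obtain ⟨hn, hle, hge⟩ := hbracket t ht
    simp only [Function.comp]
    generalize (⌊√t⌋₊) = n at *
    have ht0 : 0 ≤ t := by linarith
  · calc ((n : ℝ) / (n + 1)) ^ 2 * (((n : ℝ) ^ 2)⁻¹ * Z ((n : ℝ) ^ 2))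
        = (((n : ℝ) + 1) ^ 2)⁻¹ * Z ((n : ℝ) ^ 2) := by field_simp
      _ ≤ t⁻¹ * Z t := mul_le_mul (inv_anti₀ (by linarith) hge)
        (hmono (Set.mem_Ici.2 (by positivity)) ht0 hle) (hZ0 _ (by positivity)) (by positivity)
  · calc t⁻¹ * Z t
      _ ≤ ((n : ℝ) ^ 2)⁻¹ * Z (((n : ℝ) + 1) ^ 2) :=
        mul_le_mul (inv_anti₀ (by positivity) hle)
          (hmono ht0 (Set.mem_Ici.2 (by positivity)) hge) (hZ0 _ ht0) (by positivity)
      _ = _ := by push_cast; field_simp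

lemma ae_tendsto_zero_of_summable {S : Type*} [MeasurableSpace S] {μ : Measure S}
    {g : ℕ → S → ℝ} {B : ℕ → ℝ} (hg0 : ∀ n q, 0 ≤ g n q) (hg : ∀ n, Integrable (g n) μ)
    (hle : ∀ n, ∫ q, g n q ∂μ ≤ B n) (hB : Summable B) :
    ∀ᵐ q ∂μ, Tendsto (fun n => g n q) atTop (𝓝 0) := by
  have hsum : ∫⁻ q, ∑' n, ENNReal.ofReal (g n q) ∂μ ≠ ⊤ := by
    rw [lintegral_tsum fun n => (hg n).aemeasurable.ennreal_ofReal]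
    refine ne_top_of_le_ne_top hB.tsum_ofReal_ne_top (ENNReal.tsum_le_tsum fun n => ?_)
    rw [← ofReal_integral_eq_lintegral_ofReal (hg n) (.of_forall (hg0 n))]
    exact ENNReal.ofReal_le_ofReal (hle n)
  filter_upwards [ae_lt_top' (.tsum fun n => (hg n).aemeasurable.ennreal_ofReal) hsum] with q hq
  refine ((ENNReal.tendsto_toReal ENNReal.zero_ne_top).comp
    (ENNReal.tendsto_atTop_zero_of_tsum_ne_top hq.ne)).congr fun n => ?_
  exact ENNReal.toReal_ofReal (hg0 n q)

lemma integrable_exp_neg_mul_abs {c : ℝ} (hc : 0 < c) :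
    Integrable fun r : ℝ => Real.exp (-(c * |r|)) := by
  rw [← integrableOn_univ, ← Set.Iic_union_Ioi (a := (0 : ℝ))]
  refine IntegrableOn.union ?_ ?_
  · refine (integrableOn_exp_mul_Iic hc 0).congr_fun (fun r hr => ?_) measurableSet_Iic
    simp only [abs_of_nonpos (Set.mem_Iic.1 hr), mul_neg, neg_neg]
  · refine (integrableOn_exp_mul_Ioi (neg_neg_of_pos hc) 0).congr_fun (fun r hr => ?_)
      measurableSet_Ioi
    simp only [abs_of_pos (Set.mem_Ioi.1 hr), neg_mul]

lemma setIntegral_exp_neg_mul_abs_sub_le {c : ℝ} (hc : 0 < c) (A : Set ℝ) (s : ℝ) :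
    ∫ r in A, Real.exp (-(c * |r - s|)) ≤ ∫ r, Real.exp (-(c * |r|)) :=
  (setIntegral_le_integral ((integrable_exp_neg_mul_abs hc).comp_sub_right s)
    (.of_forall fun _ => (Real.exp_pos _).le)).trans_eq
    (integral_sub_right_eq_self (fun r => Real.exp (-(c * |r|))) s)

lemma ae_mem_Ioc_prod (T : ℝ) :
    ∀ᵐ q ∂(volume.restrict (Set.Ioc 0 T)).prod (volume.restrict (Set.Ioc 0 T)),
      q.1 ∈ Set.Ioc 0 T ∧ q.2 ∈ Set.Ioc 0 T :=
  (Measure.quasiMeasurePreserving_fst.ae (ae_restrict_mem measurableSet_Ioc)).and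
    (Measure.quasiMeasurePreserving_snd.ae (ae_restrict_mem measurableSet_Ioc))

variable {Ω : Type*} {mΩ : MeasurableSpace Ω} {Pr : Measure Ω} {ξ : ℝ → Ω → ℝ} {C c T : ℝ}

lemma integrable_prod_of_integral_norm_le {S : Type*} [MeasurableSpace S] {μ : Measure S}
    [IsFiniteMeasure μ] [SFinite Pr] {F : S × Ω → ℝ} (hF : Measurable F)
    (hint : ∀ᵐ q ∂μ, Integrable (fun ω => F (q, ω)) Pr) (hle : ∀ᵐ q ∂μ, ∫ ω, ‖F (q, ω)‖ ∂Pr ≤ C) :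
    Integrable F (μ.prod Pr) := by
  refine (integrable_prod_iff hF.aestronglyMeasurable).2 ⟨hint, ?_⟩
  refine .of_bound hF.norm.stronglyMeasurable.integral_prod_right'.aestronglyMeasurable C
    (hle.mono fun q hq => ?_)
  rwa [Real.norm_eq_abs, abs_of_nonneg (integral_nonneg fun ω => norm_nonneg _)]

/-- A square integrable process on `[0, ∞)` whose correlations decay exponentially in the time
lag. -/
structure ExpDecorrelated (Pr : Measure Ω) (ξ : ℝ → Ω → ℝ) (C c : ℝ) : Prop where
  measurable : Measurable (Function.uncurry ξ)
  rate_pos : 0 < c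
  integrable_sq : ∀ s, 0 ≤ s → Integrable (fun ω => ξ s ω ^ 2) Pr
  corr_le : ∀ s t, 0 ≤ s → 0 ≤ t → ∫ ω, ξ s ω * ξ (s + t) ω ∂Pr ≤ C * Real.exp (-(c * t))

namespace ExpDecorrelated

lemma integral_sq_le (h : ExpDecorrelated Pr ξ C c) {s : ℝ} (hs : 0 ≤ s) :
    ∫ ω, ξ s ω ^ 2 ∂Pr ≤ C := by
  simpa [← sq] using h.corr_le s 0 hs le_rfl

lemma const_nonneg (h : ExpDecorrelated Pr ξ C c) : 0 ≤ C :=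
  (integral_nonneg fun _ => sq_nonneg _).trans (h.integral_sq_le le_rfl)

lemma measurable_apply (h : ExpDecorrelated Pr ξ C c) (s : ℝ) : Measurable (ξ s) :=
  h.measurable.of_uncurry_left

lemma integrable_mul (h : ExpDecorrelated Pr ξ C c) {s r : ℝ} (hs : 0 ≤ s) (hr : 0 ≤ r) :
    Integrable (fun ω => ξ s ω * ξ r ω) Pr :=
  ((memLp_two_iff_integrable_sq (h.measurable_apply s).aestronglyMeasurable).2
    (h.integrable_sq s hs)).integrable_mul
    ((memLp_two_iff_integrable_sq (h.measurable_apply r).aestronglyMeasurable).2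
      (h.integrable_sq r hr))

lemma integral_norm_mul_le (h : ExpDecorrelated Pr ξ C c) {s r : ℝ} (hs : 0 ≤ s) (hr : 0 ≤ r) :
    ∫ ω, ‖ξ s ω * ξ r ω‖ ∂Pr ≤ C + C := by
  calc ∫ ω, ‖ξ s ω * ξ r ω‖ ∂Pr ≤ ∫ ω, (ξ s ω ^ 2 + ξ r ω ^ 2) ∂Pr :=
        integral_mono (h.integrable_mul hs hr).norm
          ((h.integrable_sq s hs).add (h.integrable_sq r hr)) fun ω => by
            dsimp only
            rw [Real.norm_eq_abs, abs_le]
            constructor <;> nlinarith [sq_nonneg (ξ s ω + ξ r ω), sq_nonneg (ξ s ω - ξ r ω)]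
    _ = ∫ ω, ξ s ω ^ 2 ∂Pr + ∫ ω, ξ r ω ^ 2 ∂Pr :=
        integral_add (h.integrable_sq s hs) (h.integrable_sq r hr)
    _ ≤ C + C := add_le_add (h.integral_sq_le hs) (h.integral_sq_le hr)

lemma integral_mul_le (h : ExpDecorrelated Pr ξ C c) {s r : ℝ} (hs : 0 ≤ s) (hr : 0 ≤ r) :
    ∫ ω, ξ s ω * ξ r ω ∂Pr ≤ C * Real.exp (-(c * |r - s|)) := by
  wlog hsr : s ≤ r generalizing s r
  · simpa only [mul_comm (ξ r _), abs_sub_comm s r] using this hr hs (le_of_not_ge hsr)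
  · simpa only [add_sub_cancel, abs_of_nonneg (sub_nonneg.2 hsr)] using
      h.corr_le s (r - s) hs (sub_nonneg.2 hsr)

lemma integrable_sq_prod [SFinite Pr] (h : ExpDecorrelated Pr ξ C c) (T : ℝ) :
    Integrable (fun q : ℝ × Ω => ξ q.1 q.2 ^ 2) ((volume.restrict (Set.Ioc 0 T)).prod Pr) := by
  have hmem : ∀ᵐ s ∂volume.restrict (Set.Ioc 0 T), s ∈ Set.Ioc 0 T :=
    ae_restrict_mem measurableSet_Ioc
  refine integrable_prod_of_integral_norm_le (C := C) (h.measurable.pow_const 2)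
    (hmem.mono fun s hs => h.integrable_sq s hs.1.le) (hmem.mono fun s hs => ?_)
  simpa using h.integral_sq_le hs.1.le

lemma integrable_uncurry [IsFiniteMeasure Pr] (h : ExpDecorrelated Pr ξ C c) (T : ℝ) :
    Integrable (Function.uncurry ξ) ((volume.restrict (Set.Ioc 0 T)).prod Pr) :=
  ((memLp_two_iff_integrable_sq h.measurable.aestronglyMeasurable).2
    (h.integrable_sq_prod T)).integrable one_le_two

lemma integrable_mul_prod [SFinite Pr] (h : ExpDecorrelated Pr ξ C c) (T : ℝ) :
    Integrable (fun z : (ℝ × ℝ) × Ω => ξ z.1.1 z.2 * ξ z.1.2 z.2)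
      (((volume.restrict (Set.Ioc 0 T)).prod (volume.restrict (Set.Ioc 0 T))).prod Pr) := by
  have hξ := h.measurable
  refine integrable_prod_of_integral_norm_le (C := C + C) (by fun_prop)
    ((ae_mem_Ioc_prod T).mono fun q hq => h.integrable_mul hq.1.1.le hq.2.1.le)
    ((ae_mem_Ioc_prod T).mono fun q hq => h.integral_norm_mul_le hq.1.1.le hq.2.1.le)

lemma integral_exp_neg_abs_sub_prod_le (h : ExpDecorrelated Pr ξ C c) (hT : 0 ≤ T) :
    Integrable (fun q : ℝ × ℝ => C * Real.exp (-(c * |q.2 - q.1|)))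
      ((volume.restrict (Set.Ioc 0 T)).prod (volume.restrict (Set.Ioc 0 T))) ∧
    ∫ q, C * Real.exp (-(c * |q.2 - q.1|))
        ∂(volume.restrict (Set.Ioc 0 T)).prod (volume.restrict (Set.Ioc 0 T)) ≤
      C * (∫ r, Real.exp (-(c * |r|))) * T := by
  have hc := h.rate_pos
  have hC := h.const_nonneg
  have hint : Integrable (fun q : ℝ × ℝ => C * Real.exp (-(c * |q.2 - q.1|)))
      ((volume.restrict (Set.Ioc 0 T)).prod (volume.restrict (Set.Ioc 0 T))) := by
    refine .of_bound (by fun_prop : Measurable _).aestronglyMeasurable C (.of_forall fun q => ?_)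
    rw [Real.norm_eq_abs, abs_of_nonneg (by positivity)]
    exact mul_le_of_le_one_right hC
      (Real.exp_le_one_iff.2 (neg_nonpos.2 (mul_nonneg hc.le (abs_nonneg _))))
  refine ⟨hint, ?_⟩
  calc ∫ q, C * Real.exp (-(c * |q.2 - q.1|))
        ∂(volume.restrict (Set.Ioc 0 T)).prod (volume.restrict (Set.Ioc 0 T))
      = ∫ s in Set.Ioc 0 T, ∫ r in Set.Ioc 0 T, C * Real.exp (-(c * |r - s|)) :=
        integral_prod _ hint
    _ ≤ ∫ _ in Set.Ioc 0 T, C * ∫ r, Real.exp (-(c * |r|)) :=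
        integral_mono hint.integral_prod_left (integrable_const _) fun s => by
          rw [integral_const_mul]
          exact mul_le_mul_of_nonneg_left (setIntegral_exp_neg_mul_abs_sub_le hc _ s) hC
    _ = C * (∫ r, Real.exp (-(c * |r|))) * T := by simp [hT, mul_comm]

lemma integral_sq_setIntegral_le [SFinite Pr] (h : ExpDecorrelated Pr ξ C c) (hT : 0 ≤ T) :
    Integrable (fun ω => (∫ s in Set.Ioc 0 T, ξ s ω) ^ 2) Pr ∧
      ∫ ω, (∫ s in Set.Ioc 0 T, ξ s ω) ^ 2 ∂Pr ≤ C * (∫ r, Real.exp (-(c * |r|))) * T := by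
  have hF := h.integrable_mul_prod T
  have hsq (ω : Ω) : (∫ s in Set.Ioc 0 T, ξ s ω) ^ 2 = ∫ q, ξ q.1 ω * ξ q.2 ω
      ∂(volume.restrict (Set.Ioc 0 T)).prod (volume.restrict (Set.Ioc 0 T)) := by
    rw [sq]
    exact (integral_prod_mul (fun s => ξ s ω) (fun s => ξ s ω)).symm
  obtain ⟨hexp, hexp_le⟩ := h.integral_exp_neg_abs_sub_prod_le hT
  simp only [hsq]
  refine ⟨hF.integral_prod_right, ?_⟩
  rw [← integral_integral_swap (f := fun (q : ℝ × ℝ) ω => ξ q.1 ω * ξ q.2 ω) hF]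
  exact (integral_mono_ae hF.integral_prod_left hexp ((ae_mem_Ioc_prod T).mono fun q hq =>
    h.integral_mul_le hq.1.1.le hq.2.1.le)).trans hexp_le

lemma ae_integrableOn [IsFiniteMeasure Pr] (h : ExpDecorrelated Pr ξ C c) :
    ∀ᵐ ω ∂Pr, ∀ T : ℝ, IntegrableOn (fun s => ξ s ω) (Set.Ioc 0 T) := by
  have hnat : ∀ᵐ ω ∂Pr, ∀ n : ℕ, IntegrableOn (fun s => ξ s ω) (Set.Ioc 0 (n : ℝ)) :=
    ae_all_iff.2 fun n => (h.integrable_uncurry n).prod_left_ae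
  filter_upwards [hnat] with ω hω T
  obtain ⟨n, hn⟩ := exists_nat_ge T
  exact (hω n).mono_set (Set.Ioc_subset_Ioc_right hn)

lemma ae_tendsto_squares [SFinite Pr] (h : ExpDecorrelated Pr ξ C c) :
    ∀ᵐ ω ∂Pr, Tendsto (fun n : ℕ => ((n : ℝ) ^ 2)⁻¹ * ∫ s in Set.Ioc 0 ((n : ℝ) ^ 2), ξ s ω)
      atTop (𝓝 0) := by
  set J := ∫ r : ℝ, Real.exp (-(c * |r|))
  have hsecond (n : ℕ) := h.integral_sq_setIntegral_le (T := (n : ℝ) ^ 2) (by positivity)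
  have hsq : ∀ᵐ ω ∂Pr, Tendsto (fun n : ℕ =>
      (((n : ℝ) ^ 2)⁻¹ * ∫ s in Set.Ioc 0 ((n : ℝ) ^ 2), ξ s ω) ^ 2) atTop (𝓝 0) := by
    refine ae_tendsto_zero_of_summable (B := fun n : ℕ => C * J * (1 / (n : ℝ) ^ 2))
      (fun n ω => sq_nonneg _) (fun n => ?_) (fun n => ?_)
      ((Real.summable_one_div_nat_pow.2 one_lt_two).mul_left _)
    · simpa only [mul_pow] using (hsecond n).1.const_mul _
    · simp only [mul_pow]
      rw [integral_const_mul]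
      refine (mul_le_mul_of_nonneg_left (hsecond n).2 (by positivity)).trans_eq ?_
      rcases eq_or_ne (n : ℝ) 0 with hn | hn
      · simp [hn]
      · field_simp
        rfl
  filter_upwards [hsq] with ω hω
  have := hω.sqrt
  simp only [Real.sqrt_sq_eq_abs, Real.sqrt_zero] at this
  exact (tendsto_zero_iff_abs_tendsto_zero _).2 this

end ExpDecorrelated

/-- The second moment bound gives convergence along the times `n²`, and monotonicity of
`t ↦ ∫₀ᵗ X` fills the gaps. -/
theorem ae_tendsto_time_average [IsFiniteMeasure Pr] {X : ℝ → Ω → ℝ} {a : ℝ}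
    (hX0 : ∀ s ω, 0 ≤ X s ω) (h : ExpDecorrelated Pr (fun s ω => X s ω - a) C c) :
    ∀ᵐ ω ∂Pr, (∀ t, 0 ≤ t → IntervalIntegrable (fun s => X s ω) volume 0 t) ∧
      Tendsto (fun t => t⁻¹ * ∫ s in (0 : ℝ)..t, X s ω) atTop (𝓝 a) := by
  filter_upwards [h.ae_integrableOn, h.ae_tendsto_squares] with ω hint hlim
  have hXi (t : ℝ) (ht : 0 ≤ t) : IntervalIntegrable (fun s => X s ω) volume 0 t := by
    rw [intervalIntegrable_iff_integrableOn_Ioc_of_le ht]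
    have hadd : IntegrableOn (fun s => X s ω - a + a) (Set.Ioc 0 t) :=
      (hint t).add (integrable_const a)
    simpa only [sub_add_cancel] using hadd
  refine ⟨hXi, tendsto_inv_mul_of_squares (fun t ht r hr htr => ?_) (by simp) ?_⟩
  · exact intervalIntegral.integral_mono_interval le_rfl (Set.mem_Ici.1 ht) htr
      (.of_forall fun s => hX0 s ω) (hXi r hr)
  · refine ((hlim.add_const a).congr' ?_).trans_eq (by rw [zero_add])
    filter_upwards [eventually_ne_atTop 0] with n hn
    have hn0 : (n : ℝ) ≠ 0 := Nat.cast_ne_zero.2 hn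
    have hT : (0 : ℝ) ≤ (n : ℝ) ^ 2 := by positivity
    rw [← intervalIntegral.integral_of_le hT,
      intervalIntegral.integral_sub (hXi _ hT) intervalIntegrable_const,
      intervalIntegral.integral_const, sub_zero, smul_eq_mul, mul_sub,
      inv_mul_cancel_left₀ (pow_ne_zero 2 hn0), sub_add_cancel]

end TimeAverage

section RightContinuous

/-- The right end point of the cell of mesh `1 / (k + 1)` that contains `s`. Right-continuous
functions are approximated by their values on this grid. -/
noncomputable def upperGrid (k : ℕ) (s : ℝ≥0) : ℝ≥0 := (⌊s * (k + 1)⌋₊ + 1) / (k + 1)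

lemma tendsto_upperGrid (s : ℝ≥0) : Tendsto (fun k => upperGrid k s) atTop (𝓝[≥] s) := by
  have hpos (k : ℕ) : (0 : ℝ≥0) < k + 1 := by positivity
  have hge (k : ℕ) : s ≤ upperGrid k s :=
    (le_div_iff₀ (hpos k)).2 (Nat.lt_floor_add_one _).le
  have hle (k : ℕ) : upperGrid k s ≤ s + 1 / (k + 1) := by
    rw [upperGrid, div_le_iff₀ (hpos k), add_mul, one_div, inv_mul_cancel₀ (hpos k).ne']
    gcongr
    exact Nat.floor_le (by positivity)
  have hmesh : Tendsto (fun k : ℕ => s + 1 / ((k : ℝ≥0) + 1)) atTop (𝓝 s) := by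
    simpa using tendsto_const_nhds.add (tendsto_one_div_add_atTop_nhds_zero_nat (𝕜 := ℝ≥0))
  exact tendsto_nhdsWithin_iff.2 ⟨tendsto_of_tendsto_of_tendsto_of_le_of_le tendsto_const_nhds hmesh
    hge hle, .of_forall hge⟩

variable {Ω : Type*} [MeasurableSpace Ω]

lemma measurable_upperGrid (k : ℕ) : Measurable (upperGrid k) := by
  unfold upperGrid
  exact ((measurable_from_nat (f := fun n : ℕ => (n : ℝ≥0))).comp
    (measurable_id.mul_const _).nat_floor).add_const 1 |>.div_const _

lemma countable_range_upperGrid (k : ℕ) : (Set.range (upperGrid k)).Countable :=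
  (Set.countable_range fun n : ℕ => ((n : ℝ≥0) + 1) / (k + 1)).mono
    (Set.range_subset_iff.2 fun s => Set.mem_range_self ⌊s * (k + 1)⌋₊)

lemma measurable_comp_of_countable_range {E T : Type*} [MeasurableSpace E] [MeasurableSpace T]
    [MeasurableSingletonClass T] {Z : T → Ω → E} (hm : ∀ t, Measurable (Z t)) {a : T → T}
    (ha : Measurable a) (hcount : (Set.range a).Countable) :
    Measurable fun q : T × Ω => Z (a q.1) q.2 := by
  have : Countable (Set.range a) := hcount.to_subtype
  have hrange : Measurable fun z : Set.range a × Ω => Z z.1 z.2 :=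
    measurable_from_prod_countable_right fun t => hm t
  have hval : Measurable (Set.rangeFactorization a) := ha.subtype_mk
  exact hrange.comp (hval.prodMap measurable_id)

lemma measurable_uncurry_of_rightContinuous {E : Type*} [TopologicalSpace E]
    [TopologicalSpace.PseudoMetrizableSpace E] [MeasurableSpace E] [BorelSpace E]
    {Z : ℝ≥0 → Ω → E} (hm : ∀ t, Measurable (Z t))
    (hc : ∀ ω t, ContinuousWithinAt (fun s => Z s ω) (Set.Ici t) t) :
    Measurable (Function.uncurry Z) :=
  measurable_of_tendsto_metrizable
    (fun k => measurable_comp_of_countable_range hm (measurable_upperGrid k)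
      (countable_range_upperGrid k))
    (tendsto_pi_nhds.2 fun q => (hc q.2 q.1).tendsto.comp (tendsto_upperGrid q.1))

lemma measurable_finiteMeasure_of_lintegral {E S : Type*} [TopologicalSpace E] [MeasurableSpace E]
    [BorelSpace E] [HasOuterApproxClosed E] [MeasurableSpace S] {ν : S → FiniteMeasure E}
    (h : ∀ φ : BoundedContinuousFunction E ℝ≥0, Measurable fun q => ∫⁻ x, φ x ∂(ν q : Measure E)) :
    Measurable ν := by
  have hclosed (F : Set E) (hF : IsClosed F) : Measurable fun q => (ν q : Measure E) F :=
    measurable_of_tendsto_metrizable (fun n => h (hF.apprSeq n))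
      (tendsto_pi_nhds.2 fun q => HasOuterApproxClosed.tendsto_lintegral_apprSeq hF _)
  have hmeasure : Measurable fun q => (ν q : Measure E) :=
    Measurable.measure_of_isPiSystem (S := {s : Set E | IsClosed s})
      (by rw [BorelSpace.measurable_eq (α := E), borel_eq_generateFrom_isClosed])
      isPiSystem_isClosed hclosed (hclosed _ isClosed_univ)
  exact hmeasure.subtype_mk

lemma measurable_uncurry_finiteMeasure_of_rightContinuous {E : Type*} [TopologicalSpace E]
    [MeasurableSpace E] [BorelSpace E] [HasOuterApproxClosed E] {Z : ℝ≥0 → Ω → FiniteMeasure E}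
    (hm : ∀ t, Measurable (Z t))
    (hc : ∀ ω t, ContinuousWithinAt (fun s => Z s ω) (Set.Ici t) t) :
    Measurable (Function.uncurry Z) := by
  refine measurable_finiteMeasure_of_lintegral fun φ => ?_
  have hφ : Measurable fun x : E => (φ x : ℝ≥0∞) := φ.continuous.measurable.coe_nnreal_ennreal
  exact measurable_uncurry_of_rightContinuous (Z := fun t ω => ∫⁻ x, φ x ∂(Z t ω : Measure E))
    (fun t => (Measure.measurable_lintegral hφ).comp (measurable_subtype_coe.comp (hm t)))
    fun ω t => FiniteMeasure.tendsto_iff_forall_lintegral_tendsto.1 (hc ω t) φ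

end RightContinuous

lemma isSFiniteKernel_of_isFiniteMeasure {S E : Type*} [MeasurableSpace S] [MeasurableSpace E]
    (κ : Kernel S E) (hκ : ∀ a, IsFiniteMeasure (κ a)) : IsSFiniteKernel κ := by
  classical
  let size (a : S) : ℕ := ⌈(κ a Set.univ).toNNReal⌉₊
  have hsize : Measurable size := (κ.measurable_coe .univ).ennreal_toNNReal.nat_ceil
  have hlevel (n : ℕ) : MeasurableSet (size ⁻¹' {n}) := hsize (measurableSet_singleton n)
  refine ⟨fun n => Kernel.piecewise (hlevel n) κ 0, fun n => ⟨n, by simp, fun a => ?_⟩, ?_⟩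
  · rw [Kernel.piecewise_apply]
    split_ifs with h
    · have hn : size a = n := h
      rw [← ENNReal.coe_toNNReal (measure_ne_top (κ a) _), ← hn]
      exact_mod_cast Nat.le_ceil (κ a Set.univ).toNNReal
    · simp
  · ext a s hs
    rw [Kernel.sum_apply' _ _ hs, tsum_eq_single (size a), Kernel.piecewise_apply,
      if_pos (by simp)]
    intro n hn
    rw [Kernel.piecewise_apply, if_neg (by simpa using hn.symm)]
    simp

lemma PopMeasure.measurable_toM : Measurable PopMeasure.toM :=
  measurable_subtype_coe.comp measurable_subtype_coe

instance (ν : PopMeasure) : IsFiniteMeasure ν.toM := by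
  unfold PopMeasure.toM; infer_instance

/-- The kernel `ν ↦ ν` from populations to `(0, ∞)`. Seeing a random population as a kernel makes
the measurability of `⟨ν, f⟩` an instance of the measurability of kernel integrals. -/
noncomputable def popKernel : Kernel PopMeasure Pos := ⟨PopMeasure.toM, PopMeasure.measurable_toM⟩

instance : IsSFiniteKernel popKernel :=
  isSFiniteKernel_of_isFiniteMeasure popKernel fun ν =>
    inferInstanceAs (IsFiniteMeasure ν.toM)

section Pairing

variable {S : Type*} [MeasurableSpace S] {F : S → ℝ → ℝ} {μ : Measure Pos} {f g : ℝ → ℝ} {C : ℝ}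

lemma measurable_pairing_prod (hF : Measurable (Function.uncurry F)) :
    Measurable fun q : S × PopMeasure => pairing q.2.toM (F q.1) := by
  have hF' : Measurable (Function.uncurry fun (q : S × PopMeasure) (x : Pos) => F q.1 x) :=
    hF.comp (measurable_fst.fst.prodMk (measurable_subtype_coe.comp measurable_snd))
  exact (hF'.stronglyMeasurable.integral_kernel_prod_right
    (κ := Kernel.prodMkLeft S popKernel)).measurable

lemma measurable_pairing (hf : Measurable f) :
    Measurable fun ν : PopMeasure => pairing ν.toM f :=
  (measurable_pairing_prod (F := fun _ : Unit => f) (hf.comp measurable_snd)).comp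
    (measurable_prodMk_left (x := ()))

lemma measurable_pairing_left [SFinite μ] (hF : Measurable (Function.uncurry F)) :
    Measurable fun s => pairing μ (F s) := by
  have hF' : Measurable (Function.uncurry fun (s : S) (x : Pos) => F s x) :=
    hF.comp (measurable_fst.prodMk (measurable_subtype_coe.comp measurable_snd))
  exact hF'.stronglyMeasurable.integral_prod_right.measurable

lemma integrable_of_abs_le [IsFiniteMeasure μ] (hf : Measurable f)
    (h : ∀ x, 0 < x → |f x| ≤ C) : Integrable (fun x : Pos => f x) μ :=
  .of_bound (hf.comp measurable_subtype_coe).aestronglyMeasurable C (.of_forall fun x => h x x.2)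

lemma pairing_mono (hf : Integrable (fun x : Pos => f x) μ) (hg : Integrable (fun x : Pos => g x) μ)
    (h : ∀ x, 0 < x → f x ≤ g x) : pairing μ f ≤ pairing μ g :=
  integral_mono hf hg fun x => h x x.2

lemma pairing_nonneg (h : ∀ x, 0 < x → 0 ≤ f x) : 0 ≤ pairing μ f :=
  integral_nonneg fun x => h x x.2

lemma pairing_congr (h : ∀ x, 0 < x → f x = g x) : pairing μ f = pairing μ g :=
  integral_congr_ae (.of_forall fun x => h x x.2)

lemma abs_pairing_le (hg : Integrable (fun x : Pos => g x) μ) (h : ∀ x, 0 < x → |f x| ≤ g x) :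
    |pairing μ f| ≤ pairing μ g :=
  norm_integral_le_of_norm_le (f := fun x : Pos => f x) hg (.of_forall fun x => h x x.2)

lemma abs_pairing_le_of_abs_le [IsProbabilityMeasure μ] (h : ∀ x, 0 < x → |f x| ≤ C) :
    |pairing μ f| ≤ C := by
  simpa [pairing] using abs_pairing_le (μ := μ) (g := fun _ => C) (integrable_const C) h

end Pairing

-- An integer-valued measure vanishes on every set of mass less than `1`.
lemma PopMeasure.exists_support_bound (ν : PopMeasure) :
    ∃ N : ℝ, ∀ᵐ x : Pos ∂ν.toM, (x : ℝ) ≤ N := by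
  have hmeas (n : ℕ) : MeasurableSet {x : Pos | (n : ℝ) < x} :=
    measurableSet_lt measurable_const measurable_subtype_coe
  have hempty : ⋂ n : ℕ, {x : Pos | (n : ℝ) < x} = ∅ := by
    refine Set.eq_empty_of_forall_notMem fun x hx => ?_
    obtain ⟨n, hn⟩ := exists_nat_ge (x : ℝ)
    exact (Set.mem_iInter.1 hx n).not_ge hn
  have htail : Tendsto (fun n : ℕ => ν.toM {x : Pos | (n : ℝ) < x}) atTop (𝓝 0) := by
    rw [← measure_empty (μ := ν.toM), ← hempty]
    refine tendsto_measure_iInter_atTop (fun n => (hmeas n).nullMeasurableSet)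
      (fun m n hmn x hx => ?_) ⟨0, measure_ne_top _ _⟩
    exact (Nat.cast_le.2 hmn).trans_lt (Set.mem_ofPred_eq ▸ hx)
  obtain ⟨n, hn⟩ := (htail.eventually (gt_mem_nhds zero_lt_one)).exists
  obtain ⟨k, hk⟩ := ν.2 _ (hmeas n)
  have hkν : ν.toM {x : Pos | (n : ℝ) < x} = k := hk
  have hk0 : k = 0 := Nat.lt_one_iff.1 (by exact_mod_cast hkν ▸ hn)
  exact ⟨n, by simpa [ae_iff, hk0] using hkν⟩

lemma PopMeasure.integrable_exp (ν : PopMeasure) {c : ℝ} (hc : 0 ≤ c) :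
    Integrable (fun x : Pos => Real.exp (c * x)) ν.toM := by
  obtain ⟨N, hN⟩ := ν.exists_support_bound
  refine .of_bound (by fun_prop : Measurable _).aestronglyMeasurable (Real.exp (c * N)) ?_
  filter_upwards [hN] with x hx
  rw [Real.norm_eq_abs, Real.abs_exp]
  exact Real.exp_le_exp.2 (mul_le_mul_of_nonneg_left hx hc)

section Convolution

variable {β : ℝ → ℝ} {K c t x : ℝ}

/-- `∫₀ᵗ e^{cs} β(x - s) ds`, the expected number of births, weighted by `e^{cs}`, up to time `t` of
an individual with lifetime `x` and birth intensity `β`. -/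
noncomputable def weightedConv (β : ℝ → ℝ) (c t x : ℝ) : ℝ :=
  ∫ s in (0 : ℝ)..t, Real.exp (c * s) * β (x - s)

lemma measurable_weightedConv (hβ : Measurable β) (c t : ℝ) : Measurable (weightedConv β c t) :=
  measurable_intervalIntegral (F := fun x s => Real.exp (c * s) * β (x - s)) measurable_const
    (by unfold Function.uncurry; fun_prop)

lemma weightedConv_nonneg (h0 : ∀ x, 0 ≤ β x) (ht : 0 ≤ t) : 0 ≤ weightedConv β c t x :=
  intervalIntegral.integral_nonneg ht fun _ _ => mul_nonneg (Real.exp_pos _).le (h0 _)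

lemma weightedConv_le (hm : Measurable β) (h0 : ∀ x, 0 ≤ β x) (hK : ∀ x, β x ≤ K)
    (hoff : ∀ x ≤ 0, β x = 0) (hc : 0 < c) (ht : 0 ≤ t) :
    weightedConv β c t x ≤ K / c * Real.exp (c * x) := by
  have hdom : Integrable ((Set.Iic x).indicator fun s => K * Real.exp (c * s)) :=
    (integrable_indicator_iff measurableSet_Iic).2 ((integrableOn_exp_mul_Iic hc x).const_mul K)
  have hpos (s : ℝ) : 0 ≤ Real.exp (c * s) * β (x - s) := mul_nonneg (Real.exp_pos _).le (h0 _)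
  have hle (s : ℝ) : Real.exp (c * s) * β (x - s) ≤
      (Set.Iic x).indicator (fun s => K * Real.exp (c * s)) s := by
    by_cases hs : s ∈ Set.Iic x
    · rw [Set.indicator_of_mem hs, mul_comm]
      exact mul_le_mul_of_nonneg_right (hK _) (Real.exp_pos _).le
    · rw [Set.indicator_of_notMem hs, hoff _ (sub_nonpos.2 (not_le.1 hs).le), mul_zero]
  have hint : Integrable fun s => Real.exp (c * s) * β (x - s) :=
    hdom.mono' (by fun_prop : Measurable _).aestronglyMeasurable (.of_forall fun s => by
      rw [Real.norm_eq_abs, abs_of_nonneg (hpos s)]; exact hle s)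
  calc weightedConv β c t x = ∫ s in Set.Ioc 0 t, Real.exp (c * s) * β (x - s) :=
        intervalIntegral.integral_of_le ht
    _ ≤ ∫ s, Real.exp (c * s) * β (x - s) := setIntegral_le_integral hint (.of_forall hpos)
    _ ≤ ∫ s, (Set.Iic x).indicator (fun s => K * Real.exp (c * s)) s := integral_mono hint hdom hle
    _ = K / c * Real.exp (c * x) := by
        rw [integral_indicator measurableSet_Iic, integral_const_mul, integral_exp_mul_Iic hc]
        ring

lemma intervalIntegrable_exp_mul (hm : Measurable β) (h0 : ∀ x, 0 ≤ β x) (hK : ∀ x, β x ≤ K)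
    (hc : 0 ≤ c) (ht : 0 ≤ t) (x : ℝ) :
    IntervalIntegrable (fun s => Real.exp (c * s) * β (x - s)) volume 0 t := by
  refine intervalIntegrable_of_abs_le (C := Real.exp (c * t) * K) (by fun_prop) ht
    fun s _ hst => ?_
  rw [abs_of_nonneg (mul_nonneg (Real.exp_pos _).le (h0 _))]
  exact mul_le_mul (Real.exp_le_exp.2 (mul_le_mul_of_nonneg_left hst hc)) (hK _) (h0 _)
    (Real.exp_pos _).le

end Convolution

/-- A bounded birth intensity `β` on `(0, ∞)` and a lifetime law `G` for which the reproduction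
kernel, weighted by `s ↦ e^{cs}`, has mass at most `κ < 1`. This is the quantitative form of
subcriticality under which all moment estimates are proved. -/
structure SubcriticalKernel (β : ℝ → ℝ) (G : Measure Pos) (c κ K : ℝ) : Prop where
  measurable : Measurable β
  nonneg : ∀ x, 0 ≤ β x
  le : ∀ x, β x ≤ K
  zero_off : ∀ x ≤ 0, β x = 0
  rate_pos : 0 < c
  lt_one : κ < 1
  mass_le : ∀ t, 0 ≤ t → pairing G (weightedConv β c t) ≤ κ
  exp_integrable : Integrable (fun x : Pos => Real.exp (2 * c * x)) G

/-- The constant in the comparison principle for subsolutions of the renewal equation. -/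
noncomputable def growthConst (G : Measure Pos) (c κ K : ℝ) : ℝ :=
  1 + pairing G (fun x => Real.exp (c * x)) / (1 - κ) * (K / c)

/-- A locally bounded subsolution of the renewal equation with birth intensity `β` and source
`D e^{c(x-t)}`. -/
structure RenewalSubsolution (β : ℝ → ℝ) (G : Measure Pos) (c D : ℝ) (w : ℝ → ℝ → ℝ) : Prop where
  source_nonneg : 0 ≤ D
  measurable : Measurable (Function.uncurry w)
  locBdd : LocBdd w
  le : ∀ t x, 0 ≤ t → 0 < x →
    w t x ≤ (∫ s in (0 : ℝ)..t, β (x - s) * pairing G (w (t - s))) + D * Real.exp (c * (x - t))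

namespace SubcriticalKernel

variable {β : ℝ → ℝ} {G : Measure Pos} {c κ K t M D : ℝ}

lemma bound_nonneg (h : SubcriticalKernel β G c κ K) : 0 ≤ K :=
  (h.nonneg 0).trans (h.le 0)

lemma mass_nonneg (h : SubcriticalKernel β G c κ K) : 0 ≤ κ := by
  simpa [pairing, weightedConv] using h.mass_le 0 le_rfl

lemma one_sub_pos (h : SubcriticalKernel β G c κ K) : 0 < 1 - κ := sub_pos.2 h.lt_one

lemma one_le_growthConst (h : SubcriticalKernel β G c κ K) : 1 ≤ growthConst G c κ K := by
  have hc := h.rate_pos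
  have hK := h.bound_nonneg
  have hκ := h.one_sub_pos
  have hE : 0 ≤ pairing G fun x => Real.exp (c * x) := pairing_nonneg fun x _ => (Real.exp_pos _).le
  exact le_add_of_nonneg_right (by positivity)

lemma growthConst_nonneg (h : SubcriticalKernel β G c κ K) : 0 ≤ growthConst G c κ K :=
  zero_le_one.trans h.one_le_growthConst

lemma integrable_exp (h : SubcriticalKernel β G c κ K) :
    Integrable (fun x : Pos => Real.exp (c * x)) G := by
  refine h.exp_integrable.mono' (by fun_prop : Measurable _).aestronglyMeasurable
    (.of_forall fun x => ?_)
  rw [Real.norm_eq_abs, Real.abs_exp]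
  exact Real.exp_le_exp.2 (by nlinarith [h.rate_pos, show (0 : ℝ) < x from x.2])

lemma weightedConv_le (h : SubcriticalKernel β G c κ K) (ht : 0 ≤ t) (x : ℝ) :
    weightedConv β c t x ≤ K / c * Real.exp (c * x) :=
  AgeBranching.weightedConv_le h.measurable h.nonneg h.le h.zero_off h.rate_pos ht

lemma integrable_weightedConv (h : SubcriticalKernel β G c κ K) (ht : 0 ≤ t) :
    Integrable (fun x : Pos => weightedConv β c t x) G := by
  refine (h.integrable_exp.const_mul (K / c)).mono'
    ((measurable_weightedConv h.measurable c t).comp measurable_subtype_coe).aestronglyMeasurable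
    (.of_forall fun x => ?_)
  rw [Real.norm_eq_abs, abs_of_nonneg (weightedConv_nonneg h.nonneg ht)]
  exact h.weightedConv_le ht x

lemma conv_le_weightedConv (h : SubcriticalKernel β G c κ K) {v : ℝ → ℝ} {B : ℝ}
    (hv : Measurable v) (ht : 0 ≤ t) (hB : ∀ s, 0 ≤ s → s ≤ t → |v s| ≤ B)
    (hM : ∀ s, 0 ≤ s → s ≤ t → v s ≤ M * Real.exp (-(c * s))) (x : ℝ) :
    ∫ s in (0 : ℝ)..t, β (x - s) * v (t - s) ≤ M * Real.exp (-(c * t)) * weightedConv β c t x := by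
  have hβ := h.measurable
  rw [weightedConv, ← intervalIntegral.integral_const_mul]
  refine intervalIntegral.integral_mono_on ht ?_ (.const_mul ?_ _) fun s hs => ?_
  · refine intervalIntegrable_of_abs_le (C := K * B) (by fun_prop) ht fun s hs0 hst => ?_
    rw [abs_mul, abs_of_nonneg (h.nonneg _)]
    exact mul_le_mul (h.le _) (hB _ (by linarith) (by linarith)) (abs_nonneg _) h.bound_nonneg
  · exact intervalIntegrable_exp_mul hβ h.nonneg h.le h.rate_pos.le ht x
  · have hexp : Real.exp (-(c * (t - s))) = Real.exp (-(c * t)) * Real.exp (c * s) := by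
      rw [← Real.exp_add]; ring_nf
    calc β (x - s) * v (t - s) ≤ β (x - s) * (M * Real.exp (-(c * (t - s)))) :=
          mul_le_mul_of_nonneg_left (hM _ (by linarith [hs.2]) (by linarith [hs.1])) (h.nonneg _)
      _ = _ := by rw [hexp]; ring

end SubcriticalKernel

namespace RenewalSubsolution

variable {β : ℝ → ℝ} {G : Measure Pos} [IsProbabilityMeasure G] {w : ℝ → ℝ → ℝ}
  {c κ K t M D : ℝ}

lemma measurable_pairing (hw : RenewalSubsolution β G c D w) :
    Measurable fun s => pairing G (w s) :=
  measurable_pairing_left hw.measurable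

lemma le_of_pairing_le (h : SubcriticalKernel β G c κ K) (hw : RenewalSubsolution β G c D w)
    (hM : ∀ s, 0 ≤ s → s ≤ t → pairing G (w s) ≤ M * Real.exp (-(c * s))) {x : ℝ} (ht : 0 ≤ t)
    (hx : 0 < x) :
    w t x ≤ M * Real.exp (-(c * t)) * weightedConv β c t x + D * Real.exp (c * (x - t)) := by
  obtain ⟨B, hB⟩ := hw.locBdd t
  exact (hw.le t x ht hx).trans (add_le_add_left (h.conv_le_weightedConv hw.measurable_pairing ht
    (fun s hs hst => abs_pairing_le_of_abs_le fun x hx => hB s x hs hst hx) hM x) _)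

-- The mass bound `κ < 1` of the kernel makes the bound on `⟨G, w⟩` self-improving.
lemma pairing_le_of_pairing_le (h : SubcriticalKernel β G c κ K)
    (hw : RenewalSubsolution β G c D w) (hM0 : 0 ≤ M)
    (hM : ∀ s, 0 ≤ s → s ≤ t → pairing G (w s) ≤ M * Real.exp (-(c * s))) (ht : 0 ≤ t) :
    pairing G (w t) ≤
      (κ * M + D * pairing G fun x => Real.exp (c * x)) * Real.exp (-(c * t)) := by
  obtain ⟨B, hB⟩ := hw.locBdd t
  have hwi : Integrable (fun x : Pos => w t x) G :=
    integrable_of_abs_le hw.measurable.of_uncurry_left fun x hx => hB t x ht le_rfl hx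
  have hconv := (h.integrable_weightedConv ht).const_mul (M * Real.exp (-(c * t)))
  have hsource := h.integrable_exp.const_mul (D * Real.exp (-(c * t)))
  calc pairing G (w t)
      ≤ ∫ x : Pos, (M * Real.exp (-(c * t)) * weightedConv β c t x +
          D * Real.exp (-(c * t)) * Real.exp (c * x)) ∂G := by
        refine integral_mono hwi (hconv.add hsource) fun x => ?_
        refine (hw.le_of_pairing_le h hM ht x.2).trans_eq ?_
        rw [mul_assoc D, ← Real.exp_add, show -(c * t) + c * (x : ℝ) = c * (x - t) by ring]
    _ = M * Real.exp (-(c * t)) * pairing G (weightedConv β c t) +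
          D * Real.exp (-(c * t)) * pairing G fun x => Real.exp (c * x) := by
        rw [integral_add hconv hsource, integral_const_mul, integral_const_mul]; rfl
    _ ≤ M * Real.exp (-(c * t)) * κ +
          D * Real.exp (-(c * t)) * pairing G fun x => Real.exp (c * x) := by
        gcongr
        exact h.mass_le t ht
    _ = _ := by ring

lemma pairing_le (h : SubcriticalKernel β G c κ K) (hw : RenewalSubsolution β G c D w)
    (ht : 0 ≤ t) :
    pairing G (w t) ≤
      D * (pairing G fun x => Real.exp (c * x)) / (1 - κ) * Real.exp (-(c * t)) := by
  obtain ⟨B, hB⟩ := hw.locBdd t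
  have hB0 : 0 ≤ B := (abs_nonneg _).trans (hB t 1 ht le_rfl one_pos)
  have hmove (s M : ℝ) :
      pairing G (w s) * Real.exp (c * s) ≤ M ↔ pairing G (w s) ≤ M * Real.exp (-(c * s)) := by
    rw [Real.exp_neg, ← div_eq_mul_inv, le_div_iff₀ (Real.exp_pos _)]
  have hE : 0 ≤ pairing G fun x => Real.exp (c * x) := pairing_nonneg fun x _ => (Real.exp_pos _).le
  refine (hmove _ _).1 (le_div_one_sub_of_selfImproving
    (v := fun s : Set.Icc 0 t => pairing G (w s) * Real.exp (c * s)) ⟨B * Real.exp (c * t), ?_⟩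
    h.mass_nonneg h.lt_one (mul_nonneg hw.source_nonneg hE) (fun M hM0 hM s => ?_) ⟨t, ht, le_rfl⟩)
  · rintro _ ⟨s, rfl⟩
    exact mul_le_mul ((le_abs_self _).trans
        (abs_pairing_le_of_abs_le fun x hx => hB s x s.2.1 s.2.2 hx))
      (Real.exp_le_exp.2 (mul_le_mul_of_nonneg_left s.2.2 h.rate_pos.le)) (Real.exp_pos _).le hB0
  · exact (hmove _ _).2 (hw.pairing_le_of_pairing_le h hM0
      (fun r hr hrs => (hmove _ _).1 (hM ⟨r, hr, hrs.trans s.2.2⟩)) s.2.1)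

theorem le_growthConst_mul (h : SubcriticalKernel β G c κ K) (hw : RenewalSubsolution β G c D w)
    {x : ℝ} (ht : 0 ≤ t) (hx : 0 < x) :
    w t x ≤ growthConst G c κ K * D * Real.exp (c * (x - t)) := by
  set E := pairing G fun x => Real.exp (c * x) with hE_def
  have hE : 0 ≤ E := pairing_nonneg fun x _ => (Real.exp_pos _).le
  have hκ := h.one_sub_pos
  have hD := hw.source_nonneg
  calc w t x
      ≤ D * E / (1 - κ) * Real.exp (-(c * t)) * weightedConv β c t x + D * Real.exp (c * (x - t)) :=
        hw.le_of_pairing_le h (fun s hs _ => hw.pairing_le h hs) ht hx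
    _ ≤ D * E / (1 - κ) * Real.exp (-(c * t)) * (K / c * Real.exp (c * x)) +
          D * Real.exp (c * (x - t)) := by
        gcongr
        exact h.weightedConv_le ht x
    _ = growthConst G c κ K * D * Real.exp (c * (x - t)) := by
        rw [growthConst, ← hE_def, show c * (x - t) = -(c * t) + c * x by ring, Real.exp_add]; ring

end RenewalSubsolution

lemma ExpGrowth.exists_abs_le {c D : ℝ} {y : ℝ → ℝ} (hy : ExpGrowth c D y) (t : ℝ) :
    ∃ M, 0 ≤ M ∧ ∀ s, 0 ≤ s → s ≤ t → |y s| ≤ M := by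
  have hD : 0 ≤ D := (abs_nonneg _).trans ((hy.abs_le 0 le_rfl).trans_eq (by simp))
  refine ⟨D * Real.exp (|c| * t), by positivity, fun s hs hst => (hy.abs_le s hs).trans ?_⟩
  gcongr
  exact le_abs_self c

/-- The right-hand side `f(x - t) + ∫₀ᵗ H(x - s, y(t - s)) ds` of a renewal equation, as a function
of the boundary values `y`. Both the mean equation and the cumulant equation are of this form with
`y_t` a functional of `u_t`. -/
noncomputable def renewalMap (H : ℝ → ℝ → ℝ) (f y : ℝ → ℝ) (t x : ℝ) : ℝ :=
  f (x - t) + ∫ s in (0 : ℝ)..t, H (x - s) (y (t - s))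

section Renewal

variable {H : ℝ → ℝ → ℝ} {J f y z : ℝ → ℝ} {B C c D t M : ℝ}

lemma measurable_renewalMap (hH : Measurable (Function.uncurry H)) (hf : Measurable f)
    (hy : Measurable y) : Measurable (Function.uncurry (renewalMap H f y)) := by
  refine (hf.comp (measurable_snd.sub measurable_fst)).add ?_
  refine measurable_intervalIntegral (S := ℝ × ℝ)
    (F := fun q s => H (q.2 - s) (y (q.1 - s))) measurable_fst ?_
  exact hH.comp (((measurable_snd.comp measurable_fst).sub measurable_snd).prodMk
    (hy.comp ((measurable_fst.comp measurable_fst).sub measurable_snd)))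

/-- A measurable reproduction function, Lipschitz in its second argument and vanishing at `0`. -/
structure LipschitzReproduction (H : ℝ → ℝ → ℝ) (B : ℝ) : Prop where
  measurable : Measurable (Function.uncurry H)
  zero : ∀ x, H x 0 = 0
  abs_sub_le : ∀ x y z, |H x y - H x z| ≤ B * |y - z|

namespace LipschitzReproduction

lemma nonneg (hH : LipschitzReproduction H B) : 0 ≤ B := by
  simpa using (abs_nonneg _).trans (hH.abs_sub_le 0 1 0)

lemma abs_le_mul (hH : LipschitzReproduction H B) (hy : ∀ s, 0 ≤ s → s ≤ t → |y s| ≤ M)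
    (x : ℝ) {s : ℝ} (hs : 0 ≤ s) (hst : s ≤ t) : |H (x - s) (y (t - s))| ≤ B * M := by
  have h := hH.abs_sub_le (x - s) (y (t - s)) 0
  rw [hH.zero, sub_zero, sub_zero] at h
  exact h.trans (mul_le_mul_of_nonneg_left (hy _ (by linarith) (by linarith)) hH.nonneg)

lemma intervalIntegrable (hH : LipschitzReproduction H B) (hy : Measurable y) (ht : 0 ≤ t)
    (hM : ∀ s, 0 ≤ s → s ≤ t → |y s| ≤ M) (x : ℝ) :
    IntervalIntegrable (fun s => H (x - s) (y (t - s))) volume 0 t :=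
  intervalIntegrable_of_abs_le (hH.measurable.comp ((measurable_const.sub measurable_id).prodMk
    (hy.comp (measurable_const.sub measurable_id)))) ht fun _ hs hst =>
      hH.abs_le_mul hM x hs.le hst

lemma abs_renewalMap_le (hH : LipschitzReproduction H B) (hf : ∀ x, |f x| ≤ C) (ht : 0 ≤ t)
    (hM : ∀ s, 0 ≤ s → s ≤ t → |y s| ≤ M) (x : ℝ) : |renewalMap H f y t x| ≤ C + B * M * t := by
  have hconv : ‖∫ s in (0 : ℝ)..t, H (x - s) (y (t - s))‖ ≤ B * M * |t - 0| :=
    intervalIntegral.norm_integral_le_of_norm_le_const fun s hs => by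
      rw [Set.uIoc_of_le ht] at hs
      exact hH.abs_le_mul hM x hs.1.le hs.2
  rw [sub_zero, abs_of_nonneg ht, Real.norm_eq_abs] at hconv
  exact (abs_add_le _ _).trans (add_le_add (hf _) hconv)

lemma abs_renewalMap_sub_le (hH : LipschitzReproduction H B) (hy : ExpGrowth c D y)
    (hz : ExpGrowth c D z) (ht : 0 ≤ t) (x : ℝ) :
    |renewalMap H f y t x - renewalMap H f z t x| ≤ B * ∫ s in (0 : ℝ)..t, |y s - z s| := by
  obtain ⟨M, -, hM⟩ := hy.exists_abs_le t
  obtain ⟨N, -, hN⟩ := hz.exists_abs_le t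
  have hyz : Measurable fun s => |y (t - s) - z (t - s)| :=
    ((hy.measurable.sub hz.measurable).comp (measurable_const.sub measurable_id)).abs
  have hint : IntervalIntegrable (fun s => B * |y (t - s) - z (t - s)|) volume 0 t :=
    (intervalIntegrable_of_abs_le (C := M + N) hyz ht fun s hs hst => by
      rw [abs_abs]
      exact (abs_sub _ _).trans (add_le_add (hM _ (by linarith) (by linarith))
        (hN _ (by linarith) (by linarith)))).const_mul B
  calc |renewalMap H f y t x - renewalMap H f z t x|
      = |∫ s in (0 : ℝ)..t, (H (x - s) (y (t - s)) - H (x - s) (z (t - s)))| := by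
        rw [intervalIntegral.integral_sub (hH.intervalIntegrable hy.measurable ht hM x)
          (hH.intervalIntegrable hz.measurable ht hN x), renewalMap, renewalMap,
          add_sub_add_left_eq_sub]
    _ ≤ ∫ s in (0 : ℝ)..t, B * |y (t - s) - z (t - s)| := by
        rw [← Real.norm_eq_abs]
        exact intervalIntegral.norm_integral_le_of_norm_le ht
          (.of_forall fun s _ => hH.abs_sub_le _ _ _) hint
    _ = B * ∫ s in (0 : ℝ)..t, |y s - z s| := by
        rw [intervalIntegral.integral_const_mul,
          intervalIntegral.integral_comp_sub_left (fun s => |y s - z s|), sub_self, sub_zero]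

variable {G : Measure Pos} [IsProbabilityMeasure G]

lemma isVolterra (hH : LipschitzReproduction H B) (hJ : LipschitzWith 1 J) (hJ0 : J 0 = 0)
    (hf : Measurable f) (hfC : ∀ x, |f x| ≤ C) :
    IsVolterra B C fun y t => pairing G fun x => J (renewalMap H f y t x) where
  nonneg := hH.nonneg
  measurable y hy := measurable_pairing_left
    (hJ.continuous.measurable.comp (measurable_renewalMap hH.measurable hf hy))
  abs_zero_le t _ := by
    refine abs_pairing_le_of_abs_le fun x _ => ?_
    simpa [renewalMap, hH.zero, hJ0] using (hJ.dist_le_mul (f (x - t)) 0).trans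
      (by simpa using hfC (x - t))
  lipschitz y z hy hz t ht := by
    have hint {w : ℝ → ℝ} (hw : ExpGrowth (2 * B) C w) :
        Integrable (fun x : Pos => J (renewalMap H f w t x)) G := by
      obtain ⟨M, -, hM⟩ := hw.exists_abs_le t
      refine integrable_of_abs_le (hJ.continuous.measurable.comp
        (measurable_renewalMap hH.measurable hf hw.measurable).of_uncurry_left) fun x _ =>
        le_trans ?_ (hH.abs_renewalMap_le hfC ht hM x)
      simpa [hJ0] using hJ.dist_le_mul (renewalMap H f w t x) 0
    rw [pairing, pairing, ← integral_sub (hint hy) (hint hz)]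
    refine abs_pairing_le_of_abs_le
      (f := fun x => J (renewalMap H f y t x) - J (renewalMap H f z t x)) fun x _ =>
      le_trans ?_ (hH.abs_renewalMap_sub_le (f := f) hy hz ht x)
    simpa [Real.dist_eq] using hJ.dist_le_mul (renewalMap H f y t x) (renewalMap H f z t x)

theorem exists_renewal_solution (hH : LipschitzReproduction H B) (hJ : LipschitzWith 1 J)
    (hJ0 : J 0 = 0) (hf : Measurable f) (hfC : ∀ x, |f x| ≤ C) :
    ∃ u : ℝ → ℝ → ℝ, Measurable (Function.uncurry u) ∧ LocBdd u ∧ ∀ t x, 0 ≤ t →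
      u t x = f (x - t) + ∫ s in (0 : ℝ)..t, H (x - s) (pairing G fun z => J (u (t - s) z)) := by
  obtain ⟨y, hy, hfix⟩ := (hH.isVolterra (G := G) hJ hJ0 hf hfC).exists_fixedPoint
  refine ⟨renewalMap H f y, measurable_renewalMap hH.measurable hf hy.measurable, fun T => ?_,
    fun t x ht => ?_⟩
  · obtain ⟨M, hM0, hM⟩ := hy.exists_abs_le T
    refine ⟨C + B * M * T, fun t x ht htT _ => (hH.abs_renewalMap_le hfC ht
      (fun s hs hst => hM s hs (hst.trans htT)) x).trans ?_⟩
    have := hH.nonneg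
    gcongr
  · rw [renewalMap]
    congr 1
    refine intervalIntegral.integral_congr fun s hs => ?_
    rw [Set.uIcc_of_le ht] at hs
    rw [hfix (t - s) (sub_nonneg.2 hs.2)]

end LipschitzReproduction

end Renewal

section Offspring

variable {α : ℝ → ℝ} {p : ℝ → ℕ → ℝ} {x y z w A C K : ℝ}

lemma measurable_tsum {S : Type*} [MeasurableSpace S] {F : ℕ → S → ℝ} (hF : ∀ i, Measurable (F i))
    (hs : ∀ q, Summable fun i => F i q) : Measurable fun q => ∑' i, F i q := by
  refine measurable_of_tendsto_metrizable (f := fun n q => ∑ i ∈ Finset.range n, F i q)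
    (fun n => Finset.measurable_fun_sum _ fun i _ => hF i) ?_
  exact tendsto_pi_nhds.2 fun q => (hs q).hasSum.tendsto_sum_nat

lemma one_sub_pow_le_quadratic {r : ℝ} (h0 : 0 ≤ r) (h1 : r ≤ 1) (i : ℕ) :
    (1 - r) ^ i ≤ 1 - i * r + i * (i - 1) / 2 * r ^ 2 := by
  induction i with
  | zero => simp
  | succ n ih =>
    have hcoeff : (0 : ℝ) ≤ n * (n - 1) := by
      rcases Nat.eq_zero_or_pos n with rfl | hn
      · simp
      · exact mul_nonneg (Nat.cast_nonneg n) (sub_nonneg.2 (by exact_mod_cast hn))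
    have hcubic : 0 ≤ (n : ℝ) * (n - 1) * r ^ 3 := by positivity
    calc (1 - r) ^ (n + 1) ≤ (1 - n * r + n * (n - 1) / 2 * r ^ 2) * (1 - r) := by
          rw [pow_succ]; exact mul_le_mul_of_nonneg_right ih (by linarith)
      _ ≤ _ := by push_cast; nlinarith

lemma C1Nonneg.measurable {h : ℝ → ℝ} (hh : C1Nonneg h) : Measurable h := by
  classical
  have hcont : ContinuousOn h (Set.Ioi 0) := fun x hx =>
    (hh.differentiable x hx).continuousAt.continuousWithinAt
  convert hcont.measurable_piecewise (g := fun _ => (0 : ℝ)) continuousOn_const measurableSet_Ioi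
    using 1
  funext x
  by_cases hx : x ∈ Set.Ioi (0 : ℝ)
  · rw [Set.piecewise_eq_of_mem _ _ _ hx]
  · rw [Set.piecewise_eq_of_notMem _ _ _ hx, hh.zero_off x (not_lt.1 hx)]

/-- The mean intensity of births `x ↦ α(x) g'(x, 1-)`. -/
noncomputable def birthRate (α : ℝ → ℝ) (p : ℝ → ℕ → ℝ) (x : ℝ) : ℝ := α x * genFunDeriv p x

/-- The nonlinearity `α(x) [1 - g(x, 1 - y)]` of the cumulant equation. Its argument `y` is
truncated to `[0, 1]`, which makes it globally Lipschitz. -/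
noncomputable def birthFun (α : ℝ → ℝ) (p : ℝ → ℕ → ℝ) (x y : ℝ) : ℝ :=
  α x * (1 - genFun p x (1 - (Set.projIcc (0 : ℝ) 1 zero_le_one y : ℝ)))

namespace BranchingData

lemma law_zero (hd : BranchingData α p) (hx : x ≤ 0) (i : ℕ) : p x i = 0 :=
  (hd.law_C1 i).zero_off x hx

lemma law_nonneg (hd : BranchingData α p) (x : ℝ) (i : ℕ) : 0 ≤ p x i := (hd.law_C1 i).nonneg x

lemma summable_law (hd : BranchingData α p) (x : ℝ) : Summable (p x) := by
  rcases le_or_gt x 0 with hx | hx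
  · exact summable_zero.congr fun i => (hd.law_zero hx i).symm
  · exact (hd.law_sum x hx).summable

lemma summable_mean (hd : BranchingData α p) (x : ℝ) : Summable fun i : ℕ => (i : ℝ) * p x i := by
  rcases le_or_gt x 0 with hx | hx
  · exact summable_zero.congr fun i => by simp [hd.law_zero hx i]
  · exact (hd.mean_bounded.choose_spec x hx).1

lemma measurable_genFunDeriv (hd : BranchingData α p) : Measurable (genFunDeriv p) :=
  measurable_tsum (F := fun i x => (i : ℝ) * p x i)
    (fun i => (hd.law_C1 i).measurable.const_mul _) hd.summable_mean

lemma genFunDeriv_nonneg (hd : BranchingData α p) (x : ℝ) : 0 ≤ genFunDeriv p x :=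
  tsum_nonneg fun i => mul_nonneg (Nat.cast_nonneg _) (hd.law_nonneg x i)

lemma exists_rate_bound (hd : BranchingData α p) : ∃ A : ℝ, 0 ≤ A ∧ ∀ x, α x ≤ A := by
  obtain ⟨A, hA⟩ := hd.rate_C1.bounded
  exact ⟨A, (hd.rate_C1.nonneg 0).trans (hA 0), hA⟩

lemma birthRate_nonneg (hd : BranchingData α p) (x : ℝ) : 0 ≤ birthRate α p x :=
  mul_nonneg (hd.rate_C1.nonneg x) (hd.genFunDeriv_nonneg x)

lemma birthRate_zero (hd : BranchingData α p) (x : ℝ) (hx : x ≤ 0) : birthRate α p x = 0 := by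
  rw [birthRate, hd.rate_C1.zero_off x hx, zero_mul]

lemma measurable_birthRate (hd : BranchingData α p) : Measurable (birthRate α p) :=
  hd.rate_C1.measurable.mul hd.measurable_genFunDeriv

lemma exists_birthRate_bound (hd : BranchingData α p) : ∃ K : ℝ, ∀ x, birthRate α p x ≤ K := by
  obtain ⟨A, hA0, hA⟩ := hd.exists_rate_bound
  obtain ⟨C, hC⟩ := hd.mean_bounded
  have hC0 : 0 ≤ C := (hd.genFunDeriv_nonneg 1).trans (hC 1 one_pos).2
  refine ⟨A * C, fun x => ?_⟩
  rcases le_or_gt x 0 with hx | hx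
  · rw [hd.birthRate_zero x hx]; positivity
  · exact mul_le_mul (hA x) (hC x hx).2 (hd.genFunDeriv_nonneg x) hA0

lemma term_le (hd : BranchingData α p) (hz : z ∈ Set.Icc 0 1) (i : ℕ) : p x i * z ^ i ≤ p x i :=
  mul_le_of_le_one_right (hd.law_nonneg x i) (pow_le_one₀ hz.1 hz.2)

lemma summable_genFun (hd : BranchingData α p) (x : ℝ) (hz : z ∈ Set.Icc 0 1) :
    Summable fun i : ℕ => p x i * z ^ i :=
  (hd.summable_law x).of_nonneg_of_le
    (fun i => mul_nonneg (hd.law_nonneg x i) (pow_nonneg hz.1 i)) (hd.term_le hz)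

lemma measurable_genFun (hd : BranchingData α p) {S : Type*} [MeasurableSpace S] {a z : S → ℝ}
    (ha : Measurable a) (hz : Measurable z) (hz01 : ∀ q, z q ∈ Set.Icc 0 1) :
    Measurable fun q => genFun p (a q) (z q) :=
  measurable_tsum (F := fun i q => p (a q) i * z q ^ i)
    (fun i => ((hd.law_C1 i).measurable.comp ha).mul (hz.pow_const i))
    fun q => hd.summable_genFun _ (hz01 q)

lemma abs_genFun_sub_le (hd : BranchingData α p) (x : ℝ) (hz : z ∈ Set.Icc 0 1)
    (hw : w ∈ Set.Icc 0 1) : |genFun p x z - genFun p x w| ≤ genFunDeriv p x * |z - w| := by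
  have hpow (i : ℕ) : |z ^ i - w ^ i| ≤ i * |z - w| := by
    refine (abs_pow_sub_pow_le z w i).trans ?_
    have hmax : max |z| |w| ^ (i - 1) ≤ 1 := pow_le_one₀ (by positivity)
      (max_le (abs_le.2 ⟨by linarith [hz.1], hz.2⟩) (abs_le.2 ⟨by linarith [hw.1], hw.2⟩))
    exact (mul_le_of_le_one_right (by positivity) hmax).trans_eq (mul_comm _ _)
  rw [genFun, genFun, ← (hd.summable_genFun x hz).tsum_sub (hd.summable_genFun x hw), genFunDeriv]
  refine (tsum_of_norm_bounded (f := fun i : ℕ => p x i * z ^ i - p x i * w ^ i)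
    ((hd.summable_mean x).hasSum.mul_right |z - w|) fun i => ?_)
  calc |p x i * z ^ i - p x i * w ^ i| = p x i * |z ^ i - w ^ i| := by
        rw [← mul_sub, abs_mul, abs_of_nonneg (hd.law_nonneg x i)]
    _ ≤ p x i * (i * |z - w|) := mul_le_mul_of_nonneg_left (hpow i) (hd.law_nonneg x i)
    _ = i * p x i * |z - w| := by ring

lemma hasSum_one_sub_genFun (hd : BranchingData α p) (hx : 0 < x) (hz : z ∈ Set.Icc 0 1) :
    HasSum (fun i : ℕ => p x i * (1 - z ^ i)) (1 - genFun p x z) := by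
  simpa [mul_sub, genFun] using (hd.law_sum x hx).sub (hd.summable_genFun x hz).hasSum

lemma one_sub_genFun_nonneg (hd : BranchingData α p) (hx : 0 < x) (hz : z ∈ Set.Icc 0 1) :
    0 ≤ 1 - genFun p x z :=
  (hd.hasSum_one_sub_genFun hx hz).nonneg fun i =>
    mul_nonneg (hd.law_nonneg x i) (sub_nonneg.2 (pow_le_one₀ hz.1 hz.2))

lemma one_sub_genFun_le (hd : BranchingData α p) (hx : 0 < x) (hz : z ∈ Set.Icc 0 1) :
    1 - genFun p x z ≤ genFunDeriv p x * (1 - z) := by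
  have h := hd.abs_genFun_sub_le x (Set.right_mem_Icc.2 zero_le_one) hz
  have hone : genFun p x 1 = 1 := by simpa [genFun] using (hd.law_sum x hx).tsum_eq
  rw [hone, abs_of_nonneg (sub_nonneg.2 hz.2)] at h
  exact (le_abs_self _).trans h

lemma le_one_sub_genFun (hd : BranchingData α p) (hx : 0 < x) (hz : z ∈ Set.Icc 0 1)
    (hs : Summable fun i : ℕ => (i : ℝ) * ((i : ℝ) - 1) * p x i)
    (hC : ∑' i : ℕ, (i : ℝ) * ((i : ℝ) - 1) * p x i ≤ C) :
    genFunDeriv p x * (1 - z) - C / 2 * (1 - z) ^ 2 ≤ 1 - genFun p x z := by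
  have htaylor : genFunDeriv p x * (1 - z) -
      (∑' i : ℕ, (i : ℝ) * ((i : ℝ) - 1) * p x i) * ((1 - z) ^ 2 / 2) ≤ 1 - genFun p x z := by
    refine hasSum_le (fun i => ?_)
      (((hd.summable_mean x).hasSum.mul_right (1 - z)).sub (hs.hasSum.mul_right ((1 - z) ^ 2 / 2)))
      (hd.hasSum_one_sub_genFun hx hz)
    have hpow := one_sub_pow_le_quadratic (sub_nonneg.2 hz.2) (sub_le_self 1 hz.1) i
    rw [sub_sub_cancel] at hpow
    calc (i : ℝ) * p x i * (1 - z) - (i : ℝ) * ((i : ℝ) - 1) * p x i * ((1 - z) ^ 2 / 2)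
        = p x i * (i * (1 - z) - i * (i - 1) / 2 * (1 - z) ^ 2) := by ring
      _ ≤ _ := mul_le_mul_of_nonneg_left (by linarith) (hd.law_nonneg x i)
  have := mul_le_mul_of_nonneg_right hC (by positivity : 0 ≤ (1 - z) ^ 2 / 2)
  linarith

end BranchingData

lemma one_sub_projIcc_mem (y : ℝ) : 1 - (Set.projIcc (0 : ℝ) 1 zero_le_one y : ℝ) ∈ Set.Icc 0 1 :=
  Set.Icc.one_sub_mem (Subtype.prop _)

lemma birthFun_of_mem (hy : y ∈ Set.Icc (0 : ℝ) 1) :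
    birthFun α p x y = α x * (1 - genFun p x (1 - y)) := by
  rw [birthFun, Set.projIcc_of_mem _ hy]

namespace BranchingData

lemma birthFun_nonneg (hd : BranchingData α p) (x y : ℝ) : 0 ≤ birthFun α p x y := by
  rcases le_or_gt x 0 with hx | hx
  · simp [birthFun, hd.rate_C1.zero_off x hx]
  · exact mul_nonneg (hd.rate_C1.nonneg x) (hd.one_sub_genFun_nonneg hx (one_sub_projIcc_mem y))

lemma birthFun_le (hd : BranchingData α p) (x : ℝ) (hy : y ∈ Set.Icc (0 : ℝ) 1) :
    birthFun α p x y ≤ birthRate α p x * y := by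
  rw [birthFun_of_mem hy, birthRate, mul_assoc]
  rcases le_or_gt x 0 with hx | hx
  · simp [hd.rate_C1.zero_off x hx]
  · refine mul_le_mul_of_nonneg_left ?_ (hd.rate_C1.nonneg x)
    simpa using hd.one_sub_genFun_le hx (Set.Icc.one_sub_mem hy)

lemma le_birthFun (hd : BranchingData α p)
    (hg2 : ∀ x, 0 < x → Summable (fun i : ℕ => (i : ℝ) * ((i : ℝ) - 1) * p x i) ∧
      ∑' i : ℕ, (i : ℝ) * ((i : ℝ) - 1) * p x i ≤ C) (x : ℝ) (hy : y ∈ Set.Icc (0 : ℝ) 1) :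
    birthRate α p x * y - α x * (C / 2 * y ^ 2) ≤ birthFun α p x y := by
  rw [birthFun_of_mem hy, birthRate, mul_assoc, ← mul_sub]
  rcases le_or_gt x 0 with hx | hx
  · simp only [hd.rate_C1.zero_off x hx, zero_mul, le_refl]
  · refine mul_le_mul_of_nonneg_left ?_ (hd.rate_C1.nonneg x)
    simpa only [sub_sub_cancel] using
      hd.le_one_sub_genFun hx (Set.Icc.one_sub_mem hy) (hg2 x hx).1 (hg2 x hx).2

lemma lipschitzReproduction_birthRate (hd : BranchingData α p) (hK : ∀ x, birthRate α p x ≤ K) :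
    LipschitzReproduction (fun x y => birthRate α p x * y) K where
  measurable := (hd.measurable_birthRate.comp measurable_fst).mul measurable_snd
  zero _ := mul_zero _
  abs_sub_le x y z := by
    rw [← mul_sub, abs_mul, abs_of_nonneg (hd.birthRate_nonneg x)]
    exact mul_le_mul_of_nonneg_right (hK x) (abs_nonneg _)

lemma lipschitzReproduction_birthFun (hd : BranchingData α p) (hK : ∀ x, birthRate α p x ≤ K) :
    LipschitzReproduction (birthFun α p) K where
  measurable := by
    have hproj : Measurable fun q : ℝ × ℝ =>
        1 - (Set.projIcc (0 : ℝ) 1 zero_le_one q.2 : ℝ) :=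
      measurable_const.sub (continuous_projIcc.measurable.comp measurable_snd).subtype_val
    exact (hd.rate_C1.measurable.comp measurable_fst).mul (measurable_const.sub
      (hd.measurable_genFun measurable_fst hproj fun q => one_sub_projIcc_mem q.2))
  zero x := by
    refine le_antisymm ?_ (hd.birthFun_nonneg x 0)
    simpa using hd.birthFun_le x (Set.left_mem_Icc.2 zero_le_one)
  abs_sub_le x y z := by
    have hproj : |(Set.projIcc (0 : ℝ) 1 zero_le_one y : ℝ) - Set.projIcc (0 : ℝ) 1 zero_le_one z|
        ≤ |y - z| := Set.abs_projIcc_sub_projIcc zero_le_one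
    have hgen := hd.abs_genFun_sub_le x (one_sub_projIcc_mem z) (one_sub_projIcc_mem y)
    rw [sub_sub_sub_cancel_left] at hgen
    calc |birthFun α p x y - birthFun α p x z|
        = α x * |genFun p x (1 - (Set.projIcc (0 : ℝ) 1 zero_le_one z : ℝ)) -
            genFun p x (1 - (Set.projIcc (0 : ℝ) 1 zero_le_one y : ℝ))| := by
          rw [birthFun, birthFun, ← mul_sub, abs_mul, abs_of_nonneg (hd.rate_C1.nonneg x),
            sub_sub_sub_cancel_left]
      _ ≤ α x * (genFunDeriv p x * |y - z|) := by
          refine mul_le_mul_of_nonneg_left (hgen.trans ?_) (hd.rate_C1.nonneg x)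
          exact mul_le_mul_of_nonneg_left hproj (hd.genFunDeriv_nonneg x)
      _ ≤ K * |y - z| := by
          rw [← mul_assoc]; exact mul_le_mul_of_nonneg_right (hK x) (abs_nonneg _)

end BranchingData

end Offspring

/-- `f` grows on `(0, ∞)` at most like `A e^{cx}`. -/
def ExpBdd (c A : ℝ) (f : ℝ → ℝ) : Prop := ∀ x, 0 < x → |f x| ≤ A * Real.exp (c * x)

lemma ExpBdd.nonneg {c A : ℝ} {f : ℝ → ℝ} (hf : ExpBdd c A f) : 0 ≤ A :=
  nonneg_of_mul_nonneg_left ((abs_nonneg _).trans (hf 1 one_pos)) (Real.exp_pos _)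

section MeanEquation

variable {α : ℝ → ℝ} {p : ℝ → ℕ → ℝ} {G : Measure Pos} {f f₁ f₂ : ℝ → ℝ} {m m₁ m₂ : ℝ → ℝ → ℝ}
  {A c κ K t x : ℝ}

lemma BddBorel.const_mul (hf : BddBorel f) (a : ℝ) : BddBorel fun x => a * f x := by
  obtain ⟨C, hC⟩ := hf.bounded
  refine ⟨hf.measurable.const_mul a, ⟨|a| * C, fun x => ?_⟩, fun x hx => by
    simp [hf.zero_off x hx]⟩
  rw [abs_mul]
  exact mul_le_mul_of_nonneg_left (hC x) (abs_nonneg a)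

lemma SolvesMean.eqn_birthRate (hm : SolvesMean α p G f m) (ht : 0 ≤ t) (hx : 0 < x) :
    m t x = f (x - t) + ∫ s in (0 : ℝ)..t, birthRate α p (x - s) * pairing G (m (t - s)) :=
  hm.eqn t x ht hx

lemma LocBdd.integrable [IsFiniteMeasure G] (hb : LocBdd m) (hm : Measurable (Function.uncurry m))
    (ht : 0 ≤ t) : Integrable (fun x : Pos => m t x) G := by
  obtain ⟨B, hB⟩ := hb t
  exact integrable_of_abs_le hm.of_uncurry_left fun x hx => hB t x ht le_rfl hx

lemma LocBdd.pairing_sub [IsFiniteMeasure G] (h₁ : LocBdd m₁) (h₂ : LocBdd m₂)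
    (hm₁ : Measurable (Function.uncurry m₁)) (hm₂ : Measurable (Function.uncurry m₂))
    (ht : 0 ≤ t) :
    (pairing G fun x => m₁ t x - m₂ t x) = pairing G (m₁ t) - pairing G (m₂ t) :=
  integral_sub (h₁.integrable hm₁ ht) (h₂.integrable hm₂ ht)

lemma LocBdd.sub (h₁ : LocBdd m₁) (h₂ : LocBdd m₂) : LocBdd fun t x => m₁ t x - m₂ t x := by
  intro T
  obtain ⟨B₁, hB₁⟩ := h₁ T
  obtain ⟨B₂, hB₂⟩ := h₂ T
  exact ⟨B₁ + B₂, fun t x ht htT hx => (abs_sub _ _).trans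
    (add_le_add (hB₁ t x ht htT hx) (hB₂ t x ht htT hx))⟩

lemma LocBdd.const_mul (hm : LocBdd m) (a : ℝ) : LocBdd fun t x => a * m t x := by
  intro T
  obtain ⟨B, hB⟩ := hm T
  refine ⟨|a| * B, fun t x ht htT hx => ?_⟩
  rw [abs_mul]
  exact mul_le_mul_of_nonneg_left (hB t x ht htT hx) (abs_nonneg a)

lemma SolvesMean.const_mul (h : SolvesMean α p G f m) (a : ℝ) :
    SolvesMean α p G (fun x => a * f x) (fun t x => a * m t x) where
  measurable := h.measurable.const_mul a
  locBdd := h.locBdd.const_mul a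
  eqn t x ht hx := by
    rw [h.eqn t x ht hx, mul_add, ← intervalIntegral.integral_const_mul]
    simp only [pairing, integral_const_mul]
    congr 2 with s
    ring

lemma SolvesMean.renewalSubsolution (hm : SolvesMean α p G f m) (hA : 0 ≤ A)
    (hf : ∀ x, 0 < x → f x ≤ A * Real.exp (c * x)) (h0 : ∀ x ≤ 0, f x = 0) :
    RenewalSubsolution (birthRate α p) G c A m where
  source_nonneg := hA
  measurable := hm.measurable
  locBdd := hm.locBdd
  le t x ht hx := by
    rw [hm.eqn_birthRate ht hx, add_comm]
    refine add_le_add_right ?_ _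
    rcases le_or_gt (x - t) 0 with hxt | hxt
    · rw [h0 _ hxt]; positivity
    · exact hf _ hxt

variable [IsProbabilityMeasure G]

lemma BranchingData.intervalIntegrable_mean (hd : BranchingData α p)
    (hm : Measurable (Function.uncurry m)) (hb : LocBdd m) (ht : 0 ≤ t) (x : ℝ) :
    IntervalIntegrable (fun s => birthRate α p (x - s) * pairing G (m (t - s))) volume 0 t := by
  obtain ⟨K, hK⟩ := hd.exists_birthRate_bound
  obtain ⟨B, hB⟩ := hb t
  exact (hd.lipschitzReproduction_birthRate hK).intervalIntegrable (measurable_pairing_left hm) ht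
    (fun s hs hst => abs_pairing_le_of_abs_le fun x hx => hB s x hs hst hx) x

namespace SolvesMean

lemma sub (hd : BranchingData α p) (h₁ : SolvesMean α p G f₁ m₁) (h₂ : SolvesMean α p G f₂ m₂) :
    SolvesMean α p G (fun x => f₁ x - f₂ x) (fun t x => m₁ t x - m₂ t x) where
  measurable := h₁.measurable.sub h₂.measurable
  locBdd := h₁.locBdd.sub h₂.locBdd
  eqn t x ht hx := by
    rw [h₁.eqn_birthRate ht hx, h₂.eqn_birthRate ht hx, add_sub_add_comm,
      ← intervalIntegral.integral_sub
        (hd.intervalIntegrable_mean h₁.measurable h₁.locBdd ht x)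
        (hd.intervalIntegrable_mean h₂.measurable h₂.locBdd ht x)]
    congr 1
    refine intervalIntegral.integral_congr fun s hs => ?_
    rw [Set.uIcc_of_le ht] at hs
    have hts : 0 ≤ t - s := sub_nonneg.2 hs.2
    simp only [h₁.locBdd.pairing_sub h₂.locBdd h₁.measurable h₂.measurable hts, mul_sub, birthRate]

lemma nonneg (h : SubcriticalKernel (birthRate α p) G c κ K) (hm : SolvesMean α p G f m)
    (hf : ∀ x, 0 ≤ f x) (h0 : ∀ x ≤ 0, f x = 0) (ht : 0 ≤ t) (hx : 0 < x) : 0 ≤ m t x := by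
  have hneg := ((hm.const_mul (-1)).renewalSubsolution (c := c) le_rfl
    (fun x _ => by simpa using hf x) fun x hx => by simp [h0 x hx]).le_growthConst_mul h ht hx
  rw [mul_zero, zero_mul] at hneg
  linarith

lemma abs_le_growthConst_mul (h : SubcriticalKernel (birthRate α p) G c κ K)
    (hm : SolvesMean α p G f m) (hf : ExpBdd c A f) (h0 : ∀ x ≤ 0, f x = 0) (ht : 0 ≤ t)
    (hx : 0 < x) : |m t x| ≤ growthConst G c κ K * A * Real.exp (c * (x - t)) := by
  have hneg := ((hm.const_mul (-1)).renewalSubsolution (c := c) hf.nonneg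
    (fun x hx => by simpa using (neg_le_abs _).trans (hf x hx)) fun x hx => by
      simp [h0 x hx]).le_growthConst_mul h ht hx
  have hpos := (hm.renewalSubsolution hf.nonneg (fun x hx => (le_abs_self _).trans (hf x hx))
    h0).le_growthConst_mul h ht hx
  exact abs_le.2 ⟨by linarith, hpos⟩

lemma unique (hd : BranchingData α p) (h : SubcriticalKernel (birthRate α p) G c κ K)
    (h₁ : SolvesMean α p G f m₁) (h₂ : SolvesMean α p G f m₂) (ht : 0 ≤ t) (hx : 0 < x) :
    m₁ t x = m₂ t x := by
  have hdiff := (h₁.sub hd h₂).abs_le_growthConst_mul h (A := 0) (fun x _ => by simp)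
    (fun _ _ => sub_self _) ht hx
  rw [mul_zero, zero_mul] at hdiff
  exact sub_eq_zero.1 (abs_nonpos_iff.1 hdiff)

end SolvesMean

theorem BranchingData.solvesMean (hd : BranchingData α p) (hf : BddBorel f) :
    SolvesMean α p G f (meanSemigroup α p G f) := by
  obtain ⟨K, hK⟩ := hd.exists_birthRate_bound
  obtain ⟨C, hC⟩ := hf.bounded
  obtain ⟨m, hm, hb, heqn⟩ := (hd.lipschitzReproduction_birthRate hK).exists_renewal_solution
    (G := G) LipschitzWith.id rfl hf.measurable hC
  exact Classical.epsilon_spec (p := SolvesMean α p G f) ⟨m, hm, hb, fun t x ht _ => heqn t x ht⟩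

namespace SubcriticalKernel

lemma meanSemigroup_nonneg (hd : BranchingData α p)
    (h : SubcriticalKernel (birthRate α p) G c κ K) (hf : BddBorel f) (hf0 : ∀ x, 0 ≤ f x)
    (ht : 0 ≤ t) (hx : 0 < x) : 0 ≤ meanSemigroup α p G f t x :=
  (hd.solvesMean hf).nonneg h hf0 hf.zero_off ht hx

lemma abs_meanSemigroup_le (hd : BranchingData α p)
    (h : SubcriticalKernel (birthRate α p) G c κ K) (hf : BddBorel f) (hfA : ExpBdd c A f)
    (ht : 0 ≤ t) (hx : 0 < x) :
    |meanSemigroup α p G f t x| ≤ growthConst G c κ K * A * Real.exp (c * (x - t)) :=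
  (hd.solvesMean hf).abs_le_growthConst_mul h hfA hf.zero_off ht hx

lemma meanSemigroup_const_mul (hd : BranchingData α p)
    (h : SubcriticalKernel (birthRate α p) G c κ K) (hf : BddBorel f) (θ : ℝ) (ht : 0 ≤ t)
    (hx : 0 < x) :
    meanSemigroup α p G (fun x => θ * f x) t x = θ * meanSemigroup α p G f t x :=
  (hd.solvesMean (hf.const_mul θ)).unique hd h ((hd.solvesMean hf).const_mul θ) ht hx

lemma meanSemigroup_sub (hd : BranchingData α p)
    (h : SubcriticalKernel (birthRate α p) G c κ K) (h₁ : BddBorel f₁) (h₂ : BddBorel f₂)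
    (hf : BddBorel fun x => f₁ x - f₂ x) (ht : 0 ≤ t) (hx : 0 < x) :
    meanSemigroup α p G (fun x => f₁ x - f₂ x) t x =
      meanSemigroup α p G f₁ t x - meanSemigroup α p G f₂ t x :=
  (hd.solvesMean hf).unique hd h ((hd.solvesMean h₁).sub hd (hd.solvesMean h₂)) ht hx

end SubcriticalKernel

end MeanEquation

section CumulantEquation

lemma lipschitzWith_one_sub_exp_neg_max :
    LipschitzWith 1 fun v : ℝ => 1 - Real.exp (-max v 0) := by
  have hle {a b : ℝ} (ha : 0 ≤ a) (hab : a ≤ b) : Real.exp (-a) - Real.exp (-b) ≤ b - a := by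
    have hfactor : Real.exp (-b) = Real.exp (-a) * Real.exp (-(b - a)) := by
      rw [← Real.exp_add]; ring_nf
    calc Real.exp (-a) - Real.exp (-b) = Real.exp (-a) * (1 - Real.exp (-(b - a))) := by
          rw [hfactor]; ring
      _ ≤ 1 * (1 - Real.exp (-(b - a))) := mul_le_mul_of_nonneg_right
          (Real.exp_le_one_iff.2 (neg_nonpos.2 ha)) (one_sub_exp_neg_nonneg (sub_nonneg.2 hab))
      _ ≤ b - a := by rw [one_mul]; exact one_sub_exp_neg_le _
  refine LipschitzWith.of_le_add fun v w => ?_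
  rw [Real.dist_eq]
  have hmax : max v 0 - max w 0 ≤ |v - w| := (le_abs_self _).trans (abs_max_sub_max_le_abs v w 0)
  rcases le_total (max v 0) (max w 0) with hvw | hwv
  · have : Real.exp (-max w 0) ≤ Real.exp (-max v 0) := Real.exp_le_exp.2 (neg_le_neg hvw)
    linarith [abs_nonneg (v - w)]
  · linarith [hle (le_max_right w 0) hwv]

variable {α : ℝ → ℝ} {p : ℝ → ℕ → ℝ} {G : Measure Pos} {f : ℝ → ℝ} {u m : ℝ → ℝ → ℝ}
  {A b c κ t C K Q : ℝ}

/-- The rate of the quadratic error made when the nonlinear births `birthFun` are replaced by their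
linearization `birthRate`, for arguments growing like `e^{cx}` and for `C` a bound on
`g''(·, 1-)`. -/
noncomputable def secondOrderRate (α : ℝ → ℝ) (p : ℝ → ℕ → ℝ) (G : Measure Pos) (c C x : ℝ) : ℝ :=
  (birthRate α p x * pairing G (fun y => Real.exp (2 * c * y)) +
    α x * (C * pairing G (fun y => Real.exp (c * y)) ^ 2)) / 2

lemma BranchingData.exists_secondOrderRate_bound (hd : BranchingData α p) (hC : 0 ≤ C) :
    ∃ Q, ∀ x, secondOrderRate α p G c C x ≤ Q := by
  obtain ⟨a, -, ha⟩ := hd.exists_rate_bound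
  obtain ⟨K, hK⟩ := hd.exists_birthRate_bound
  have hE : 0 ≤ pairing G fun x => Real.exp (2 * c * x) := pairing_nonneg fun _ _ => by positivity
  exact ⟨_, fun x => div_le_div_of_nonneg_right (add_le_add (mul_le_mul_of_nonneg_right (hK x) hE)
    (mul_le_mul_of_nonneg_right (ha x) (by positivity))) zero_le_two⟩

lemma BranchingData.secondOrderRate_nonneg (hd : BranchingData α p) (hC : 0 ≤ C) (x : ℝ) :
    0 ≤ secondOrderRate α p G c C x := by
  have hE : 0 ≤ pairing G fun x => Real.exp (2 * c * x) := pairing_nonneg fun _ _ => by positivity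
  have hα := hd.rate_C1.nonneg x
  have hβ := hd.birthRate_nonneg x
  unfold secondOrderRate
  positivity

lemma BranchingData.secondOrderRate_zero_off (hd : BranchingData α p) {x : ℝ} (hx : x ≤ 0) :
    secondOrderRate α p G c C x = 0 := by
  simp [secondOrderRate, birthRate, hd.rate_C1.zero_off x hx]

lemma BranchingData.measurable_secondOrderRate (hd : BranchingData α p) :
    Measurable (secondOrderRate α p G c C) :=
  ((hd.measurable_birthRate.mul_const _).add (hd.rate_C1.measurable.mul_const _)).div_const 2

variable [IsProbabilityMeasure G]

lemma pairing_one_sub_exp_mem_Icc {v : ℝ → ℝ} (hv : ∀ x, 0 < x → 0 ≤ v x) :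
    pairing G (fun y => 1 - Real.exp (-v y)) ∈ Set.Icc 0 1 := by
  have hmem (x : ℝ) (hx : 0 < x) : 1 - Real.exp (-v x) ∈ Set.Icc (0 : ℝ) 1 :=
    ⟨one_sub_exp_neg_nonneg (hv x hx), sub_le_self _ (Real.exp_pos _).le⟩
  refine ⟨pairing_nonneg fun x hx => (hmem x hx).1, (le_abs_self _).trans ?_⟩
  exact abs_pairing_le_of_abs_le (f := fun y => 1 - Real.exp (-v y)) fun x hx => by
    rw [abs_of_nonneg (hmem x hx).1]; exact (hmem x hx).2

lemma integrable_exp_neg_of_nonneg {v : ℝ → ℝ} (hv : Measurable v) (h0 : ∀ x, 0 < x → 0 ≤ v x) :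
    Integrable (fun x : Pos => Real.exp (-v x)) G :=
  integrable_exp_neg (hv.comp measurable_subtype_coe) fun x => h0 x x.2

lemma pairing_one_sub_exp {v : ℝ → ℝ} (hv : Measurable v) (h0 : ∀ x, 0 < x → 0 ≤ v x) :
    pairing G (fun y => 1 - Real.exp (-v y)) = 1 - pairing G fun y => Real.exp (-v y) := by
  simp only [pairing]
  rw [integral_sub (integrable_const _) (integrable_exp_neg_of_nonneg hv h0)]
  simp

lemma birthFun_pairing_one_sub_exp {v : ℝ → ℝ} (hv : Measurable v) (h0 : ∀ x, 0 < x → 0 ≤ v x)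
    (x : ℝ) : birthFun α p x (pairing G fun y => 1 - Real.exp (-v y)) =
      α x * (1 - genFun p x (pairing G fun y => Real.exp (-v y))) := by
  rw [birthFun_of_mem (pairing_one_sub_exp_mem_Icc h0), pairing_one_sub_exp hv h0, sub_sub_cancel]

theorem BranchingData.solvesCumulant (hd : BranchingData α p) (hf : BddBorel f)
    (hf0 : ∀ x, 0 ≤ f x) : SolvesCumulant α p G f (cumulant α p G f) := by
  obtain ⟨K, hK⟩ := hd.exists_birthRate_bound
  obtain ⟨C, hC⟩ := hf.bounded
  obtain ⟨u, hu, hub, heqn⟩ := (hd.lipschitzReproduction_birthFun hK).exists_renewal_solution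
    (G := G) lipschitzWith_one_sub_exp_neg_max (by simp) hf.measurable hC
  have hu0 (t x : ℝ) (ht : 0 ≤ t) : 0 ≤ u t x := by
    rw [heqn t x ht]
    exact add_nonneg (hf0 _) (intervalIntegral.integral_nonneg ht fun s _ => hd.birthFun_nonneg _ _)
  refine Classical.epsilon_spec (p := SolvesCumulant α p G f)
    ⟨u, hu, fun t x ht _ => hu0 t x ht, hub, fun t x ht _ => ?_⟩
  rw [heqn t x ht]
  congr 1
  refine intervalIntegral.integral_congr fun s hs => ?_
  rw [Set.uIcc_of_le ht] at hs
  have hpos (y : ℝ) : 0 ≤ u (t - s) y := hu0 _ _ (sub_nonneg.2 hs.2)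
  simp only [max_eq_left (hpos _)]
  exact birthFun_pairing_one_sub_exp hu.of_uncurry_left (fun y _ => hpos y) _

namespace SolvesCumulant

lemma eqn_birthFun (hu : SolvesCumulant α p G f u) (ht : 0 ≤ t) {x : ℝ} (hx : 0 < x) :
    u t x = f (x - t) + ∫ s in (0 : ℝ)..t,
      birthFun α p (x - s) (pairing G fun y => 1 - Real.exp (-u (t - s) y)) := by
  rw [hu.eqn t x ht hx]
  congr 1
  refine intervalIntegral.integral_congr fun s hs => ?_
  rw [Set.uIcc_of_le ht] at hs
  exact (birthFun_pairing_one_sub_exp hu.measurable.of_uncurry_left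
    (fun y => hu.nonneg _ y (sub_nonneg.2 hs.2)) _).symm

lemma measurable_pairing (hu : SolvesCumulant α p G f u) :
    Measurable fun t => pairing G fun y => 1 - Real.exp (-u t y) :=
  measurable_pairing_left (measurable_const.sub (Real.measurable_exp.comp hu.measurable.neg))

lemma pairing_mem_Icc (hu : SolvesCumulant α p G f u) (ht : 0 ≤ t) :
    pairing G (fun y => 1 - Real.exp (-u t y)) ∈ Set.Icc 0 1 :=
  pairing_one_sub_exp_mem_Icc fun x => hu.nonneg t x ht

lemma integrable_one_sub_exp (hu : SolvesCumulant α p G f u) (ht : 0 ≤ t) :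
    Integrable (fun x : Pos => 1 - Real.exp (-u t x)) G :=
  (integrable_const 1).sub
    (integrable_exp_neg_of_nonneg hu.measurable.of_uncurry_left fun x => hu.nonneg t x ht)

lemma intervalIntegrable (hd : BranchingData α p) (hu : SolvesCumulant α p G f u) (ht : 0 ≤ t)
    (x : ℝ) : IntervalIntegrable (fun s =>
      birthFun α p (x - s) (pairing G fun y => 1 - Real.exp (-u (t - s) y))) volume 0 t := by
  obtain ⟨K, hK⟩ := hd.exists_birthRate_bound
  refine (hd.lipschitzReproduction_birthFun hK).intervalIntegrable hu.measurable_pairing ht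
    (M := 1) (fun s hs _ => ?_) x
  rw [abs_of_nonneg (hu.pairing_mem_Icc hs).1]
  exact (hu.pairing_mem_Icc hs).2

lemma mean_sub_eq (hd : BranchingData α p) (hu : SolvesCumulant α p G f u)
    (hm : SolvesMean α p G f m) (ht : 0 ≤ t) {x : ℝ} (hx : 0 < x) :
    m t x - u t x = ∫ s in (0 : ℝ)..t, (birthRate α p (x - s) * pairing G (m (t - s)) -
      birthFun α p (x - s) (pairing G fun y => 1 - Real.exp (-u (t - s) y))) := by
  rw [intervalIntegral.integral_sub (hd.intervalIntegrable_mean hm.measurable hm.locBdd ht x)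
    (hu.intervalIntegrable hd ht x), hm.eqn_birthRate ht hx, hu.eqn_birthFun ht hx,
    add_sub_add_left_eq_sub]

lemma pairing_one_sub_exp_le (hu : SolvesCumulant α p G f u) (ht : 0 ≤ t) :
    pairing G (fun y => 1 - Real.exp (-u t y)) ≤ pairing G (u t) :=
  pairing_mono (hu.integrable_one_sub_exp ht) (hu.locBdd.integrable hu.measurable ht)
    fun _ _ => one_sub_exp_neg_le _

lemma le_pairing_one_sub_exp (hu : SolvesCumulant α p G f u) (ht : 0 ≤ t)
    (hc : Integrable (fun x : Pos => Real.exp (2 * c * x)) G)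
    (hb : ∀ x, 0 < x → u t x ≤ b * Real.exp (c * x)) :
    pairing G (u t) - b ^ 2 / 2 * pairing G (fun x => Real.exp (2 * c * x)) ≤
      pairing G fun y => 1 - Real.exp (-u t y) := by
  have hi := hu.locBdd.integrable (G := G) hu.measurable ht
  calc pairing G (u t) - b ^ 2 / 2 * pairing G (fun x => Real.exp (2 * c * x))
      = ∫ x : Pos, (u t x - b ^ 2 / 2 * Real.exp (2 * c * x)) ∂G := by
        rw [integral_sub hi (hc.const_mul _), integral_const_mul]; rfl
    _ ≤ pairing G fun y => 1 - Real.exp (-u t y) := by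
        refine integral_mono (hi.sub (hc.const_mul _)) (hu.integrable_one_sub_exp ht) fun x => ?_
        have hu0 := hu.nonneg t x ht x.2
        refine le_trans ?_ (sub_sq_div_two_le_one_sub_exp_neg hu0)
        have hsq : u t x ^ 2 ≤ b ^ 2 * Real.exp (2 * c * x) := by
          calc u t x ^ 2 ≤ (b * Real.exp (c * x)) ^ 2 := pow_le_pow_left₀ hu0 (hb x x.2) 2
            _ = _ := by rw [mul_pow, ← Real.exp_nat_mul]; congr 2; push_cast; ring
        linarith

lemma le_mean (hd : BranchingData α p) (h : SubcriticalKernel (birthRate α p) G c κ K)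
    (hu : SolvesCumulant α p G f u) (hm : SolvesMean α p G f m) (ht : 0 ≤ t) {x : ℝ}
    (hx : 0 < x) : u t x ≤ m t x := by
  have hb : LocBdd fun t x => u t x - m t x := hu.locBdd.sub hm.locBdd
  have hmeas : Measurable (Function.uncurry fun t x => u t x - m t x) :=
    hu.measurable.sub hm.measurable
  have hsub : RenewalSubsolution (birthRate α p) G c 0 fun t x => u t x - m t x := by
    refine ⟨le_rfl, hmeas, hb, fun t x ht hx => ?_⟩
    rw [zero_mul, add_zero, ← neg_sub, hu.mean_sub_eq hd hm ht hx, ← intervalIntegral.integral_neg]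
    refine intervalIntegral.integral_mono_on ht
      ((hd.intervalIntegrable_mean hm.measurable hm.locBdd ht x).sub
        (hu.intervalIntegrable hd ht x)).neg (hd.intervalIntegrable_mean hmeas hb ht x)
      fun s hs => ?_
    have hts : 0 ≤ t - s := sub_nonneg.2 hs.2
    rw [hu.locBdd.pairing_sub hm.locBdd hu.measurable hm.measurable hts, neg_sub, mul_sub]
    exact sub_le_sub_right ((hd.birthFun_le _ (hu.pairing_mem_Icc hts)).trans
      (mul_le_mul_of_nonneg_left (hu.pairing_one_sub_exp_le hts) (hd.birthRate_nonneg _))) _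
  have := hsub.le_growthConst_mul h ht hx
  rw [mul_zero, zero_mul] at this
  linarith

end SolvesCumulant

namespace SolvesCumulant

lemma birthRate_sub_birthFun_le (hd : BranchingData α p)
    (h : SubcriticalKernel (birthRate α p) G c κ K) (hu : SolvesCumulant α p G f u) (hC : 0 ≤ C)
    (hg2 : ∀ x, 0 < x → Summable (fun i : ℕ => (i : ℝ) * ((i : ℝ) - 1) * p x i) ∧
      ∑' i : ℕ, (i : ℝ) * ((i : ℝ) - 1) * p x i ≤ C) (ht : 0 ≤ t)
    (hb : ∀ x, 0 < x → u t x ≤ b * Real.exp (c * x)) (x : ℝ) :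
    birthRate α p x * pairing G (u t) -
      birthFun α p x (pairing G fun y => 1 - Real.exp (-u t y)) ≤
        secondOrderRate α p G c C x * b ^ 2 := by
  have hmem := hu.pairing_mem_Icc ht
  have hexpand := hd.le_birthFun hg2 x hmem
  have hlin := mul_le_mul_of_nonneg_left (hu.le_pairing_one_sub_exp ht h.exp_integrable hb)
    (hd.birthRate_nonneg x)
  have hle : pairing G (fun y => 1 - Real.exp (-u t y)) ≤
      b * pairing G fun y => Real.exp (c * y) := by
    refine (hu.pairing_one_sub_exp_le ht).trans ((pairing_mono (hu.locBdd.integrable hu.measurable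
      ht) (h.integrable_exp.const_mul b) hb).trans_eq ?_)
    exact integral_const_mul _ _
  have hsq := pow_le_pow_left₀ hmem.1 hle 2
  have hquad := mul_le_mul_of_nonneg_left
    (mul_le_mul_of_nonneg_left hsq (div_nonneg hC zero_le_two)) (hd.rate_C1.nonneg x)
  unfold secondOrderRate
  linarith

lemma birthRate_sub_birthFun_le_of_decay (hd : BranchingData α p)
    (h : SubcriticalKernel (birthRate α p) G c κ K) (hu : SolvesCumulant α p G f u) (hC : 0 ≤ C)
    (hg2 : ∀ x, 0 < x → Summable (fun i : ℕ => (i : ℝ) * ((i : ℝ) - 1) * p x i) ∧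
      ∑' i : ℕ, (i : ℝ) * ((i : ℝ) - 1) * p x i ≤ C)
    (hb : ∀ t x, 0 ≤ t → 0 < x → u t x ≤ b * Real.exp (c * (x - t))) {s : ℝ} (hst : s ≤ t)
    (x : ℝ) :
    birthRate α p x * pairing G (u (t - s)) -
      birthFun α p x (pairing G fun y => 1 - Real.exp (-u (t - s) y)) ≤
        b ^ 2 * Real.exp (-(c * t)) * (Real.exp (c * s) * secondOrderRate α p G c C x) := by
  have hts : 0 ≤ t - s := sub_nonneg.2 hst
  have hexp : Real.exp (-(c * (t - s))) ^ 2 ≤ Real.exp (-(c * t)) * Real.exp (c * s) := by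
    rw [← Real.exp_nat_mul, ← Real.exp_add]
    exact Real.exp_le_exp.2 (by push_cast; nlinarith [mul_nonneg h.rate_pos.le hts])
  calc _ ≤ secondOrderRate α p G c C x * (b * Real.exp (-(c * (t - s)))) ^ 2 :=
        hu.birthRate_sub_birthFun_le hd h hC hg2 hts (fun y hy => (hb _ y hts hy).trans_eq (by
          rw [mul_assoc, ← Real.exp_add]; ring_nf)) x
    _ ≤ secondOrderRate α p G c C x * (b ^ 2 * (Real.exp (-(c * t)) * Real.exp (c * s))) := by
        rw [mul_pow]
        exact mul_le_mul_of_nonneg_left (mul_le_mul_of_nonneg_left hexp (sq_nonneg b))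
          (hd.secondOrderRate_nonneg hC x)
    _ = _ := by ring

lemma renewalSubsolution_mean_sub (hd : BranchingData α p)
    (h : SubcriticalKernel (birthRate α p) G c κ K) (hu : SolvesCumulant α p G f u)
    (hm : SolvesMean α p G f m) (hC : 0 ≤ C)
    (hg2 : ∀ x, 0 < x → Summable (fun i : ℕ => (i : ℝ) * ((i : ℝ) - 1) * p x i) ∧
      ∑' i : ℕ, (i : ℝ) * ((i : ℝ) - 1) * p x i ≤ C)
    (hQ : ∀ x, secondOrderRate α p G c C x ≤ Q)
    (hb : ∀ t x, 0 ≤ t → 0 < x → u t x ≤ b * Real.exp (c * (x - t))) :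
    RenewalSubsolution (birthRate α p) G c (b ^ 2 * (Q / c)) fun t x => m t x - u t x := by
  have hlb : LocBdd fun t x => m t x - u t x := hm.locBdd.sub hu.locBdd
  have hmeas : Measurable (Function.uncurry fun t x => m t x - u t x) :=
    hm.measurable.sub hu.measurable
  have hc := h.rate_pos
  have hQ0 : 0 ≤ Q := (hd.secondOrderRate_nonneg (G := G) (c := c) hC 0).trans (hQ 0)
  refine ⟨by positivity, hmeas, hlb, fun t x ht hx => ?_⟩
  have hi := hd.intervalIntegrable_mean (G := G) hmeas hlb ht x
  have hj : IntervalIntegrable (fun s => b ^ 2 * Real.exp (-(c * t)) *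
      (Real.exp (c * s) * secondOrderRate α p G c C (x - s))) volume 0 t :=
    (intervalIntegrable_exp_mul hd.measurable_secondOrderRate (hd.secondOrderRate_nonneg hC) hQ
      hc.le ht x).const_mul _
  calc m t x - u t x
      = ∫ s in (0 : ℝ)..t, (birthRate α p (x - s) * pairing G (m (t - s)) -
          birthFun α p (x - s) (pairing G fun y => 1 - Real.exp (-u (t - s) y))) :=
        hu.mean_sub_eq hd hm ht hx
    _ ≤ ∫ s in (0 : ℝ)..t, (birthRate α p (x - s) *
          (pairing G fun y => m (t - s) y - u (t - s) y) + b ^ 2 * Real.exp (-(c * t)) *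
            (Real.exp (c * s) * secondOrderRate α p G c C (x - s))) := by
        refine intervalIntegral.integral_mono_on ht ((hd.intervalIntegrable_mean hm.measurable
          hm.locBdd ht x).sub (hu.intervalIntegrable hd ht x)) (hi.add hj) fun s hs => ?_
        have hts : 0 ≤ t - s := sub_nonneg.2 hs.2
        rw [hm.locBdd.pairing_sub hu.locBdd hm.measurable hu.measurable hts]
        linarith [hu.birthRate_sub_birthFun_le_of_decay hd h hC hg2 hb hs.2 (x - s)]
    _ = (∫ s in (0 : ℝ)..t, birthRate α p (x - s) *
          pairing G fun y => m (t - s) y - u (t - s) y) +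
          b ^ 2 * Real.exp (-(c * t)) * weightedConv (secondOrderRate α p G c C) c t x := by
        rw [intervalIntegral.integral_add hi hj, intervalIntegral.integral_const_mul, weightedConv]
    _ ≤ _ := by
        have hconv := weightedConv_le (x := x) hd.measurable_secondOrderRate
          (hd.secondOrderRate_nonneg hC) hQ (fun _ => hd.secondOrderRate_zero_off) hc ht
        have hexp : Real.exp (c * (x - t)) = Real.exp (-(c * t)) * Real.exp (c * x) := by
          rw [← Real.exp_add]; ring_nf
        rw [hexp]
        linarith [mul_le_mul_of_nonneg_left hconv
          (by positivity : 0 ≤ b ^ 2 * Real.exp (-(c * t)))]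

end SolvesCumulant

theorem SubcriticalKernel.exists_mean_sub_cumulant_le (hd : BranchingData α p)
    (hg2 : BddSecondMoment p) (h : SubcriticalKernel (birthRate α p) G c κ K) :
    ∃ C₂ : ℝ, 0 ≤ C₂ ∧ ∀ (f : ℝ → ℝ) (A : ℝ), BddBorel f → (∀ x, 0 ≤ f x) → ExpBdd c A f →
      ∀ t x : ℝ, 0 ≤ t → 0 < x → meanSemigroup α p G f t x - cumulant α p G f t x ≤
        C₂ * A ^ 2 * Real.exp (c * (x - t)) := by
  obtain ⟨C, hC⟩ := hg2
  have hC0 : 0 ≤ max C 0 := le_max_right C 0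
  obtain ⟨Q, hQ⟩ := hd.exists_secondOrderRate_bound (G := G) (c := c) hC0
  have hQ0 : 0 ≤ Q := (hd.secondOrderRate_nonneg (G := G) (c := c) hC0 0).trans (hQ 0)
  have hc := h.rate_pos
  have hΓ := h.growthConst_nonneg
  refine ⟨growthConst G c κ K * (growthConst G c κ K ^ 2 * (Q / c)), by positivity,
    fun f A hf hf0 hfA t x ht hx => ?_⟩
  have hu := hd.solvesCumulant (G := G) hf hf0
  have hm := hd.solvesMean (G := G) hf
  have hsub := hu.renewalSubsolution_mean_sub hd h hm hC0
    (fun x hx => ⟨(hC x hx).1, (hC x hx).2.trans (le_max_left C 0)⟩) hQ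
    fun t x ht hx => (hu.le_mean hd h hm ht hx).trans
      ((le_abs_self _).trans (h.abs_meanSemigroup_le hd hf hfA ht hx))
  exact (hsub.le_growthConst_mul h ht hx).trans_eq (by ring)

end CumulantEquation

section ExpWeight

variable {f : ℝ → ℝ} {A c : ℝ}

/-- `⟨ν, e^{c ·}⟩`, the weight that controls `⟨ν, f⟩` for functions of growth `e^{cx}`. -/
noncomputable def expWeight (c : ℝ) (ν : PopMeasure) : ℝ :=
  pairing ν.toM fun x => Real.exp (c * x)

lemma expWeight_nonneg (c : ℝ) (ν : PopMeasure) : 0 ≤ expWeight c ν :=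
  pairing_nonneg fun _ _ => (Real.exp_pos _).le

lemma measurable_expWeight (c : ℝ) : Measurable (expWeight c) :=
  measurable_pairing (by fun_prop)

lemma ExpBdd.integrable (hfA : ExpBdd c A f) (hc : 0 ≤ c) (hf : Measurable f) (ν : PopMeasure) :
    Integrable (fun x : Pos => f x) ν.toM :=
  ((ν.integrable_exp hc).const_mul A).mono' (hf.comp measurable_subtype_coe).aestronglyMeasurable
    (.of_forall fun x => hfA x x.2)

lemma ExpBdd.abs_pairing_le (hfA : ExpBdd c A f) (hc : 0 ≤ c) (ν : PopMeasure) :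
    |pairing ν.toM f| ≤ A * expWeight c ν :=
  (AgeBranching.abs_pairing_le ((ν.integrable_exp hc).const_mul A) hfA).trans_eq
    (integral_const_mul _ _)

lemma integral_exp_neg_mul_le (hc : 0 < c) (t : ℝ) :
    ∫ s in (0 : ℝ)..t, Real.exp (-(c * s)) ≤ 1 / c := by
  have hint := mul_integral_mul_exp (-c) 1 t
  simp only [one_mul, neg_mul] at hint
  rw [le_div_iff₀ hc]
  linarith [Real.exp_pos (-(c * t))]

end ExpWeight

section Moments

/-- `∫ ⟨ν, π_s f⟩ L(dν)`, the expected contribution to `⟨Y_t, f⟩`, per unit time, of the immigration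
at time `t - s`. -/
noncomputable def immigrationMean (α : ℝ → ℝ) (p : ℝ → ℕ → ℝ) (G : Measure Pos)
    (L : Measure PopMeasure) (f : ℝ → ℝ) (s : ℝ) : ℝ :=
  ∫ ν, pairing ν.toM (meanSemigroup α p G f s) ∂L

/-- The mean of `⟨Y_t, f⟩` for the process started from `ν`, see `exists_moment_bound`. -/
noncomputable def processMean (α : ℝ → ℝ) (p : ℝ → ℕ → ℝ) (G : Measure Pos)
    (L : Measure PopMeasure) (f : ℝ → ℝ) (t : ℝ) (ν : PopMeasure) : ℝ :=
  pairing ν.toM (meanSemigroup α p G f t) + ∫ s in (0 : ℝ)..t, immigrationMean α p G L f s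

/-- `⟨ν, u_t f⟩ + ∫₀ᵗ ψ(u_s f) ds`, minus the logarithm of the Laplace functional at `f` of the
process started from `ν`. -/
noncomputable def laplaceExponent (α : ℝ → ℝ) (p : ℝ → ℕ → ℝ) (G : Measure Pos)
    (L : Measure PopMeasure) (f : ℝ → ℝ) (t : ℝ) (ν : PopMeasure) : ℝ :=
  pairing ν.toM (cumulant α p G f t) + ∫ s in (0 : ℝ)..t, immigration L (cumulant α p G f s)

variable {α : ℝ → ℝ} {p : ℝ → ℕ → ℝ} {G : Measure Pos}
  {L : Measure PopMeasure} {f : ℝ → ℝ} {A D c κ K t : ℝ}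

lemma IsTransition.integral_exp_neg_mul {P : ℝ≥0 → Kernel PopMeasure PopMeasure}
    (hP : IsTransition α p G L P) (hf : BddBorel f) (hf0 : ∀ x, 0 ≤ f x) {θ : ℝ} (hθ : 0 ≤ θ)
    (t : ℝ≥0) (σ : PopMeasure) :
    ∫ ν, Real.exp (-(θ * pairing ν.toM f)) ∂(P t σ) =
      Real.exp (-laplaceExponent α p G L (fun x => θ * f x) t σ) := by
  have hscale (ν : PopMeasure) : pairing ν.toM (fun x => θ * f x) = θ * pairing ν.toM f :=
    integral_const_mul _ _
  simp only [← hscale]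
  rw [hP.2 _ (hf.const_mul θ) (fun x => mul_nonneg hθ (hf0 x)) t σ, laplaceExponent, neg_add']

variable [IsProbabilityMeasure G]

lemma BranchingData.measurable_meanSemigroup (hd : BranchingData α p) (hf : BddBorel f) (t : ℝ) :
    Measurable (meanSemigroup α p G f t) :=
  (hd.solvesMean hf).measurable.of_uncurry_left

lemma BranchingData.measurable_immigrationMean [SFinite L] (hd : BranchingData α p)
    (hf : BddBorel f) : Measurable (immigrationMean α p G L f) :=
  (measurable_pairing_prod
    (hd.solvesMean hf).measurable).stronglyMeasurable.integral_prod_right.measurable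

lemma BranchingData.pairing_cumulant_nonneg (hd : BranchingData α p) (hf : BddBorel f)
    (hf0 : ∀ x, 0 ≤ f x) (ht : 0 ≤ t) (ν : PopMeasure) :
    0 ≤ pairing ν.toM (cumulant α p G f t) :=
  pairing_nonneg fun x hx => (hd.solvesCumulant hf hf0).nonneg t x ht hx

lemma BranchingData.integrable_one_sub_exp_pairing [IsFiniteMeasure L] (hd : BranchingData α p)
    (hf : BddBorel f) (hf0 : ∀ x, 0 ≤ f x) (ht : 0 ≤ t) :
    Integrable (fun ν : PopMeasure => 1 - Real.exp (-pairing ν.toM (cumulant α p G f t))) L :=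
  (integrable_const 1).sub (integrable_exp_neg
    (measurable_pairing (hd.solvesCumulant hf hf0).measurable.of_uncurry_left)
    fun ν => hd.pairing_cumulant_nonneg hf hf0 ht ν)

lemma BranchingData.intervalIntegrable_immigration [IsFiniteMeasure L] (hd : BranchingData α p)
    (hf : BddBorel f) (hf0 : ∀ x, 0 ≤ f x) (ht : 0 ≤ t) :
    IntervalIntegrable (fun s => immigration L (cumulant α p G f s)) volume 0 t := by
  refine intervalIntegrable_of_abs_le (C := 1 * L.real Set.univ) ?_ ht fun s hs _ => ?_
  · have hpair := measurable_pairing_prod (hd.solvesCumulant (G := G) hf hf0).measurable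
    have hexp : Measurable fun q : ℝ × PopMeasure =>
        1 - Real.exp (-pairing q.2.toM (cumulant α p G f q.1)) :=
      measurable_const.sub (Real.measurable_exp.comp hpair.neg)
    exact hexp.stronglyMeasurable.integral_prod_right.measurable
  · refine norm_integral_le_of_norm_le_const (μ := L)
      (f := fun ν => 1 - Real.exp (-pairing ν.toM (cumulant α p G f s))) (.of_forall fun ν => ?_)
    rw [Real.norm_eq_abs, abs_of_nonneg
      (one_sub_exp_neg_nonneg (hd.pairing_cumulant_nonneg hf hf0 hs.le ν))]
    exact sub_le_self _ (Real.exp_pos _).le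

namespace SubcriticalKernel

lemma expBdd_meanSemigroup (hd : BranchingData α p)
    (h : SubcriticalKernel (birthRate α p) G c κ K) (hf : BddBorel f) (hfA : ExpBdd c A f)
    (ht : 0 ≤ t) :
    ExpBdd c (growthConst G c κ K * A * Real.exp (-(c * t))) (meanSemigroup α p G f t) :=
  fun _ hx => (h.abs_meanSemigroup_le hd hf hfA ht hx).trans_eq (by
    rw [mul_assoc _ (Real.exp _), ← Real.exp_add]; ring_nf)

lemma cumulant_le_meanSemigroup (hd : BranchingData α p)
    (h : SubcriticalKernel (birthRate α p) G c κ K) (hf : BddBorel f) (hf0 : ∀ x, 0 ≤ f x)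
    (ht : 0 ≤ t) {x : ℝ} (hx : 0 < x) : cumulant α p G f t x ≤ meanSemigroup α p G f t x :=
  (hd.solvesCumulant hf hf0).le_mean hd h (hd.solvesMean hf) ht hx

lemma expBdd_cumulant (hd : BranchingData α p)
    (h : SubcriticalKernel (birthRate α p) G c κ K) (hf : BddBorel f) (hf0 : ∀ x, 0 ≤ f x)
    (hfA : ExpBdd c A f) (ht : 0 ≤ t) :
    ExpBdd c (growthConst G c κ K * A * Real.exp (-(c * t))) (cumulant α p G f t) := by
  intro x hx
  rw [abs_of_nonneg ((hd.solvesCumulant hf hf0).nonneg t x ht hx)]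
  exact (h.cumulant_le_meanSemigroup hd hf hf0 ht hx).trans
    ((le_abs_self _).trans (h.expBdd_meanSemigroup hd hf hfA ht x hx))

lemma integrable_pairing_meanSemigroup (hd : BranchingData α p)
    (h : SubcriticalKernel (birthRate α p) G c κ K) (hf : BddBorel f) (hfA : ExpBdd c A f)
    (hW : Integrable (expWeight c) L) (ht : 0 ≤ t) :
    Integrable (fun ν => pairing ν.toM (meanSemigroup α p G f t)) L :=
  (hW.const_mul (growthConst G c κ K * A * Real.exp (-(c * t)))).mono'
    (measurable_pairing (hd.measurable_meanSemigroup hf t)).aestronglyMeasurable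
    (.of_forall fun ν => (h.expBdd_meanSemigroup hd hf hfA ht).abs_pairing_le h.rate_pos.le ν)

lemma abs_immigrationMean_le (hd : BranchingData α p)
    (h : SubcriticalKernel (birthRate α p) G c κ K) (hf : BddBorel f) (hfA : ExpBdd c A f)
    (hW : Integrable (expWeight c) L) (ht : 0 ≤ t) :
    |immigrationMean α p G L f t| ≤
      growthConst G c κ K * A * (∫ ν, expWeight c ν ∂L) * Real.exp (-(c * t)) := by
  refine (norm_integral_le_of_norm_le (f := fun ν => pairing ν.toM (meanSemigroup α p G f t))
    (hW.const_mul _) (.of_forall fun ν =>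
      (h.expBdd_meanSemigroup hd hf hfA ht).abs_pairing_le h.rate_pos.le ν)).trans_eq ?_
  rw [integral_const_mul]
  ring

lemma intervalIntegrable_immigrationMean [SFinite L] (hd : BranchingData α p)
    (h : SubcriticalKernel (birthRate α p) G c κ K) (hf : BddBorel f) (hfA : ExpBdd c A f)
    (hW : Integrable (expWeight c) L) (ht : 0 ≤ t) :
    IntervalIntegrable (immigrationMean α p G L f) volume 0 t := by
  refine intervalIntegrable_of_abs_le (hd.measurable_immigrationMean hf) ht fun s hs _ =>
    (h.abs_immigrationMean_le hd hf hfA hW hs.le).trans (mul_le_of_le_one_right ?_ ?_)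
  · exact mul_nonneg (mul_nonneg h.growthConst_nonneg hfA.nonneg)
      (integral_nonneg (expWeight_nonneg c))
  · exact Real.exp_le_one_iff.2 (neg_nonpos.2 (mul_nonneg h.rate_pos.le hs.le))

lemma abs_processMean_le (hd : BranchingData α p)
    (h : SubcriticalKernel (birthRate α p) G c κ K) (hf : BddBorel f) (hfA : ExpBdd c A f)
    (hW : Integrable (expWeight c) L) (ht : 0 ≤ t) (ν : PopMeasure) :
    |processMean α p G L f t ν| ≤
      growthConst G c κ K * (expWeight c ν + (∫ ν, expWeight c ν ∂L) / c) * A := by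
  have hc := h.rate_pos
  have hΓA : 0 ≤ growthConst G c κ K * A := mul_nonneg h.growthConst_nonneg hfA.nonneg
  have hW0 : 0 ≤ ∫ ν, expWeight c ν ∂L := integral_nonneg (expWeight_nonneg c)
  have hpair : |pairing ν.toM (meanSemigroup α p G f t)| ≤
      growthConst G c κ K * A * expWeight c ν :=
    ((h.expBdd_meanSemigroup hd hf hfA ht).abs_pairing_le hc.le ν).trans
      (mul_le_mul_of_nonneg_right (mul_le_of_le_one_right hΓA
        (Real.exp_le_one_iff.2 (neg_nonpos.2 (mul_nonneg hc.le ht)))) (expWeight_nonneg c ν))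
  have himm : |∫ s in (0 : ℝ)..t, immigrationMean α p G L f s| ≤
      growthConst G c κ K * A * (∫ ν, expWeight c ν ∂L) * (1 / c) := by
    calc _ ≤ ∫ s in (0 : ℝ)..t, growthConst G c κ K * A * (∫ ν, expWeight c ν ∂L) *
          Real.exp (-(c * s)) :=
          intervalIntegral.norm_integral_le_of_norm_le (f := immigrationMean α p G L f) ht
            (.of_forall fun s hs => h.abs_immigrationMean_le hd hf hfA hW hs.1.le)
            (Continuous.intervalIntegrable (by fun_prop) _ _)
      _ ≤ _ := by
          rw [intervalIntegral.integral_const_mul]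
          exact mul_le_mul_of_nonneg_left (integral_exp_neg_mul_le hc t) (mul_nonneg hΓA hW0)
  calc _ ≤ _ := abs_add_le _ _
    _ ≤ _ := add_le_add hpair himm
    _ = _ := by ring

lemma processMean_const_mul (hd : BranchingData α p)
    (h : SubcriticalKernel (birthRate α p) G c κ K) (hf : BddBorel f) (θ : ℝ) (ht : 0 ≤ t)
    (ν : PopMeasure) :
    processMean α p G L (fun x => θ * f x) t ν = θ * processMean α p G L f t ν := by
  have hpair (μ : PopMeasure) {s : ℝ} (hs : 0 ≤ s) :
      pairing μ.toM (meanSemigroup α p G (fun x => θ * f x) s) =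
        θ * pairing μ.toM (meanSemigroup α p G f s) :=
    (pairing_congr fun x hx => h.meanSemigroup_const_mul hd hf θ hs hx).trans
      (integral_const_mul _ _)
  rw [processMean, processMean, hpair ν ht, mul_add, ← intervalIntegral.integral_const_mul]
  congr 1
  refine intervalIntegral.integral_congr fun s hs => ?_
  rw [Set.uIcc_of_le ht] at hs
  simp only [immigrationMean, hpair _ hs.1, integral_const_mul]

lemma pairing_cumulant_le (hd : BranchingData α p)
    (h : SubcriticalKernel (birthRate α p) G c κ K) (hf : BddBorel f) (hf0 : ∀ x, 0 ≤ f x)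
    (hfA : ExpBdd c A f) (ht : 0 ≤ t) (ν : PopMeasure) :
    pairing ν.toM (cumulant α p G f t) ≤ pairing ν.toM (meanSemigroup α p G f t) :=
  pairing_mono
    ((h.expBdd_cumulant hd hf hf0 hfA ht).integrable h.rate_pos.le
      (hd.solvesCumulant hf hf0).measurable.of_uncurry_left ν)
    ((h.expBdd_meanSemigroup hd hf hfA ht).integrable h.rate_pos.le
      (hd.measurable_meanSemigroup hf t) ν)
    fun _ hx => h.cumulant_le_meanSemigroup hd hf hf0 ht hx

lemma pairing_mean_sub_cumulant_le (hd : BranchingData α p)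
    (h : SubcriticalKernel (birthRate α p) G c κ K) (hf : BddBorel f) (hf0 : ∀ x, 0 ≤ f x)
    (hfA : ExpBdd c A f) (hD : ∀ t x : ℝ, 0 ≤ t → 0 < x →
      meanSemigroup α p G f t x - cumulant α p G f t x ≤ D * Real.exp (c * (x - t)))
    (ht : 0 ≤ t) (ν : PopMeasure) :
    pairing ν.toM (meanSemigroup α p G f t) - pairing ν.toM (cumulant α p G f t) ≤
      D * Real.exp (-(c * t)) * expWeight c ν := by
  have hc := h.rate_pos.le
  have hm := (h.expBdd_meanSemigroup hd hf hfA ht).integrable hc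
    (hd.measurable_meanSemigroup hf t) ν
  have hu := (h.expBdd_cumulant hd hf hf0 hfA ht).integrable hc
    (hd.solvesCumulant hf hf0).measurable.of_uncurry_left ν
  calc _ = pairing ν.toM fun x => meanSemigroup α p G f t x - cumulant α p G f t x :=
        (integral_sub hm hu).symm
    _ ≤ pairing ν.toM fun x => D * Real.exp (-(c * t)) * Real.exp (c * x) :=
        pairing_mono (hm.sub hu) ((ν.integrable_exp hc).const_mul _) fun x hx =>
          (hD t x ht hx).trans_eq (by rw [mul_assoc, ← Real.exp_add]; ring_nf)
    _ = _ := integral_const_mul _ _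

lemma immigration_le [IsFiniteMeasure L] (hd : BranchingData α p)
    (h : SubcriticalKernel (birthRate α p) G c κ K) (hf : BddBorel f) (hf0 : ∀ x, 0 ≤ f x)
    (hfA : ExpBdd c A f) (hW : Integrable (expWeight c) L) (ht : 0 ≤ t) :
    immigration L (cumulant α p G f t) ≤ immigrationMean α p G L f t :=
  integral_mono (hd.integrable_one_sub_exp_pairing hf hf0 ht)
    (h.integrable_pairing_meanSemigroup hd hf hfA hW ht) fun ν =>
      (one_sub_exp_neg_le _).trans (h.pairing_cumulant_le hd hf hf0 hfA ht ν)

lemma pairing_mean_sub_one_sub_exp_le (hd : BranchingData α p)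
    (h : SubcriticalKernel (birthRate α p) G c κ K) (hf : BddBorel f) (hf0 : ∀ x, 0 ≤ f x)
    (hfA : ExpBdd c A f) (hD : ∀ t x : ℝ, 0 ≤ t → 0 < x →
      meanSemigroup α p G f t x - cumulant α p G f t x ≤ D * Real.exp (c * (x - t)))
    (ht : 0 ≤ t) (ν : PopMeasure) :
    pairing ν.toM (meanSemigroup α p G f t) -
        (1 - Real.exp (-pairing ν.toM (cumulant α p G f t))) ≤
      D * Real.exp (-(c * t)) * expWeight c ν +
        (growthConst G c κ K * A) ^ 2 / 2 * Real.exp (-(c * t)) * expWeight c ν ^ 2 := by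
  have hexp : Real.exp (-(c * t)) ≤ 1 :=
    Real.exp_le_one_iff.2 (neg_nonpos.2 (mul_nonneg h.rate_pos.le ht))
  have hu0 := hd.pairing_cumulant_nonneg (G := G) hf hf0 ht ν
  have hu : pairing ν.toM (cumulant α p G f t) ^ 2 ≤
      (growthConst G c κ K * A) ^ 2 * Real.exp (-(c * t)) * expWeight c ν ^ 2 := by
    calc _ ≤ (growthConst G c κ K * A * Real.exp (-(c * t)) * expWeight c ν) ^ 2 :=
          pow_le_pow_left₀ hu0 ((le_abs_self _).trans
            ((h.expBdd_cumulant hd hf hf0 hfA ht).abs_pairing_le h.rate_pos.le ν)) 2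
      _ = (growthConst G c κ K * A) ^ 2 * Real.exp (-(c * t)) * expWeight c ν ^ 2 *
            Real.exp (-(c * t)) := by ring
      _ ≤ _ := mul_le_of_le_one_right (by positivity) hexp
  linarith [sub_sq_div_two_le_one_sub_exp_neg hu0,
    h.pairing_mean_sub_cumulant_le hd hf hf0 hfA hD ht ν]

lemma immigrationMean_sub_immigration_le [IsFiniteMeasure L] (hd : BranchingData α p)
    (h : SubcriticalKernel (birthRate α p) G c κ K) (hf : BddBorel f) (hf0 : ∀ x, 0 ≤ f x)
    (hfA : ExpBdd c A f) (hD : ∀ t x : ℝ, 0 ≤ t → 0 < x →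
      meanSemigroup α p G f t x - cumulant α p G f t x ≤ D * Real.exp (c * (x - t)))
    (hW : MemLp (expWeight c) 2 L) (ht : 0 ≤ t) :
    immigrationMean α p G L f t - immigration L (cumulant α p G f t) ≤
      (D * (∫ ν, expWeight c ν ∂L) +
        (growthConst G c κ K * A) ^ 2 / 2 * ∫ ν, expWeight c ν ^ 2 ∂L) * Real.exp (-(c * t)) := by
  have hW1 := hW.integrable one_le_two
  have hm := h.integrable_pairing_meanSemigroup hd hf hfA hW1 ht
  have hu := hd.integrable_one_sub_exp_pairing (G := G) (L := L) hf hf0 ht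
  calc _ = ∫ ν, (pairing ν.toM (meanSemigroup α p G f t) -
        (1 - Real.exp (-pairing ν.toM (cumulant α p G f t)))) ∂L := (integral_sub hm hu).symm
    _ ≤ ∫ ν, (D * Real.exp (-(c * t)) * expWeight c ν +
        (growthConst G c κ K * A) ^ 2 / 2 * Real.exp (-(c * t)) * expWeight c ν ^ 2) ∂L :=
        integral_mono (hm.sub hu) ((hW1.const_mul _).add (hW.integrable_sq.const_mul _)) fun ν =>
          h.pairing_mean_sub_one_sub_exp_le hd hf hf0 hfA hD ht ν
    _ = _ := by
        rw [integral_add (hW1.const_mul _) (hW.integrable_sq.const_mul _), integral_const_mul,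
          integral_const_mul]
        ring

lemma laplaceExponent_le_processMean [IsFiniteMeasure L] (hd : BranchingData α p)
    (h : SubcriticalKernel (birthRate α p) G c κ K) (hf : BddBorel f) (hf0 : ∀ x, 0 ≤ f x)
    (hfA : ExpBdd c A f) (hW : Integrable (expWeight c) L) (ht : 0 ≤ t) (ν : PopMeasure) :
    laplaceExponent α p G L f t ν ≤ processMean α p G L f t ν :=
  add_le_add (h.pairing_cumulant_le hd hf hf0 hfA ht ν)
    (intervalIntegral.integral_mono_on ht (hd.intervalIntegrable_immigration hf hf0 ht)
      (h.intervalIntegrable_immigrationMean hd hf hfA hW ht) fun _ hs =>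
        h.immigration_le hd hf hf0 hfA hW hs.1)

lemma processMean_sub_laplaceExponent_le [IsFiniteMeasure L] (hd : BranchingData α p)
    (h : SubcriticalKernel (birthRate α p) G c κ K) (hf : BddBorel f) (hf0 : ∀ x, 0 ≤ f x)
    (hfA : ExpBdd c A f) (hD0 : 0 ≤ D) (hD : ∀ t x : ℝ, 0 ≤ t → 0 < x →
      meanSemigroup α p G f t x - cumulant α p G f t x ≤ D * Real.exp (c * (x - t)))
    (hW : MemLp (expWeight c) 2 L) (ht : 0 ≤ t) (ν : PopMeasure) :
    processMean α p G L f t ν - laplaceExponent α p G L f t ν ≤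
      D * expWeight c ν + (D * (∫ ν, expWeight c ν ∂L) +
        (growthConst G c κ K * A) ^ 2 / 2 * ∫ ν, expWeight c ν ^ 2 ∂L) / c := by
  have hc := h.rate_pos
  have hW0 : 0 ≤ ∫ ν, expWeight c ν ∂L := integral_nonneg (expWeight_nonneg c)
  have hm := h.intervalIntegrable_immigrationMean hd hf hfA (hW.integrable one_le_two) ht
  have hu := hd.intervalIntegrable_immigration (G := G) (L := L) hf hf0 ht
  set V := D * (∫ ν, expWeight c ν ∂L) +
    (growthConst G c κ K * A) ^ 2 / 2 * ∫ ν, expWeight c ν ^ 2 ∂L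
  have himm : (∫ s in (0 : ℝ)..t, immigrationMean α p G L f s) -
      ∫ s in (0 : ℝ)..t, immigration L (cumulant α p G f s) ≤ V / c := by
    calc _ = ∫ s in (0 : ℝ)..t, (immigrationMean α p G L f s -
          immigration L (cumulant α p G f s)) := (intervalIntegral.integral_sub hm hu).symm
      _ ≤ ∫ s in (0 : ℝ)..t, V * Real.exp (-(c * s)) :=
          intervalIntegral.integral_mono_on ht (hm.sub hu)
            (Continuous.intervalIntegrable (by fun_prop) _ _) fun s hs =>
              h.immigrationMean_sub_immigration_le hd hf hf0 hfA hD hW hs.1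
      _ ≤ _ := by
          rw [intervalIntegral.integral_const_mul, div_eq_mul_one_div V]
          exact mul_le_mul_of_nonneg_left (integral_exp_neg_mul_le hc t) (by positivity)
  have hpair : pairing ν.toM (meanSemigroup α p G f t) - pairing ν.toM (cumulant α p G f t) ≤
      D * expWeight c ν :=
    (h.pairing_mean_sub_cumulant_le hd hf hf0 hfA hD ht ν).trans
      (mul_le_mul_of_nonneg_right (mul_le_of_le_one_right hD0
        (Real.exp_le_one_iff.2 (neg_nonpos.2 (mul_nonneg hc.le ht)))) (expWeight_nonneg c ν))
  unfold processMean laplaceExponent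
  linarith

end SubcriticalKernel

theorem exists_moment_bound [IsFiniteMeasure L] (hd : BranchingData α p) (hg2 : BddSecondMoment p)
    (h : SubcriticalKernel (birthRate α p) G c κ K) (hW : MemLp (expWeight c) 2 L)
    {P : ℝ≥0 → Kernel PopMeasure PopMeasure} (hP : IsTransition α p G L P) (σ : PopMeasure) :
    ∃ M : ℝ, 0 ≤ M ∧ ∀ (f : ℝ → ℝ) (A : ℝ), BddBorel f → (∀ x, 0 ≤ f x) → ExpBdd c A f →
      ∀ t : ℝ≥0,
        Integrable (fun ν => pairing ν.toM f) (P t σ) ∧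
        ∫ ν, pairing ν.toM f ∂(P t σ) = processMean α p G L f t σ ∧
        Integrable (fun ν => pairing ν.toM f ^ 2) (P t σ) ∧
        ∫ ν, pairing ν.toM f ^ 2 ∂(P t σ) ≤ M * A ^ 2 := by
  obtain ⟨C, hC0, hC⟩ := h.exists_mean_sub_cumulant_le hd hg2
  have hc := h.rate_pos
  have hW1 := hW.integrable one_le_two
  have hW0 : 0 ≤ ∫ ν, expWeight c ν ∂L := integral_nonneg (expWeight_nonneg c)
  have hσ := expWeight_nonneg c σ
  set V := C * expWeight c σ + (C * (∫ ν, expWeight c ν ∂L) +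
    growthConst G c κ K ^ 2 / 2 * ∫ ν, expWeight c ν ^ 2 ∂L) / c with hV
  set B := growthConst G c κ K * (expWeight c σ + (∫ ν, expWeight c ν ∂L) / c)
  refine ⟨2 * V + B ^ 2, by positivity, fun f A hf hf0 hfA t => ?_⟩
  have := hP.1 t
  have ht : (0 : ℝ) ≤ t := t.2
  have hscale {θ : ℝ} (hθ : 0 < θ) : ExpBdd c (θ * A) fun x => θ * f x := fun x hx => by
    rw [abs_mul, abs_of_pos hθ, mul_assoc]
    exact mul_le_mul_of_nonneg_left (hfA x hx) hθ.le
  obtain ⟨hX, hmean, hX2, hle⟩ := moments_of_laplace (Q := P t σ) (V := V * A ^ 2)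
    (measurable_pairing hf.measurable) (fun ν => pairing_nonneg fun x _ => hf0 x)
    (fun θ hθ => hP.integral_exp_neg_mul hf hf0 hθ.le t σ)
    (fun θ hθ => (h.laplaceExponent_le_processMean hd (hf.const_mul θ)
      (fun x => mul_nonneg hθ.le (hf0 x)) (hscale hθ) hW1 ht σ).trans_eq
        (h.processMean_const_mul hd hf θ ht σ))
    (fun θ hθ => by
      have := h.processMean_sub_laplaceExponent_le hd (hf.const_mul θ)
        (fun x => mul_nonneg hθ.le (hf0 x)) (hscale hθ) (by positivity)
        (hC _ _ (hf.const_mul θ) (fun x => mul_nonneg hθ.le (hf0 x)) (hscale hθ)) hW ht σ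
      rw [h.processMean_const_mul hd hf θ ht σ] at this
      rw [hV]
      linear_combination this)
  refine ⟨hX, hmean, hX2, hle.trans ?_⟩
  have hB := sq_le_sq' (neg_le_of_abs_le (h.abs_processMean_le hd hf hfA hW1 ht σ))
    (le_of_abs_le (h.abs_processMean_le hd hf hfA hW1 ht σ))
  linarith

end Moments

section ExpDecay

variable {b : ℝ → ℝ} {c C t : ℝ}

lemma integrableOn_exp_neg_mul (hc : 0 < c) (t : ℝ) :
    IntegrableOn (fun s => Real.exp (-(c * s))) (Set.Ioi t) := by
  simpa only [neg_mul] using integrableOn_exp_mul_Ioi (neg_neg_of_pos hc) t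

lemma integral_Ioi_exp_neg_mul (hc : 0 < c) (t : ℝ) :
    ∫ s in Set.Ioi t, Real.exp (-(c * s)) = Real.exp (-(c * t)) / c := by
  simpa only [neg_mul, neg_div_neg_eq] using integral_exp_mul_Ioi (neg_neg_of_pos hc) t

lemma integrableOn_of_exp_decay (hc : 0 < c) (hb : Measurable b)
    (hle : ∀ s, 0 < s → |b s| ≤ C * Real.exp (-(c * s))) : IntegrableOn b (Set.Ioi 0) :=
  ((integrableOn_exp_neg_mul hc 0).const_mul C).mono' hb.aestronglyMeasurable
    ((ae_restrict_mem measurableSet_Ioi).mono hle)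

lemma abs_integral_Ioi_le (hc : 0 < c) (hle : ∀ s, 0 < s → |b s| ≤ C * Real.exp (-(c * s)))
    (ht : 0 ≤ t) : |∫ s in Set.Ioi t, b s| ≤ C / c * Real.exp (-(c * t)) := by
  refine (norm_integral_le_of_norm_le (f := b) ((integrableOn_exp_neg_mul hc t).const_mul C)
    ((ae_restrict_mem measurableSet_Ioi).mono fun s hs => hle s (ht.trans_lt hs))).trans_eq ?_
  rw [integral_const_mul, integral_Ioi_exp_neg_mul hc]
  ring

lemma abs_integral_sub_integral_Ioi_le (hc : 0 < c) (hb : Measurable b)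
    (hle : ∀ s, 0 < s → |b s| ≤ C * Real.exp (-(c * s))) (ht : 0 ≤ t) :
    |(∫ s in (0 : ℝ)..t, b s) - ∫ s in Set.Ioi (0 : ℝ), b s| ≤ C / c * Real.exp (-(c * t)) := by
  have hi := integrableOn_of_exp_decay hc hb hle
  rw [← intervalIntegral.integral_interval_add_Ioi hi (hi.mono_set (Set.Ioi_subset_Ioi ht)),
    sub_add_cancel_left, abs_neg]
  exact abs_integral_Ioi_le hc hle ht

lemma integral_integral_Ioi_swap {S : Type*} [MeasurableSpace S] {μ : Measure S} [SFinite μ]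
    {F : ℝ → S → ℝ} {W : S → ℝ} (hc : 0 < c) (hF : Measurable (Function.uncurry F))
    (hW : Integrable W μ) (hle : ∀ s, 0 < s → ∀ a, |F s a| ≤ W a * Real.exp (-(c * s))) :
    ∫ a, (∫ s in Set.Ioi (0 : ℝ), F s a) ∂μ = ∫ s in Set.Ioi (0 : ℝ), (∫ a, F s a ∂μ) := by
  have hFm : Measurable (Function.uncurry fun a s => F s a) := hF.comp measurable_swap
  refine integral_integral_swap ((hW.mul_prod (integrableOn_exp_neg_mul hc 0)).mono'
    hFm.aestronglyMeasurable ?_)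
  have hpos : ∀ᵐ q ∂(μ.prod (volume.restrict (Set.Ioi (0 : ℝ)))), q.2 ∈ Set.Ioi (0 : ℝ) :=
    Measure.quasiMeasurePreserving_snd.ae (ae_restrict_mem measurableSet_Ioi)
  filter_upwards [hpos] with q hq
  exact hle q.2 hq q.1

end ExpDecay

section TotalMean

variable {α : ℝ → ℝ} {p : ℝ → ℕ → ℝ} {G : Measure Pos} [IsProbabilityMeasure G]
  {L : Measure PopMeasure} {f : ℝ → ℝ} {A c κ K t : ℝ}

lemma BranchingData.measurable_totalMean (hd : BranchingData α p) (hf : BddBorel f) :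
    Measurable (totalMean α p G f) := by
  have hswap : Measurable fun q : ℝ × ℝ => meanSemigroup α p G f q.2 q.1 :=
    (hd.solvesMean hf).measurable.comp measurable_swap
  exact hswap.stronglyMeasurable.integral_prod_right.measurable

lemma BranchingData.bddBorel_indicator_meanSemigroup (hd : BranchingData α p) (hf : BddBorel f)
    (ht : 0 ≤ t) : BddBorel ((Set.Ioi 0).indicator (meanSemigroup α p G f t)) := by
  obtain ⟨B, hB⟩ := (hd.solvesMean (G := G) hf).locBdd t
  refine ⟨(hd.measurable_meanSemigroup hf t).indicator measurableSet_Ioi, ⟨B, fun x => ?_⟩,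
    fun x hx => Set.indicator_of_notMem (not_lt.2 hx) _⟩
  by_cases hx : x ∈ Set.Ioi (0 : ℝ)
  · rw [Set.indicator_of_mem hx]
    exact hB t x ht le_rfl hx
  · rw [Set.indicator_of_notMem hx, abs_zero]
    exact (abs_nonneg _).trans (hB t 1 ht le_rfl one_pos)

namespace SubcriticalKernel

lemma abs_meanSemigroup_le_mul_exp_neg (hd : BranchingData α p)
    (h : SubcriticalKernel (birthRate α p) G c κ K) (hf : BddBorel f) (hfA : ExpBdd c A f)
    (ht : 0 ≤ t) {x : ℝ} (hx : 0 < x) :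
    |meanSemigroup α p G f t x| ≤
      growthConst G c κ K * A * Real.exp (c * x) * Real.exp (-(c * t)) :=
  (h.expBdd_meanSemigroup hd hf hfA ht x hx).trans_eq (mul_right_comm _ _ _)

lemma integrableOn_meanSemigroup (hd : BranchingData α p)
    (h : SubcriticalKernel (birthRate α p) G c κ K) (hf : BddBorel f) (hfA : ExpBdd c A f)
    {x : ℝ} (hx : 0 < x) : IntegrableOn (fun s => meanSemigroup α p G f s x) (Set.Ioi 0) :=
  integrableOn_of_exp_decay h.rate_pos (hd.solvesMean hf).measurable.of_uncurry_right
    fun _ hs => h.abs_meanSemigroup_le_mul_exp_neg hd hf hfA hs.le hx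

lemma expBdd_totalMean (hd : BranchingData α p)
    (h : SubcriticalKernel (birthRate α p) G c κ K) (hf : BddBorel f) (hfA : ExpBdd c A f) :
    ExpBdd c (growthConst G c κ K * A / c) (totalMean α p G f) := fun x hx =>
  (abs_integral_Ioi_le h.rate_pos (fun _ hs =>
    h.abs_meanSemigroup_le_mul_exp_neg hd hf hfA hs.le hx) le_rfl).trans_eq (by simp; ring)

lemma integrable_pairing_totalMean (hd : BranchingData α p)
    (h : SubcriticalKernel (birthRate α p) G c κ K) (hf : BddBorel f) (hfA : ExpBdd c A f)
    (hW : Integrable (expWeight c) L) :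
    Integrable (fun ν : PopMeasure => pairing ν.toM (totalMean α p G f)) L :=
  (hW.const_mul (growthConst G c κ K * A / c)).mono'
    (measurable_pairing (hd.measurable_totalMean hf)).aestronglyMeasurable
    (.of_forall fun ν => (h.expBdd_totalMean hd hf hfA).abs_pairing_le h.rate_pos.le ν)

lemma pairing_totalMean (hd : BranchingData α p)
    (h : SubcriticalKernel (birthRate α p) G c κ K) (hf : BddBorel f) (hfA : ExpBdd c A f)
    (ν : PopMeasure) :
    pairing ν.toM (totalMean α p G f) =
      ∫ s in Set.Ioi (0 : ℝ), pairing ν.toM (meanSemigroup α p G f s) :=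
  integral_integral_Ioi_swap (F := fun s (x : Pos) => meanSemigroup α p G f s x) h.rate_pos
    ((hd.solvesMean hf).measurable.comp
      (measurable_fst.prodMk (measurable_subtype_coe.comp measurable_snd)))
    ((ν.integrable_exp h.rate_pos.le).const_mul (growthConst G c κ K * A))
    fun _ hs x => h.abs_meanSemigroup_le_mul_exp_neg hd hf hfA hs.le x.2

lemma integral_pairing_totalMean [SFinite L] (hd : BranchingData α p)
    (h : SubcriticalKernel (birthRate α p) G c κ K) (hf : BddBorel f) (hfA : ExpBdd c A f)
    (hW : Integrable (expWeight c) L) :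
    ∫ ν, pairing ν.toM (totalMean α p G f) ∂L =
      ∫ s in Set.Ioi (0 : ℝ), immigrationMean α p G L f s := by
  simp only [h.pairing_totalMean hd hf hfA]
  exact integral_integral_Ioi_swap
    (F := fun s (ν : PopMeasure) => pairing ν.toM (meanSemigroup α p G f s)) h.rate_pos
    (measurable_pairing_prod (hd.solvesMean hf).measurable)
    (hW.const_mul (growthConst G c κ K * A)) fun s hs ν =>
      ((h.expBdd_meanSemigroup hd hf hfA hs.le).abs_pairing_le h.rate_pos.le ν).trans_eq
        (mul_right_comm _ _ _)

lemma abs_integral_immigrationMean_sub_le [SFinite L] (hd : BranchingData α p)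
    (h : SubcriticalKernel (birthRate α p) G c κ K) (hf : BddBorel f) (hfA : ExpBdd c A f)
    (hW : Integrable (expWeight c) L) (ht : 0 ≤ t) :
    |(∫ s in (0 : ℝ)..t, immigrationMean α p G L f s) -
        ∫ ν, pairing ν.toM (totalMean α p G f) ∂L| ≤
      growthConst G c κ K * A * (∫ ν, expWeight c ν ∂L) / c * Real.exp (-(c * t)) := by
  rw [h.integral_pairing_totalMean hd hf hfA hW]
  exact abs_integral_sub_integral_Ioi_le h.rate_pos (hd.measurable_immigrationMean hf)
    (fun s hs => h.abs_immigrationMean_le hd hf hfA hW hs.le) ht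

end SubcriticalKernel

end TotalMean

section Markov

variable {Ω : Type*} {m mΩ : MeasurableSpace Ω} {Pr : Measure Ω}

theorem map_prodMk_eq_compProd {E T : Type*} [MeasurableSpace E] [MeasurableSpace T]
    [IsFiniteMeasure Pr] (hm : m ≤ mΩ) {X : Ω → E} (hX : Measurable[m] X) {Z : Ω → T}
    (hZ : Measurable Z) {κ : Kernel E T} [IsMarkovKernel κ]
    (hκ : ∀ B, MeasurableSet B →
      Pr[fun ω => B.indicator (fun _ => (1 : ℝ)) (Z ω) | m] =ᵐ[Pr] fun ω => (κ (X ω)).real B) :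
    Pr.map (fun ω => (X ω, Z ω)) = (Pr.map X) ⊗ₘ κ := by
  have hX' : Measurable X := hX.mono hm le_rfl
  refine Measure.ext_prod fun {A B} hA hB => ?_
  have hAm : MeasurableSet[m] (X ⁻¹' A) := hX hA
  have hind : (fun ω => B.indicator (fun _ => (1 : ℝ)) (Z ω)) =
      (Z ⁻¹' B).indicator fun _ => (1 : ℝ) := rfl
  have hcond : ∫ ω in X ⁻¹' A, Pr[fun ω => B.indicator (fun _ => (1 : ℝ)) (Z ω) | m] ω ∂Pr =
      ∫ ω in X ⁻¹' A, B.indicator (fun _ => (1 : ℝ)) (Z ω) ∂Pr :=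
    setIntegral_condExp hm ((integrable_const (1 : ℝ)).indicator (hZ hB)) hAm
  have hreal : ∫ ω in X ⁻¹' A, (κ (X ω)).real B ∂Pr = Pr.real (X ⁻¹' A ∩ Z ⁻¹' B) := by
    calc _ = ∫ ω in X ⁻¹' A, B.indicator (fun _ => (1 : ℝ)) (Z ω) ∂Pr := by
          rw [← hcond]
          exact setIntegral_congr_ae (hm _ hAm) ((hκ B hB).mono fun ω hω _ => hω.symm)
      _ = _ := by
          rw [hind, setIntegral_indicator (hZ hB)]
          simp
  have hint : Integrable (fun ω => (κ (X ω)).real B) (Pr.restrict (X ⁻¹' A)) :=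
    .of_bound ((κ.measurable_coe hB).comp hX').ennreal_toReal.aestronglyMeasurable 1
      (.of_forall fun ω => by
        rw [Real.norm_eq_abs, abs_of_nonneg measureReal_nonneg]
        exact measureReal_le_one)
  calc Pr.map (fun ω => (X ω, Z ω)) (A ×ˢ B)
      = Pr (X ⁻¹' A ∩ Z ⁻¹' B) := Measure.map_apply (hX'.prodMk hZ) (hA.prod hB)
    _ = ENNReal.ofReal (∫ ω in X ⁻¹' A, (κ (X ω)).real B ∂Pr) := by
        rw [hreal, ofReal_measureReal]
    _ = ∫⁻ ω in X ⁻¹' A, κ (X ω) B ∂Pr := by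
        rw [ofReal_integral_eq_lintegral_ofReal hint (.of_forall fun ω => measureReal_nonneg)]
        exact lintegral_congr fun ω => ofReal_measureReal
    _ = (Pr.map X ⊗ₘ κ) (A ×ˢ B) := by
        rw [Measure.compProd_apply_prod hA hB, setLIntegral_map hA (κ.measurable_coe hB) hX']

lemma integral_mul_of_map_prodMk_eq_compProd {E T : Type*} [MeasurableSpace E]
    [MeasurableSpace T] {μ : Measure E} [SFinite μ] {κ : Kernel E T} [IsSFiniteKernel κ]
    {X : Ω → E} {Z : Ω → T} {φ : E → ℝ} {ψ : T → ℝ} (hX : Measurable X) (hZ : Measurable Z)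
    (hφ : Measurable φ) (hψ : Measurable ψ)
    (hlaw : Pr.map (fun ω => (X ω, Z ω)) = μ ⊗ₘ κ)
    (hint : Integrable (fun ω => φ (X ω) * ψ (Z ω)) Pr) :
    ∫ ω, φ (X ω) * ψ (Z ω) ∂Pr = ∫ x, φ x * ∫ z, ψ z ∂(κ x) ∂μ := by
  have hF : Measurable fun q : E × T => φ q.1 * ψ q.2 :=
    (hφ.comp measurable_fst).mul (hψ.comp measurable_snd)
  have hXZ := (hX.prodMk hZ).aemeasurable (μ := Pr)
  have hint' : Integrable (fun q : E × T => φ q.1 * ψ q.2) (μ ⊗ₘ κ) := by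
    rw [← hlaw]
    exact (integrable_map_measure hF.aestronglyMeasurable hXZ).2 hint
  calc ∫ ω, φ (X ω) * ψ (Z ω) ∂Pr
      = ∫ q, φ q.1 * ψ q.2 ∂(μ ⊗ₘ κ) := by
        rw [← hlaw, integral_map hXZ hF.aestronglyMeasurable]
    _ = ∫ x, φ x * ∫ z, ψ z ∂(κ x) ∂μ := by
        rw [Measure.integral_compProd hint']
        simp only [integral_const_mul]

variable {ℱ : Filtration ℝ≥0 mΩ} {α : ℝ → ℝ} {p : ℝ → ℕ → ℝ} {G : Measure Pos}
  {L : Measure PopMeasure} {σ : PopMeasure} {Y : ℝ≥0 → Ω → PopMeasure}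

namespace IsProcess

lemma measurable (hY : IsProcess Pr ℱ α p G L σ Y) (t : ℝ≥0) : Measurable (Y t) :=
  (hY.adapted t).mono (ℱ.le t) le_rfl

lemma measurable_uncurry (hY : IsProcess Pr ℱ α p G L σ Y) : Measurable (Function.uncurry Y) :=
  Measurable.subtype_mk (measurable_uncurry_finiteMeasure_of_rightContinuous
    (fun t => measurable_subtype_coe.comp (hY.measurable t)) fun ω t =>
      continuous_subtype_val.continuousAt.comp_continuousWithinAt (hY.right_continuous ω t))

lemma exists_transition [IsProbabilityMeasure Pr] (hY : IsProcess Pr ℱ α p G L σ Y) :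
    ∃ P : ℝ≥0 → Kernel PopMeasure PopMeasure, IsTransition α p G L P ∧
      (∀ t, Pr.map (Y t) = P t σ) ∧
      ∀ s t, Pr.map (fun ω => (Y s ω, Y (s + t) ω)) = (P s σ) ⊗ₘ (P t) := by
  obtain ⟨P, hP, hM⟩ := hY.markov
  have hjoint (s t : ℝ≥0) :
      Pr.map (fun ω => (Y s ω, Y (s + t) ω)) = (Pr.map (Y s)) ⊗ₘ (P t) := by
    have := hP.1 t
    refine map_prodMk_eq_compProd (ℱ.le s) (hY.adapted s) (hY.measurable _) fun B hB => ?_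
    refine (hM s t _ (measurable_const.indicator hB) ⟨1, fun ν => ?_⟩).trans
      (.of_forall fun ω => integral_indicator_one hB)
    by_cases hν : ν ∈ B <;> simp [hν]
  have hlaw (t : ℝ≥0) : Pr.map (Y t) = P t σ := by
    have := hP.1 t
    have hstart : Pr.map (Y 0) = Measure.dirac σ := by
      rw [Measure.map_congr hY.start, Measure.map_const]
      simp
    have hsnd := congrArg Measure.snd (hjoint 0 t)
    rwa [zero_add, Measure.snd_map_prodMk (hY.measurable 0), hstart, Measure.snd_compProd,
      Measure.dirac_bind (P t).measurable] at hsnd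
  exact ⟨P, hP, hlaw, fun s t => by rw [hjoint, hlaw]⟩

end IsProcess

end Markov

-- The weighted inequality `u v ≤ e u² / 2 + v² / (2 e)`, applied to `u = X - a` and `v = Z + b`.
lemma integral_sub_mul_add_le {S : Type*} [MeasurableSpace S] {μ : Measure S}
    [IsProbabilityMeasure μ] {X Z : S → ℝ} {a b e : ℝ} (hX : MemLp X 2 μ) (hZ : MemLp Z 2 μ)
    (he : 0 < e) :
    ∫ ν, (X ν - a) * (Z ν + b) ∂μ ≤
      e * (∫ ν, X ν ^ 2 ∂μ + a ^ 2) + e⁻¹ * (∫ ν, Z ν ^ 2 ∂μ + b ^ 2) := by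
  have hpt (x z : ℝ) : (x - a) * (z + b) ≤ e * (x ^ 2 + a ^ 2) + e⁻¹ * (z ^ 2 + b ^ 2) := by
    have hgap : e * (x ^ 2 + a ^ 2) + e⁻¹ * (z ^ 2 + b ^ 2) - (x - a) * (z + b) =
        (e * (x - a) - (z + b)) ^ 2 / (2 * e) + e / 2 * (x + a) ^ 2 + (z - b) ^ 2 / (2 * e) := by
      field_simp
      ring
    have : 0 ≤ (e * (x - a) - (z + b)) ^ 2 / (2 * e) + e / 2 * (x + a) ^ 2 +
      (z - b) ^ 2 / (2 * e) := by positivity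
    linarith
  have hX2 : Integrable (fun ν => e * (X ν ^ 2 + a ^ 2)) μ :=
    (hX.integrable_sq.add (integrable_const _)).const_mul e
  have hZ2 : Integrable (fun ν => e⁻¹ * (Z ν ^ 2 + b ^ 2)) μ :=
    (hZ.integrable_sq.add (integrable_const _)).const_mul e⁻¹
  have hmul : Integrable (fun ν => (X ν - a) * (Z ν + b)) μ :=
    (hX.sub (memLp_const a)).integrable_mul (hZ.add (memLp_const b))
  refine (integral_mono hmul (hX2.add hZ2) fun ν => hpt (X ν) (Z ν)).trans_eq ?_
  rw [integral_add' hX2 hZ2, integral_const_mul, integral_const_mul,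
    integral_add hX.integrable_sq (integrable_const _),
    integral_add hZ.integrable_sq (integrable_const _)]
  simp

lemma BddBorel.exists_expBdd {f : ℝ → ℝ} {c : ℝ} (hf : BddBorel f) (hc : 0 ≤ c) :
    ∃ A, ExpBdd c A f := by
  obtain ⟨A, hA⟩ := hf.bounded
  exact ⟨A, fun x hx => (hA x).trans (le_mul_of_one_le_right ((abs_nonneg _).trans (hA 0))
    (Real.one_le_exp (mul_nonneg hc hx.le)))⟩

lemma BddBorel.max_zero {f : ℝ → ℝ} (hf : BddBorel f) : BddBorel fun x => max (f x) 0 := by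
  obtain ⟨C, hC⟩ := hf.bounded
  refine ⟨hf.measurable.max measurable_const, ⟨C, fun x => ?_⟩,
    fun x hx => by simp [hf.zero_off x hx]⟩
  rw [abs_of_nonneg (le_max_right _ _)]
  exact max_le ((le_abs_self _).trans (hC x)) ((abs_nonneg _).trans (hC x))

section Correlation

variable {α : ℝ → ℝ} {p : ℝ → ℕ → ℝ} {G : Measure Pos} [IsProbabilityMeasure G]
  {L : Measure PopMeasure} {P : ℝ≥0 → Kernel PopMeasure PopMeasure}
  {f : ℝ → ℝ} {c κ K : ℝ}

lemma SubcriticalKernel.integral_pairing_totalMean_sub {f₁ f₂ : ℝ → ℝ} (hd : BranchingData α p)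
    (h : SubcriticalKernel (birthRate α p) G c κ K) (hW : Integrable (expWeight c) L)
    (h₁ : BddBorel f₁) (h₂ : BddBorel f₂) (hf : BddBorel fun x => f₁ x - f₂ x) :
    ∫ ν, pairing ν.toM (totalMean α p G fun x => f₁ x - f₂ x) ∂L =
      ∫ ν, pairing ν.toM (totalMean α p G f₁) ∂L - ∫ ν, pairing ν.toM (totalMean α p G f₂) ∂L := by
  obtain ⟨A₁, hfA₁⟩ := h₁.exists_expBdd h.rate_pos.le
  obtain ⟨A₂, hfA₂⟩ := h₂.exists_expBdd h.rate_pos.le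
  have htotal {x : ℝ} (hx : 0 < x) : totalMean α p G (fun x => f₁ x - f₂ x) x =
      totalMean α p G f₁ x - totalMean α p G f₂ x := by
    rw [totalMean, setIntegral_congr_fun measurableSet_Ioi fun s hs =>
      h.meanSemigroup_sub hd h₁ h₂ hf (le_of_lt hs) hx]
    exact integral_sub (h.integrableOn_meanSemigroup hd h₁ hfA₁ hx)
      (h.integrableOn_meanSemigroup hd h₂ hfA₂ hx)
  have hpair (ν : PopMeasure) : pairing ν.toM (totalMean α p G fun x => f₁ x - f₂ x) =
      pairing ν.toM (totalMean α p G f₁) - pairing ν.toM (totalMean α p G f₂) :=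
    (pairing_congr fun _ => htotal).trans (integral_sub
      ((h.expBdd_totalMean hd h₁ hfA₁).integrable h.rate_pos.le (hd.measurable_totalMean h₁) ν)
      ((h.expBdd_totalMean hd h₂ hfA₂).integrable h.rate_pos.le (hd.measurable_totalMean h₂) ν))
  simp only [hpair]
  exact integral_sub (h.integrable_pairing_totalMean hd h₁ hfA₁ hW)
    (h.integrable_pairing_totalMean hd h₂ hfA₂ hW)

namespace IsTransition

variable [IsFiniteMeasure L]

lemma memLp_pairing (hP : IsTransition α p G L P) (hd : BranchingData α p)
    (hg2 : BddSecondMoment p) (h : SubcriticalKernel (birthRate α p) G c κ K)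
    (hW : MemLp (expWeight c) 2 L) (hf : BddBorel f) (hf0 : ∀ x, 0 ≤ f x)
    (t : ℝ≥0) (σ : PopMeasure) :
    MemLp (fun ν : PopMeasure => pairing ν.toM f) 2 (P t σ) := by
  obtain ⟨A, hfA⟩ := hf.exists_expBdd h.rate_pos.le
  obtain ⟨_, _, hmom⟩ := exists_moment_bound hd hg2 h hW hP σ
  exact (memLp_two_iff_integrable_sq (measurable_pairing hf.measurable).aestronglyMeasurable).2
    (hmom f A hf hf0 hfA t).2.2.1

lemma integral_pairing_sub (hP : IsTransition α p G L P) (hd : BranchingData α p)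
    (hg2 : BddSecondMoment p) (h : SubcriticalKernel (birthRate α p) G c κ K)
    (hW : MemLp (expWeight c) 2 L) (hf : BddBorel f) (hf0 : ∀ x, 0 ≤ f x)
    (t : ℝ≥0) (σ : PopMeasure) (a : ℝ) :
    ∫ ν, (pairing ν.toM f - a) ∂(P t σ) = processMean α p G L f t σ - a := by
  obtain ⟨A, hfA⟩ := hf.exists_expBdd h.rate_pos.le
  obtain ⟨_, _, hmom⟩ := exists_moment_bound hd hg2 h hW hP σ
  obtain ⟨hint, hmean, -, -⟩ := hmom f A hf hf0 hfA t
  have : IsProbabilityMeasure (P t σ) := (hP.1 t).isProbabilityMeasure σ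
  rw [integral_sub hint (integrable_const _), hmean]
  simp

lemma exists_integral_sq_meanSemigroup_le (hP : IsTransition α p G L P) (hd : BranchingData α p)
    (hg2 : BddSecondMoment p) (h : SubcriticalKernel (birthRate α p) G c κ K)
    (hW : MemLp (expWeight c) 2 L) (hf : BddBorel f) (hf0 : ∀ x, 0 ≤ f x) (σ : PopMeasure) :
    ∃ M, ∀ s t : ℝ≥0,
      MemLp (fun ν : PopMeasure => pairing ν.toM (meanSemigroup α p G f t)) 2 (P s σ) ∧
      ∫ ν, pairing ν.toM (meanSemigroup α p G f t) ^ 2 ∂(P s σ) ≤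
        M * Real.exp (-(c * t)) ^ 2 := by
  obtain ⟨A, hfA⟩ := hf.exists_expBdd h.rate_pos.le
  obtain ⟨M, -, hmom⟩ := exists_moment_bound hd hg2 h hW hP σ
  refine ⟨M * (growthConst G c κ K * A) ^ 2, fun s t => ?_⟩
  set f' := (Set.Ioi 0).indicator (meanSemigroup α p G f t)
  have hf' : BddBorel f' := hd.bddBorel_indicator_meanSemigroup hf t.2
  have hf'0 : ∀ x, 0 ≤ f' x := Set.indicator_nonneg fun x hx =>
    h.meanSemigroup_nonneg hd hf hf0 t.2 hx
  have hf'_eq {x : ℝ} (hx : 0 < x) : meanSemigroup α p G f t x = f' x :=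
    (Set.indicator_of_mem (Set.mem_Ioi.2 hx) _).symm
  have hf'A : ExpBdd c (growthConst G c κ K * A * Real.exp (-(c * t))) f' := fun x hx => by
    rw [← hf'_eq hx]
    exact h.expBdd_meanSemigroup hd hf hfA t.2 x hx
  have hpair (ν : PopMeasure) : pairing ν.toM (meanSemigroup α p G f t) = pairing ν.toM f' :=
    pairing_congr fun _ => hf'_eq
  simp only [hpair]
  refine ⟨hP.memLp_pairing hd hg2 h hW hf' hf'0 s σ, ?_⟩
  exact (hmom f' _ hf' hf'0 hf'A s).2.2.2.trans_eq (by ring)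

theorem exists_correlation_le (hP : IsTransition α p G L P) (hd : BranchingData α p)
    (hg2 : BddSecondMoment p) (h : SubcriticalKernel (birthRate α p) G c κ K)
    (hW : MemLp (expWeight c) 2 L) (hf : BddBorel f) (hf0 : ∀ x, 0 ≤ f x) (σ : PopMeasure) {a : ℝ}
    (ha : a = ∫ ν, pairing ν.toM (totalMean α p G f) ∂L) :
    ∃ C, ∀ s t : ℝ≥0, ∫ ν, (pairing ν.toM f - a) * (processMean α p G L f t ν - a) ∂(P s σ) ≤
      C * Real.exp (-(c * t)) := by
  obtain ⟨A, hfA⟩ := hf.exists_expBdd h.rate_pos.le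
  obtain ⟨M, -, hmom⟩ := exists_moment_bound hd hg2 h hW hP σ
  obtain ⟨M', hM'⟩ := hP.exists_integral_sq_meanSemigroup_le hd hg2 h hW hf hf0 σ
  set D := growthConst G c κ K * A * (∫ ν, expWeight c ν ∂L) / c
  refine ⟨M * A ^ 2 + a ^ 2 + (M' + D ^ 2), fun s t => ?_⟩
  set e := Real.exp (-(c * t))
  set b := (∫ r in (0 : ℝ)..t, immigrationMean α p G L f r) - a with hb
  have hb_sq : b ^ 2 ≤ (D * e) ^ 2 := by
    rw [← sq_abs b, hb, ha]
    exact pow_le_pow_left₀ (abs_nonneg _)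
      (h.abs_integral_immigrationMean_sub_le hd hf hfA (hW.integrable one_le_two) t.2) 2
  have : IsProbabilityMeasure (P s σ) := (hP.1 s).isProbabilityMeasure σ
  simp only [processMean, add_sub_assoc]
  calc ∫ ν, (pairing ν.toM f - a) * (pairing ν.toM (meanSemigroup α p G f t) + b) ∂(P s σ)
      ≤ e * (∫ ν, pairing ν.toM f ^ 2 ∂(P s σ) + a ^ 2) +
          e⁻¹ * (∫ ν, pairing ν.toM (meanSemigroup α p G f t) ^ 2 ∂(P s σ) + b ^ 2) :=
        integral_sub_mul_add_le (hP.memLp_pairing hd hg2 h hW hf hf0 s σ) (hM' s t).1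
          (Real.exp_pos _)
    _ ≤ e * (M * A ^ 2 + a ^ 2) + e⁻¹ * (M' * e ^ 2 + (D * e) ^ 2) := by
        gcongr
        · exact (hmom f A hf hf0 hfA s).2.2.2
        · exact (hM' s t).2
    _ = (M * A ^ 2 + a ^ 2 + (M' + D ^ 2)) * e := by
        field_simp

end IsTransition

variable {Ω : Type*} {mΩ : MeasurableSpace Ω} {Pr : Measure Ω} [IsProbabilityMeasure Pr]
  [IsFiniteMeasure L] {ℱ : Filtration ℝ≥0 mΩ} {σ : PopMeasure} {Y : ℝ≥0 → Ω → PopMeasure}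

namespace IsProcess

theorem exists_expDecorrelated (hY : IsProcess Pr ℱ α p G L σ Y) (hd : BranchingData α p)
    (hg2 : BddSecondMoment p) (h : SubcriticalKernel (birthRate α p) G c κ K)
    (hW : MemLp (expWeight c) 2 L) (hf : BddBorel f) (hf0 : ∀ x, 0 ≤ f x) :
    ∃ C, ExpDecorrelated Pr (fun s ω => pairing (Y s.toNNReal ω).toM f -
      ∫ ν, pairing ν.toM (totalMean α p G f) ∂L) C c := by
  obtain ⟨P, hP, hlaw, hjoint⟩ := hY.exists_transition
  set a := ∫ ν, pairing ν.toM (totalMean α p G f) ∂L with ha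
  obtain ⟨C, hC⟩ := hP.exists_correlation_le hd hg2 h hW hf hf0 σ ha
  have hfm : Measurable fun ν : PopMeasure => pairing ν.toM f - a :=
    (measurable_pairing hf.measurable).sub_const a
  have hLp (s : ℝ≥0) : MemLp (fun ω => pairing (Y s ω).toM f - a) 2 Pr := by
    have hPs := hP.memLp_pairing hd hg2 h hW hf hf0 s σ
    rw [← hlaw s] at hPs
    exact (hPs.comp_of_map (hY.measurable s).aemeasurable).sub (memLp_const a)
  refine ⟨C, ?_, h.rate_pos, fun s _ => (hLp s.toNNReal).integrable_sq, fun s t hs ht => ?_⟩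
  · exact hfm.comp (hY.measurable_uncurry.comp
      ((measurable_real_toNNReal.comp measurable_fst).prodMk measurable_snd))
  · have := hP.1
    have : IsProbabilityMeasure (P s.toNNReal σ) := (hP.1 _).isProbabilityMeasure σ
    rw [Real.toNNReal_add hs ht, integral_mul_of_map_prodMk_eq_compProd (hY.measurable _)
      (hY.measurable _) hfm hfm (hjoint s.toNNReal t.toNNReal) ((hLp _).integrable_mul (hLp _))]
    simp only [hP.integral_pairing_sub hd hg2 h hW hf hf0]
    simpa only [Real.coe_toNNReal t ht] using hC s.toNNReal t.toNNReal

lemma ae_tendsto_occupation_of_nonneg (hY : IsProcess Pr ℱ α p G L σ Y) (hd : BranchingData α p)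
    (hg2 : BddSecondMoment p) (h : SubcriticalKernel (birthRate α p) G c κ K)
    (hW : MemLp (expWeight c) 2 L) (hf : BddBorel f) (hf0 : ∀ x, 0 ≤ f x) :
    ∀ᵐ ω ∂Pr, (∀ t : ℝ, 0 ≤ t → IntervalIntegrable
        (fun s : ℝ => pairing (Y s.toNNReal ω).toM f) volume 0 t) ∧
      Tendsto (fun t : ℝ => t⁻¹ * occupation Y f t ω) atTop
        (𝓝 (∫ ν, pairing ν.toM (totalMean α p G f) ∂L)) := by
  obtain ⟨C, hC⟩ := hY.exists_expDecorrelated hd hg2 h hW hf hf0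
  exact ae_tendsto_time_average (fun s ω => pairing_nonneg fun x _ => hf0 x) hC

theorem ae_tendsto_occupation (hY : IsProcess Pr ℱ α p G L σ Y)
    (hd : BranchingData α p) (hg2 : BddSecondMoment p)
    (h : SubcriticalKernel (birthRate α p) G c κ K)
    (hW : MemLp (expWeight c) 2 L) (hf : BddBorel f) :
    ∀ᵐ ω ∂Pr, (∀ t : ℝ, 0 ≤ t → IntervalIntegrable
        (fun s : ℝ => pairing (Y s.toNNReal ω).toM f) volume 0 t) ∧
      Tendsto (fun t : ℝ => t⁻¹ * occupation Y f t ω) atTop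
        (𝓝 (∫ ν, pairing ν.toM (totalMean α p G f) ∂L)) := by
  set f₁ : ℝ → ℝ := fun x => max (f x) 0
  set f₂ : ℝ → ℝ := fun x => max (-1 * f x) 0
  have h₁ : BddBorel f₁ := hf.max_zero
  have h₂ : BddBorel f₂ := (hf.const_mul (-1)).max_zero
  have hsplit : f = fun x => f₁ x - f₂ x := funext fun x => by
    simp only [f₁, f₂, neg_one_mul, max_zero_sub_max_neg_zero_eq_self]
  have hpair (ν : PopMeasure) :
      pairing ν.toM f = pairing ν.toM f₁ - pairing ν.toM f₂ := by
    obtain ⟨A₁, hfA₁⟩ := h₁.exists_expBdd h.rate_pos.le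
    obtain ⟨A₂, hfA₂⟩ := h₂.exists_expBdd h.rate_pos.le
    conv_lhs => rw [hsplit]
    exact integral_sub (hfA₁.integrable h.rate_pos.le h₁.measurable ν)
      (hfA₂.integrable h.rate_pos.le h₂.measurable ν)
  have hlimit := h.integral_pairing_totalMean_sub hd (hW.integrable one_le_two) h₁ h₂ (hsplit ▸ hf)
  rw [← hsplit] at hlimit
  rw [hlimit]
  filter_upwards [hY.ae_tendsto_occupation_of_nonneg hd hg2 h hW h₁ fun x => le_max_right _ _,
    hY.ae_tendsto_occupation_of_nonneg hd hg2 h hW h₂ fun x => le_max_right _ _]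
    with ω ⟨hint₁, hlim₁⟩ ⟨hint₂, hlim₂⟩
  simp only [occupation, hpair] at hlim₁ hlim₂ ⊢
  refine ⟨fun t ht => (hint₁ t ht).sub (hint₂ t ht), (hlim₁.sub hlim₂).congr' ?_⟩
  filter_upwards [eventually_ge_atTop 0] with t ht
  rw [intervalIntegral.integral_sub (hint₁ t ht) (hint₂ t ht), mul_sub]

end IsProcess

end Correlation

lemma ofReal_integral_le_lintegral_ofReal {S : Type*} [MeasurableSpace S] {μ : Measure S}
    {f : S → ℝ} (h0 : ∀ x, 0 ≤ f x) :
    ENNReal.ofReal (∫ x, f x ∂μ) ≤ ∫⁻ x, ENNReal.ofReal (f x) ∂μ := by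
  rw [← Real.enorm_of_nonneg (integral_nonneg h0)]
  exact (enorm_integral_le_lintegral_enorm f).trans_eq
    (lintegral_congr fun x => Real.enorm_of_nonneg (h0 x))

lemma exp_midpoint_mul_le (a b s : ℝ) :
    Real.exp ((a + b) / 2 * s) ≤ 2⁻¹ * Real.exp (a * s) + 2⁻¹ * Real.exp (b * s) := by
  have hconv : Real.exp (2⁻¹ * (a * s) + 2⁻¹ * (b * s)) ≤
      2⁻¹ * Real.exp (a * s) + 2⁻¹ * Real.exp (b * s) :=
    convexOn_exp.2 (Set.mem_univ _) (Set.mem_univ _) (by norm_num) (by norm_num) (by norm_num)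
  rwa [show (a + b) / 2 * s = 2⁻¹ * (a * s) + 2⁻¹ * (b * s) by ring]

section Reproduction

variable {α : ℝ → ℝ} {p : ℝ → ℕ → ℝ} {G : Measure Pos} {c t : ℝ}

lemma ofReal_weightedConv_le {β : ℝ → ℝ} (h0 : ∀ x, 0 ≤ β x) (ht : 0 ≤ t) (x : ℝ) :
    ENNReal.ofReal (weightedConv β c t x) ≤
      ∫⁻ s in Set.Ioi (0 : ℝ), ENNReal.ofReal (Real.exp (c * s)) * ENNReal.ofReal (β (x - s)) := by
  simp only [weightedConv, intervalIntegral.integral_of_le ht,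
    ← ENNReal.ofReal_mul (Real.exp_pos _).le]
  exact (ofReal_integral_le_lintegral_ofReal fun s => mul_nonneg (Real.exp_pos _).le (h0 _)).trans
    (lintegral_mono_set Set.Ioc_subset_Ioi_self)

lemma ofReal_pairing_weightedConv_le [SFinite G] {β : ℝ → ℝ} (hm : Measurable β)
    (h0 : ∀ x, 0 ≤ β x) (ht : 0 ≤ t) :
    ENNReal.ofReal (pairing G (weightedConv β c t)) ≤
      ∫⁻ s in Set.Ioi (0 : ℝ), ENNReal.ofReal (Real.exp (c * s)) *
        ∫⁻ x : Pos, ENNReal.ofReal (β (x - s)) ∂G := by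
  calc ENNReal.ofReal (pairing G (weightedConv β c t))
      ≤ ∫⁻ x : Pos, ENNReal.ofReal (weightedConv β c t x) ∂G :=
        ofReal_integral_le_lintegral_ofReal fun _ => weightedConv_nonneg h0 ht
    _ ≤ ∫⁻ x : Pos, (∫⁻ s in Set.Ioi (0 : ℝ),
          ENNReal.ofReal (Real.exp (c * s)) * ENNReal.ofReal (β (x - s))) ∂G :=
        lintegral_mono fun x => ofReal_weightedConv_le h0 ht x
    _ = _ := by
        rw [lintegral_lintegral_swap (by fun_prop)]
        exact lintegral_congr fun s => lintegral_const_mul _ (by fun_prop)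

lemma reproduction_eq (hd : BranchingData α p) (c : ℝ) :
    reproduction α p G c = ∫⁻ s in Set.Ioi (0 : ℝ), ENNReal.ofReal (Real.exp (c * s)) *
      ∫⁻ x : Pos, ENNReal.ofReal (birthRate α p (x - s)) ∂G := by
  refine lintegral_congr fun s => congrArg _ ?_
  refine setLIntegral_eq_of_support_subset fun x hx => ?_
  by_contra hxs
  exact hx (by simp [hd.rate_C1.zero_off _ (sub_nonpos.2 (not_lt.1 hxs))])

lemma measurable_lintegral_birthRate [SFinite G] (hd : BranchingData α p) :
    Measurable fun s : ℝ => ∫⁻ x : Pos, ENNReal.ofReal (birthRate α p (x - s)) ∂G := by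
  have hβ := hd.measurable_birthRate
  exact Measurable.lintegral_prod_right' (f := fun q : ℝ × Pos =>
    ENNReal.ofReal (birthRate α p (q.2 - q.1))) (by fun_prop)

lemma reproduction_midpoint_le [SFinite G] (hd : BranchingData α p) (a b : ℝ) :
    reproduction α p G ((a + b) / 2) ≤
      2⁻¹ * reproduction α p G a + 2⁻¹ * reproduction α p G b := by
  have hm := measurable_lintegral_birthRate (G := G) hd
  have hexp (s : ℝ) : ENNReal.ofReal (Real.exp ((a + b) / 2 * s)) ≤
      2⁻¹ * ENNReal.ofReal (Real.exp (a * s)) + 2⁻¹ * ENNReal.ofReal (Real.exp (b * s)) := by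
    have h2 : (2⁻¹ : ℝ≥0∞) = ENNReal.ofReal 2⁻¹ := by simp [ENNReal.ofReal_inv_of_pos]
    rw [h2, ← ENNReal.ofReal_mul (by norm_num), ← ENNReal.ofReal_mul (by norm_num),
      ← ENNReal.ofReal_add (by positivity) (by positivity)]
    exact ENNReal.ofReal_le_ofReal (exp_midpoint_mul_le a b s)
  simp only [reproduction_eq hd]
  rw [← lintegral_const_mul _ (by fun_prop), ← lintegral_const_mul _ (by fun_prop),
    ← lintegral_add_left (by fun_prop)]
  refine lintegral_mono fun s => (mul_le_mul_left (hexp s) _).trans_eq ?_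
  ring

lemma SubcriticalMalthus.reproduction_half_lt_one [SFinite G] {α₁ : ℝ}
    (h : SubcriticalMalthus α p G α₁) (hd : BranchingData α p) :
    reproduction α p G (α₁ / 2) < 1 := by
  calc reproduction α p G (α₁ / 2)
      ≤ 2⁻¹ * reproduction α p G 0 + 2⁻¹ * reproduction α p G α₁ := by
        simpa only [zero_add] using reproduction_midpoint_le hd 0 α₁
    _ < 2⁻¹ * 1 + 2⁻¹ * 1 := by
        rw [h.malthus]
        exact ENNReal.add_lt_add_right (by simp)
          (ENNReal.mul_lt_mul_right (by simp) (by simp) h.subcritical)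
    _ = 1 := by rw [mul_one, ENNReal.inv_two_add_inv_two]

lemma integrable_exp_of_lintegral {μ : Measure Pos}
    (h : ∫⁻ x : Pos, ENNReal.ofReal (Real.exp (c * x)) ∂μ < ⊤) :
    Integrable (fun x : Pos => Real.exp (c * x)) μ :=
  ⟨(by fun_prop : Measurable _).aestronglyMeasurable,
    (hasFiniteIntegral_iff_ofReal (.of_forall fun x => (Real.exp_pos _).le)).2 h⟩

lemma exists_subcriticalKernel [SFinite G] (hd : BranchingData α p) (hc : 0 < c)
    (hR : reproduction α p G c < 1)
    (hG : ∫⁻ x : Pos, ENNReal.ofReal (Real.exp (2 * c * x)) ∂G < ⊤) :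
    ∃ κ K, SubcriticalKernel (birthRate α p) G c κ K := by
  obtain ⟨K, hK⟩ := hd.exists_birthRate_bound
  have hRtop : reproduction α p G c ≠ ⊤ := (hR.trans ENNReal.one_lt_top).ne
  refine ⟨(reproduction α p G c).toReal, K, hd.measurable_birthRate, hd.birthRate_nonneg, hK,
    hd.birthRate_zero, hc, ?_, fun t ht => ?_, integrable_exp_of_lintegral hG⟩
  · exact ENNReal.toReal_lt_of_lt_ofReal (by simpa using hR)
  · refine (ENNReal.ofReal_le_iff_le_toReal hRtop).1 ?_
    rw [reproduction_eq hd]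
    exact ofReal_pairing_weightedConv_le hd.measurable_birthRate hd.birthRate_nonneg ht

lemma lintegral_exp_mono {μ : Measure Pos} {a b : ℝ} (hab : a ≤ b) :
    ∫⁻ x : Pos, ENNReal.ofReal (Real.exp (a * x)) ∂μ ≤
      ∫⁻ x : Pos, ENNReal.ofReal (Real.exp (b * x)) ∂μ :=
  lintegral_mono fun x => ENNReal.ofReal_le_ofReal
    (Real.exp_le_exp.2 (mul_le_mul_of_nonneg_right hab (le_of_lt x.2)))

lemma ofReal_expWeight (hc : 0 ≤ c) (ν : PopMeasure) :
    ENNReal.ofReal (expWeight c ν) = ∫⁻ x : Pos, ENNReal.ofReal (Real.exp (c * x)) ∂ν.toM :=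
  ofReal_integral_eq_lintegral_ofReal (ν.integrable_exp hc)
    (.of_forall fun _ => (Real.exp_pos _).le)

lemma memLp_expWeight {L : Measure PopMeasure} (hc : 0 ≤ c)
    (h : ∫⁻ ν, (∫⁻ x : Pos, ENNReal.ofReal (Real.exp (c * x)) ∂ν.toM) ^ 2 ∂L < ⊤) :
    MemLp (expWeight c) 2 L := by
  refine (memLp_two_iff_integrable_sq (measurable_expWeight c).aestronglyMeasurable).2
    ⟨((measurable_expWeight c).pow_const 2).aestronglyMeasurable, ?_⟩
  rw [hasFiniteIntegral_iff_ofReal (.of_forall fun ν => sq_nonneg _)]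
  simpa only [ENNReal.ofReal_pow (expWeight_nonneg c _), ofReal_expWeight hc] using h

end Reproduction

end AgeBranching

theorem mainTheorem5_general {Ω : Type*} {mΩ : MeasurableSpace Ω}
    (Pr : Measure Ω) [IsProbabilityMeasure Pr] (ℱ : Filtration ℝ≥0 mΩ)
    (α : ℝ → ℝ) (p : ℝ → ℕ → ℝ) (hdata : BranchingData α p)
    (G : Measure Pos) [IsProbabilityMeasure G]
    (L : Measure PopMeasure) [IsFiniteMeasure L]
    (c : ℝ) (hc : 0 < c) (hR : reproduction α p G c < 1)
    (hG2 : ∫⁻ x : Pos, ENNReal.ofReal (Real.exp (2 * c * (x : ℝ))) ∂G < ⊤)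
    (hg2 : BddSecondMoment p)
    (hL2 : ∫⁻ ν, (∫⁻ x : Pos, ENNReal.ofReal (Real.exp (c * (x : ℝ))) ∂ν.toM) ^ 2 ∂L < ⊤)
    (σ : PopMeasure) (Y : ℝ≥0 → Ω → PopMeasure) (hY : IsProcess Pr ℱ α p G L σ Y)
    (f : ℝ → ℝ) (hf : BddBorel f) :
    SolvesMean α p G f (meanSemigroup α p G f) ∧
    (∀ x : ℝ, 0 < x → IntegrableOn (fun s => meanSemigroup α p G f s x) (Set.Ioi 0)) ∧
    (∀ᵐ ν ∂L, Integrable (fun x : Pos => totalMean α p G f x) ν.toM) ∧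
    Integrable (fun ν : PopMeasure => pairing ν.toM (totalMean α p G f)) L ∧
    ∀ᵐ ω ∂Pr,
      (∀ t : ℝ, 0 ≤ t → IntervalIntegrable
        (fun s : ℝ => pairing (Y s.toNNReal ω).toM f) volume 0 t) ∧
      Tendsto (fun t : ℝ => t⁻¹ * occupation Y f t ω) atTop
        (𝓝 (∫ ν, pairing ν.toM (totalMean α p G f) ∂L)) := by
  obtain ⟨κ, K, h⟩ := exists_subcriticalKernel hdata hc hR hG2
  obtain ⟨A, hfA⟩ := hf.exists_expBdd hc.le
  have hW : MemLp (expWeight c) 2 L := memLp_expWeight hc.le hL2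
  exact ⟨hdata.solvesMean hf,
    fun x hx => h.integrableOn_meanSemigroup hdata hf hfA hx,
    .of_forall fun ν => (h.expBdd_totalMean hdata hf hfA).integrable hc.le
      (hdata.measurable_totalMean hf) ν,
    h.integrable_pairing_totalMean hdata hf hfA (hW.integrable one_le_two),
    hY.ae_tendsto_occupation hdata hg2 h hW hf⟩

theorem mainTheorem5 {Ω : Type*} {mΩ : MeasurableSpace Ω}
    (Pr : Measure Ω) [IsProbabilityMeasure Pr] (ℱ : Filtration ℝ≥0 mΩ)
    (α : ℝ → ℝ) (p : ℝ → ℕ → ℝ) (hdata : BranchingData α p)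
    (G : Measure Pos) [IsProbabilityMeasure G]
    (L : Measure PopMeasure) [IsFiniteMeasure L]
    (hL0 : L {ν : PopMeasure | ν.toM = 0} = 0)
    (α₁ : ℝ) (hcond : SubcriticalMalthus α p G α₁)
    (hG2 : ∫⁻ x : Pos, ENNReal.ofReal (Real.exp (2 * α₁ * (x : ℝ))) ∂G < ⊤)
    (hg2 : BddSecondMoment p)
    (hL2 : ∫⁻ ν, (∫⁻ x : Pos, ENNReal.ofReal (Real.exp (α₁ * (x : ℝ))) ∂ν.toM) ^ 2 ∂L < ⊤)
    (σ : PopMeasure) (Y : ℝ≥0 → Ω → PopMeasure) (hY : IsProcess Pr ℱ α p G L σ Y)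
    (f : ℝ → ℝ) (hf : BddBorel f) :
    SolvesMean α p G f (meanSemigroup α p G f) ∧
    (∀ x : ℝ, 0 < x → IntegrableOn (fun s => meanSemigroup α p G f s x) (Set.Ioi 0)) ∧
    (∀ᵐ ν ∂L, Integrable (fun x : Pos => totalMean α p G f x) ν.toM) ∧
    Integrable (fun ν : PopMeasure => pairing ν.toM (totalMean α p G f)) L ∧
    ∀ᵐ ω ∂Pr,
      (∀ t : ℝ, 0 ≤ t → IntervalIntegrable
        (fun s : ℝ => pairing (Y s.toNNReal ω).toM f) volume 0 t) ∧
      Tendsto (fun t : ℝ => t⁻¹ * occupation Y f t ω) atTop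
        (𝓝 (∫ ν, pairing ν.toM (totalMean α p G f) ∂L)) := by
  have hhalf : α₁ / 2 ≤ α₁ := half_le_self hcond.pos.le
  exact mainTheorem5_general Pr ℱ α p hdata G L (α₁ / 2) (half_pos hcond.pos)
    (hcond.reproduction_half_lt_one hdata)
    ((lintegral_exp_mono (mul_le_mul_of_nonneg_left hhalf zero_le_two)).trans_lt hG2) hg2
    ((lintegral_mono fun _ => pow_le_pow_left' (lintegral_exp_mono hhalf) 2).trans_lt hL2)
    σ Y hY f hf
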